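/- Let $\mathbb{K}$ be a field of characteristic $0$. For a $\mathbb{Z}$-graded vector space $V$ let $S^c(V)=\bigoplus_{n\ge 0}V^{\odot n}$ be its graded symmetric coalgebra and $p\colon S^c(V)\to V$ the projection. An $L_\infty[1]$ algebra structure on $V$ is a coderivation $Q$ of $S^c(V)$ of degree $1$ with $Q\circ Q=0$ whose Taylor coefficients $q_n=p\circ Q|_{V^{\odot n}}$ satisfy $q_0=0$; its tangent cohomology is $H(V,q_1)$, and it is minimal if $q_1=0$. An $L_\infty[1]$ morphism $(V,Q)\dashrightarrow(W,R)$ is a morphism $F$ of counital coaugmented DG coalgebras $(S^c(V),Q)\to(S^c(W),R)$; it is a weak equivalence if its linear part $f_1\colon(V,q_1)\to(W,r_1)$ is a quasi-isomorphism. A minimal model of $(V,Q)$ is a weak equivalence $(W,R)\dashrightarrow(V,Q)$ with $(W,R)$ minimal. $(V,Q)$ is formal if there is a weak equivalence from $(V,Q)$ to $(H(V,q_1),0,r_2,0,0,\ldots)$, where $r_2([v],[w])=[q_2(v,w)]$. If $(W,R)$ is minimal and $e_1,\ldots,e_n$ is a basis of $W^0$, the Kuranishi algebra of $(W,R)$ is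 $\mathbb{K}[[x_1,\ldots,x_n]]/I$, where $I$ is the ideal generated by the power series \[\sum_{i_1,\ldots,i_n\ge 0}\frac{\varphi\bigl(r_{i_1+\cdots+i_n}(e_1^{\odot i_1}\odot\cdots\odot e_n^{\odot i_n})\bigr)}{i_1!\cdots i_n!}\,x_1^{i_1}\cdots x_n^{i_n},\qquad \varphi\in (W^1)^\vee .\] A $\mathbb{K}$-algebra is quadratic if it is isomorphic to $\mathbb{K}[[x_1,\ldots,x_n]]/J$ for some $n\ge 0$ and some ideal $J$ generated by homogeneous polynomials of degree two. Theorem. Let $(V,Q)$ be an $L_\infty[1]$ algebra over $\mathbb{K}$ whose tangent cohomology $H(V,q_1)$ is finite dimensional and concentrated in degrees $0$ and $1$. Then $(V,Q)$ has a minimal model whose underlying graded space is $H(V,q_1)$, and for every minimal model $(W,R)\dashrightarrow(V,Q)$ (and every basis of $W^0$), $(V,Q)$ is formal if and only if the Kuranishi algebra of $(W,R)$ is quadratic. -/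

import Mathlib

open scoped DirectSum TensorProduct

universe u v w

noncomputable section

/-! ### The graded symmetric coalgebra of a graded vector space -/

section GradedSymmetric

variable {K : Type u} [Field K] {V : Type v} [AddCommGroup V] [Module K V]
variable (𝒱 : ℤ → Submodule K V)

/-- The relations `v ⊙ w = (-1)^{|v||w|} w ⊙ v` for homogeneous `v`, `w`. -/
inductive GSymRel : TensorAlgebra K V → TensorAlgebra K V → Prop
  | swap {i j : ℤ} {v w : V} (hv : v ∈ 𝒱 i) (hw : w ∈ 𝒱 j) :
      GSymRel (TensorAlgebra.ι K v * TensorAlgebra.ι K w)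
        ((-1 : ℤˣ) ^ (i * j) • (TensorAlgebra.ι K w * TensorAlgebra.ι K v))

/-- The space `S(V) = ⨁ₙ V^{⊙n}`, constructed as the quotient of the tensor algebra by the Koszul
commutation relations. -/
def GSym : Type (max u v) := RingQuot (GSymRel 𝒱)

namespace GSym

instance instRing : Ring (GSym 𝒱) := inferInstanceAs (Ring (RingQuot (GSymRel 𝒱)))

instance instAlgebra : Algebra K (GSym 𝒱) := inferInstanceAs (Algebra K (RingQuot (GSymRel 𝒱)))

/-- The inclusion `V = V^{⊙1} → S(V)`. -/
def ι : V →ₗ[K] GSym 𝒱 :=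
  (RingQuot.mkAlgHom K (GSymRel 𝒱)).toLinearMap ∘ₗ TensorAlgebra.ι K

theorem ι_mul_ι {i j : ℤ} {v w : V} (hv : v ∈ 𝒱 i) (hw : w ∈ 𝒱 j) :
    ι 𝒱 v * ι 𝒱 w = (-1 : ℤˣ) ^ (i * j) • (ι 𝒱 w * ι 𝒱 v) := by
  have h := RingQuot.mkAlgHom_rel K (GSymRel.swap (𝒱 := 𝒱) hv hw)
  rw [Units.smul_def, map_zsmul, map_mul, map_mul, ← Units.smul_def] at h
  exact h

variable {A : Type w} [Ring A] [Algebra K A]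

/-- The universal property of `S(V)` as an algebra. -/
def lift (f : V →ₗ[K] A)
    (hf : ∀ ⦃i j : ℤ⦄ ⦃v w : V⦄, v ∈ 𝒱 i → w ∈ 𝒱 j →
      f v * f w = (-1 : ℤˣ) ^ (i * j) • (f w * f v)) : GSym 𝒱 →ₐ[K] A :=
  RingQuot.liftAlgHom K ⟨TensorAlgebra.lift K f, by
    rintro _ _ ⟨hv, hw⟩
    rw [Units.smul_def, map_zsmul, map_mul, map_mul, ← Units.smul_def]
    simpa using hf hv hw⟩

theorem lift_ι (f : V →ₗ[K] A) (hf) (v : V) : lift 𝒱 f hf (ι 𝒱 v) = f v := by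
  refine (RingQuot.liftAlgHom_mkAlgHom_apply K _ _ _).trans ?_
  simp

variable {𝒱} in
theorem algHom_ext {f g : GSym 𝒱 →ₐ[K] A} (h : ∀ v, f (ι 𝒱 v) = g (ι 𝒱 v)) : f = g := by
  refine RingQuot.ringQuot_ext' (S := K) (s := GSymRel 𝒱) f g ?_
  refine TensorAlgebra.hom_ext ?_
  ext v
  exact h v

/-- The homogeneous elements of degree `k` of `S(V)`: the span of the products
`v₁ ⊙ ⋯ ⊙ vₙ` of homogeneous vectors with `|v₁| + ⋯ + |vₙ| = k`. -/
def degree (k : ℤ) : Submodule K (GSym 𝒱) :=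
  Submodule.span K {x | ∃ l : List (ℤ × V), (∀ a ∈ l, a.2 ∈ 𝒱 a.1) ∧
    (l.map Prod.fst).sum = k ∧ x = (l.map fun a => ι 𝒱 a.2).prod}

theorem ι_mem_degree {i : ℤ} {v : V} (hv : v ∈ 𝒱 i) : ι 𝒱 v ∈ degree 𝒱 i :=
  Submodule.subset_span ⟨[(i, v)], by simpa using hv, by simp, by simp⟩

theorem prod_mem_degree (l : List (ℤ × V)) (hl : ∀ a ∈ l, a.2 ∈ 𝒱 a.1) :
    (l.map fun a => ι 𝒱 a.2).prod ∈ degree 𝒱 (l.map Prod.fst).sum :=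
  Submodule.subset_span ⟨l, hl, rfl, rfl⟩

instance instGradedMonoid : SetLike.GradedMonoid (degree 𝒱) where
  one_mem := Submodule.subset_span ⟨[], by simp, by simp, by simp⟩
  mul_mem := by
    intro i j x y hx hy
    have h := Submodule.mul_mem_mul hx hy
    rw [degree, degree, Submodule.span_mul_span] at h
    refine Submodule.span_mono ?_ h
    rintro _ ⟨_, ⟨l, hl, hi, rfl⟩, _, ⟨l', hl', hj, rfl⟩, rfl⟩
    refine ⟨l ++ l', ?_, by simp [hi, hj], by simp⟩
    intro a ha
    rcases List.mem_append.1 ha with h | h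
    exacts [hl a h, hl' a h]

/-- The counit `S(V) → V^{⊙0} = K`. -/
def counit : GSym 𝒱 →ₐ[K] K := lift 𝒱 0 (by simp)

/-- The projection `p : S(V) → V^{⊙1} = V`. -/
def proj : GSym 𝒱 →ₗ[K] V := by
  letI : Module Kᵐᵒᵖ V := Module.compHom _ ((RingHom.id K).fromOpposite mul_comm)
  haveI : IsCentralScalar K V := ⟨fun r m => rfl⟩
  exact (TrivSqZeroExt.sndHom K V).comp
    (lift 𝒱 (TrivSqZeroExt.inrHom K V) (by simp)).toLinearMap

theorem proj_ι (v : V) : proj 𝒱 (ι 𝒱 v) = v := by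
  simp [proj, lift_ι]

theorem proj_one : proj 𝒱 1 = 0 := by
  let _i : Module Kᵐᵒᵖ V := Module.compHom _ ((RingHom.id K).fromOpposite mul_comm)
  have _j : IsCentralScalar K V := ⟨fun r m => rfl⟩
  exact congrArg TrivSqZeroExt.snd
    (map_one (lift 𝒱 (TrivSqZeroExt.inrHom K V) (by simp)))

theorem proj_ι_mul_ι_mul (v w : V) (x : GSym 𝒱) : proj 𝒱 (ι 𝒱 v * (ι 𝒱 w * x)) = 0 := by
  simp [proj, lift_ι]

theorem proj_mem {k : ℤ} {x : GSym 𝒱} (hx : x ∈ degree 𝒱 k) : proj 𝒱 x ∈ 𝒱 k := by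
  suffices h : degree 𝒱 k ≤ (𝒱 k).comap (proj 𝒱) from h hx
  refine Submodule.span_le.2 ?_
  rintro _ ⟨l, hl, rfl, rfl⟩
  match l, hl with
  | [], _ => simp [proj_one]
  | [a], hl => simpa [proj_ι] using hl a
  | a :: b :: l, _ => simp [proj_ι_mul_ι_mul]

variable [DirectSum.Decomposition 𝒱]

/-- The map `V → ⨁ₖ S(V)ᵏ` induced by the inclusion `V → S(V)`. -/
def gradedι : V →ₗ[K] ⨁ k, degree 𝒱 k :=
  DirectSum.toModule K ℤ _ (fun i =>
    DirectSum.lof K ℤ (fun k => degree 𝒱 k) i ∘ₗ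
      (ι 𝒱).restrict (p := 𝒱 i) (q := degree 𝒱 i) fun _ hv => ι_mem_degree 𝒱 hv) ∘ₗ
    (DirectSum.decomposeLinearEquiv 𝒱).toLinearMap

theorem gradedι_of_mem {i : ℤ} {v : V} (hv : v ∈ 𝒱 i) :
    gradedι 𝒱 v = DirectSum.of (fun k => degree 𝒱 k) i ⟨ι 𝒱 v, ι_mem_degree 𝒱 hv⟩ := by
  simp only [gradedι, LinearMap.comp_apply, LinearEquiv.coe_coe,
    DirectSum.decomposeLinearEquiv_apply, DirectSum.decompose_of_mem 𝒱 hv]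
  rw [← DirectSum.lof_eq_of K, DirectSum.toModule_lof]
  rfl

/-- The algebra map `S(V) → ⨁ₖ S(V)ᵏ`. -/
def toDirectSum : GSym 𝒱 →ₐ[K] ⨁ k, degree 𝒱 k :=
  lift 𝒱 (A := ⨁ k, degree 𝒱 k) (gradedι 𝒱) (by
    intro i j v w hv hw
    rw [gradedι_of_mem 𝒱 hv, gradedι_of_mem 𝒱 hw, DirectSum.of_mul_of, DirectSum.of_mul_of,
      Units.smul_def]
    refine Eq.trans ?_ (map_zsmul (DirectSum.of (fun k => degree 𝒱 k) (j + i)) _ _)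
    refine DirectSum.of_eq_of_gradedMonoid_eq (Sigma.subtype_ext (add_comm _ _) ?_)
    have h := ι_mul_ι 𝒱 hv hw
    rw [Units.smul_def] at h
    exact h)

theorem toDirectSum_prod (l : List (ℤ × V)) (hl : ∀ a ∈ l, a.2 ∈ 𝒱 a.1) :
    toDirectSum 𝒱 (l.map fun a => ι 𝒱 a.2).prod =
      DirectSum.of (fun k => degree 𝒱 k) (l.map Prod.fst).sum ⟨_, prod_mem_degree 𝒱 l hl⟩ := by
  induction l with
  | nil => exact map_one _
  | cons a l ih =>
    have h1 : toDirectSum 𝒱 (ι 𝒱 a.2) = _ :=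
      (lift_ι 𝒱 _ _ _).trans (gradedι_of_mem 𝒱 (hl a List.mem_cons_self))
    have h2 : toDirectSum 𝒱 ((a :: l).map fun a => ι 𝒱 a.2).prod = _ :=
      (congrArg (toDirectSum 𝒱) List.prod_cons).trans (map_mul _ _ _)
    rw [h2, h1, ih fun b hb => hl b (List.mem_cons_of_mem _ hb), DirectSum.of_mul_of]
    exact DirectSum.of_eq_of_gradedMonoid_eq (Sigma.subtype_ext List.sum_cons.symm List.prod_cons.symm)

/-- `S(V)` is a graded algebra. -/
instance instGradedAlgebra : GradedAlgebra (degree 𝒱) :=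
  GradedAlgebra.ofAlgHom _ (toDirectSum 𝒱)
    (by
      refine algHom_ext fun v => ?_
      induction v using DirectSum.Decomposition.inductionOn 𝒱 with
      | zero => simp
      | homogeneous v =>
        simp only [AlgHom.comp_apply, AlgHom.id_apply, toDirectSum, lift_ι]
        rw [gradedι_of_mem 𝒱 v.2, DirectSum.coeAlgHom_of]
      | add v w hv hw => rw [map_add, map_add, hv, hw, map_add])
    (by
      rintro i ⟨x, hx⟩
      induction hx using Submodule.span_induction with
      | mem x h =>
        obtain ⟨l, hl, rfl, rfl⟩ := h
        exact toDirectSum_prod 𝒱 l hl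
      | zero =>
        simp only [map_zero]
        exact (map_zero (DirectSum.of (fun k => degree 𝒱 k) i)).symm
      | add x y hx hy ihx ihy =>
        simp only [map_add, ihx, ihy]
        rw [← map_add]; rfl
      | smul c x hx ih =>
        simp only [map_smul, ih]
        rw [← DirectSum.lof_eq_of K, ← map_smul]; rfl)

/-- The coproduct of `S(V)` as an algebra map into the tensor product `S(V) ⊗ S(V)` with the
Koszul multiplication `(a ⊗ b)(a' ⊗ b') = (-1)^{|b||a'|} aa' ⊗ bb'`; it is determined by
`Δ v = v ⊗ 1 + 1 ⊗ v`, hence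
`Δ (v₁ ⊙ ⋯ ⊙ vₙ) = ∑ ± (v_{σ(1)} ⊙ ⋯ ⊙ v_{σ(k)}) ⊗ (v_{σ(k+1)} ⊙ ⋯ ⊙ v_{σ(n)})`,
the sum over all unshuffles `σ` with their Koszul signs. -/
def comulAlgHom : GSym 𝒱 →ₐ[K] (degree 𝒱) ᵍ⊗[K] (degree 𝒱) :=
  lift 𝒱
    ((GradedTensorProduct.includeLeft (degree 𝒱) (degree 𝒱)).toLinearMap ∘ₗ ι 𝒱 +
      (GradedTensorProduct.includeRight (degree 𝒱) (degree 𝒱)).toLinearMap ∘ₗ ι 𝒱)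
    (by
      intro i j v w hv hw
      have hl := congrArg (GradedTensorProduct.includeLeft (degree 𝒱) (degree 𝒱))
        (ι_mul_ι 𝒱 hv hw)
      have hr := congrArg (GradedTensorProduct.includeRight (degree 𝒱) (degree 𝒱))
        (ι_mul_ι 𝒱 hv hw)
      have h1 := GradedTensorProduct.tmul_coe_mul_coe_tmul (R := K) (degree 𝒱) (degree 𝒱) 1
        ⟨ι 𝒱 v, ι_mem_degree 𝒱 hv⟩ ⟨ι 𝒱 w, ι_mem_degree 𝒱 hw⟩ 1
      have h2 := GradedTensorProduct.tmul_coe_mul_coe_tmul (R := K) (degree 𝒱) (degree 𝒱) 1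
        ⟨ι 𝒱 w, ι_mem_degree 𝒱 hw⟩ ⟨ι 𝒱 v, ι_mem_degree 𝒱 hv⟩ 1
      have h3 := GradedTensorProduct.tmul_one_mul_one_tmul (R := K) (degree 𝒱) (degree 𝒱)
        (ι 𝒱 v) (ι 𝒱 w)
      have h4 := GradedTensorProduct.tmul_one_mul_one_tmul (R := K) (degree 𝒱) (degree 𝒱)
        (ι 𝒱 w) (ι 𝒱 v)
      simp only [one_mul, mul_one] at h1 h2
      rw [Units.smul_def, map_zsmul, ← Units.smul_def, map_mul, map_mul] at hl hr
      simp only [LinearMap.add_apply, LinearMap.comp_apply, AlgHom.toLinearMap_apply, add_mul,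
        mul_add, smul_add]
      rw [hl, hr]
      simp only [GradedTensorProduct.includeLeft_apply, GradedTensorProduct.includeRight_apply]
      rw [h1, h2, h3, h4, mul_comm j i, smul_smul, Int.units_mul_self, one_smul]
      abel)

/-- The coproduct `Δ : S(V) → S(V) ⊗ S(V)`. -/
def comul : GSym 𝒱 →ₗ[K] GSym 𝒱 ⊗[K] GSym 𝒱 :=
  (GradedTensorProduct.of K (degree 𝒱) (degree 𝒱)).symm.toLinearMap ∘ₗ
    (comulAlgHom 𝒱).toLinearMap

/-- The sign operator `a ↦ (-1)^{|a|} a` on `S(V)`. -/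
def sign : GSym 𝒱 →ₗ[K] GSym 𝒱 :=
  DirectSum.toModule K ℤ (GSym 𝒱) (fun k => (-1 : K) ^ k • (degree 𝒱 k).subtype) ∘ₗ
    (DirectSum.decomposeLinearEquiv (degree 𝒱)).toLinearMap

end GSym

end GradedSymmetric

/-! ### Cohomology of a graded vector space with an operator of degree one -/

section Cohomology

variable {K : Type u} [Field K] {V : Type v} [AddCommGroup V] [Module K V]
variable (𝒱 : ℤ → Submodule K V) (d : V →ₗ[K] V)

/-- The cohomology `ker d / im d`. -/
abbrev GCohomology : Type v :=
  LinearMap.ker d ⧸ (LinearMap.range d).submoduleOf (LinearMap.ker d)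

namespace GCohomology

/-- The cohomology class of a cocycle. -/
abbrev mk : LinearMap.ker d →ₗ[K] GCohomology d :=
  ((LinearMap.range d).submoduleOf (LinearMap.ker d)).mkQ

/-- `Hⁱ`: the classes of the cocycles of degree `i`. -/
def degree (i : ℤ) : Submodule K (GCohomology d) :=
  ((𝒱 i).submoduleOf (LinearMap.ker d)).map (mk d)

variable [DirectSum.Decomposition 𝒱]

/-- The projection of `V` onto `Vⁱ`, as an endomorphism of `V`. -/
def component (i : ℤ) : V →ₗ[K] V :=
  (𝒱 i).subtype ∘ₗ DirectSum.component K ℤ (fun k => 𝒱 k) i ∘ₗ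
    (DirectSum.decomposeLinearEquiv 𝒱).toLinearMap

theorem component_apply (i : ℤ) (v : V) :
    component 𝒱 i v = (DirectSum.decompose 𝒱 v i : V) := rfl

variable {𝒱 d}

theorem map_component (hd : ∀ ⦃i : ℤ⦄ ⦃v : V⦄, v ∈ 𝒱 i → d v ∈ 𝒱 (i + 1)) (i : ℤ) (v : V) :
    d (component 𝒱 i v) = component 𝒱 (i + 1) (d v) := by
  simp only [component_apply]
  induction v using DirectSum.Decomposition.inductionOn 𝒱 with
  | zero => simp
  | @homogeneous j v =>
    by_cases h : j = i
    · subst h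
      rw [DirectSum.decompose_of_mem_same 𝒱 v.2, DirectSum.decompose_of_mem_same 𝒱 (hd v.2)]
    · rw [DirectSum.decompose_of_mem_ne 𝒱 v.2 h,
        DirectSum.decompose_of_mem_ne 𝒱 (hd v.2) (by omega), map_zero]
  | add v w hv hw => simp [hv, hw]

/-- The projection induced on cocycles. -/
def cocycleComponent (hd : ∀ ⦃i : ℤ⦄ ⦃v : V⦄, v ∈ 𝒱 i → d v ∈ 𝒱 (i + 1)) (i : ℤ) :
    LinearMap.ker d →ₗ[K] LinearMap.ker d :=
  (component 𝒱 i).restrict fun v hv => by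
    rw [LinearMap.mem_ker] at hv ⊢
    rw [map_component hd, hv, map_zero]

/-- The projection induced on cohomology. -/
def cohomologyComponent (hd : ∀ ⦃i : ℤ⦄ ⦃v : V⦄, v ∈ 𝒱 i → d v ∈ 𝒱 (i + 1)) (i : ℤ) :
    GCohomology d →ₗ[K] GCohomology d :=
  Submodule.mapQ _ _ (cocycleComponent hd i) (by
    rintro ⟨_, hv⟩ ⟨w, rfl⟩
    refine ⟨component 𝒱 (i - 1) w, ?_⟩
    rw [map_component hd, sub_add_cancel]
    rfl)

theorem isInternal (hd : ∀ ⦃i : ℤ⦄ ⦃v : V⦄, v ∈ 𝒱 i → d v ∈ 𝒱 (i + 1)) :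
    DirectSum.IsInternal (degree 𝒱 d) := by
  classical
  constructor
  · have key : ∀ i (x : ⨁ k, degree 𝒱 d k),
        cohomologyComponent hd i (DirectSum.coeLinearMap (degree 𝒱 d) x) = (x i : GCohomology d) := by
      intro i x
      induction x using DirectSum.induction_on with
      | zero => simp
      | of j y =>
        obtain ⟨_, ⟨z, hz, rfl⟩⟩ := y
        rw [← DirectSum.lof_eq_of K, DirectSum.coeLinearMap_lof]
        refine (Submodule.mapQ_apply _ _ _ _).trans ?_
        by_cases h : j = i
        · subst h
          rw [DirectSum.lof_eq_of, DirectSum.of_eq_same]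
          refine congrArg (mk d) (Subtype.ext ?_)
          exact DirectSum.decompose_of_mem_same 𝒱 hz
        · rw [DirectSum.lof_eq_of, DirectSum.of_eq_of_ne _ _ _ (Ne.symm h)]
          have h0 : cocycleComponent hd i z = 0 :=
            Subtype.ext (DirectSum.decompose_of_mem_ne 𝒱 hz h)
          rw [h0]
          simp
      | add x y hx hy => simp [hx, hy]
    intro x y hxy
    refine DFinsupp.ext fun i => Subtype.ext ?_
    rw [← key i x, ← key i y]
    exact congrArg _ hxy
  · intro x
    obtain ⟨z, rfl⟩ := Submodule.mkQ_surjective _ x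
    change _ ∈ LinearMap.range (DirectSum.coeLinearMap (degree 𝒱 d))
    rw [DirectSum.range_coeLinearMap]
    have hz : z = ∑ i ∈ (DirectSum.decompose 𝒱 (z : V)).support, cocycleComponent hd i z := by
      refine Subtype.ext ?_
      conv_lhs => rw [← DirectSum.sum_support_decompose 𝒱 (z : V)]
      rw [AddSubmonoidClass.coe_finsetSum]
      rfl
    rw [hz, map_sum]
    refine Submodule.sum_mem _ fun i _ => Submodule.mem_iSup_of_mem i ?_
    exact ⟨_, (DirectSum.decompose 𝒱 (z : V) i).2, rfl⟩

end GCohomology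

end Cohomology

/-! ### `L∞[1]` algebras -/

section LInftyOne

variable {K : Type u} [Field K]
variable {V : Type v} [AddCommGroup V] [Module K V] (𝒱 : ℤ → Submodule K V)
  [DirectSum.Decomposition 𝒱]
variable {W : Type w} [AddCommGroup W] [Module K W] (𝒲 : ℤ → Submodule K W)
  [DirectSum.Decomposition 𝒲]

/-- An `L∞[1]` algebra structure on the graded space `V`: a coderivation `Q` of degree `1` of the
symmetric coalgebra with `q₀ = 0` and `Q ∘ Q = 0`. -/
structure LInftyOne where
  /-- The coderivation `Q`. -/
  Q : GSym 𝒱 →ₗ[K] GSym 𝒱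
  map_degree : ∀ ⦃k : ℤ⦄ ⦃x : GSym 𝒱⦄, x ∈ GSym.degree 𝒱 k → Q x ∈ GSym.degree 𝒱 (k + 1)
  /-- `Δ Q = (Q ⊗ id + id ⊗ Q) Δ`, with `(id ⊗ Q)(a ⊗ b) = (-1)^{|a|} a ⊗ Q b`. -/
  comul_comp : GSym.comul 𝒱 ∘ₗ Q =
    (TensorProduct.map Q LinearMap.id + TensorProduct.map (GSym.sign 𝒱) Q) ∘ₗ GSym.comul 𝒱
  map_one : GSym.proj 𝒱 (Q 1) = 0
  comp_self : Q ∘ₗ Q = 0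

variable {𝒱 𝒲}

namespace LInftyOne

variable (X : LInftyOne 𝒱) (Y : LInftyOne 𝒲)

/-- The Taylor coefficient `qₙ`, `qₙ(v₁, …, vₙ) = p (Q (v₁ ⊙ ⋯ ⊙ vₙ))`. -/
def taylor (n : ℕ) (v : Fin n → V) : V :=
  GSym.proj 𝒱 (X.Q (List.ofFn fun i => GSym.ι 𝒱 (v i)).prod)

/-- The linear part `q₁`, the differential of the tangent complex. -/
def q₁ : V →ₗ[K] V := GSym.proj 𝒱 ∘ₗ X.Q ∘ₗ GSym.ι 𝒱

theorem q₁_mem ⦃i : ℤ⦄ ⦃v : V⦄ (hv : v ∈ 𝒱 i) : X.q₁ v ∈ 𝒱 (i + 1) :=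
  GSym.proj_mem 𝒱 (X.map_degree (GSym.ι_mem_degree 𝒱 hv))

/-- The tangent cohomology `H(V, q₁)`. -/
abbrev TangentCohomology : Type v := GCohomology X.q₁

/-- The grading of the tangent cohomology. -/
abbrev cohomologyDegree : ℤ → Submodule K X.TangentCohomology := GCohomology.degree 𝒱 X.q₁

instance : DirectSum.Decomposition X.cohomologyDegree :=
  (GCohomology.isInternal X.q₁_mem).chooseDecomposition

/-- `(V, Q)` is minimal if `q₁ = 0`. -/
def IsMinimal : Prop := X.q₁ = 0

/-- An `L∞[1]` morphism `(V, Q) ⇢ (W, R)`: a morphism of counital coaugmented DG coalgebras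
`(S(V), Q) → (S(W), R)`. -/
structure Hom where
  /-- The underlying linear map. -/
  F : GSym 𝒱 →ₗ[K] GSym 𝒲
  map_degree : ∀ ⦃k : ℤ⦄ ⦃x : GSym 𝒱⦄, x ∈ GSym.degree 𝒱 k → F x ∈ GSym.degree 𝒲 k
  map_one : F 1 = 1
  counit_map : ∀ x, GSym.counit 𝒲 (F x) = GSym.counit 𝒱 x
  comul_comp : GSym.comul 𝒲 ∘ₗ F = TensorProduct.map F F ∘ₗ GSym.comul 𝒱
  comm : F ∘ₗ X.Q = Y.Q ∘ₗ F

variable {X Y}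

/-- The linear part `f₁` of a morphism. -/
def Hom.f₁ (F : Hom X Y) : V →ₗ[K] W := GSym.proj 𝒲 ∘ₗ F.F ∘ₗ GSym.ι 𝒱

/-- `F` is a weak equivalence if `f₁ : (V, q₁) → (W, r₁)` is a quasi-isomorphism, that is, the map
`[v] ↦ [f₁ v]` of cohomologies is injective and surjective. -/
def Hom.IsWeakEquivalence (F : Hom X Y) : Prop :=
  (∀ v, X.q₁ v = 0 → F.f₁ v ∈ LinearMap.range Y.q₁ → v ∈ LinearMap.range X.q₁) ∧
    ∀ w, Y.q₁ w = 0 → ∃ v, X.q₁ v = 0 ∧ w - F.f₁ v ∈ LinearMap.range Y.q₁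

variable (X)

/-- `F : (W, R) ⇢ (V, Q)` is a minimal model of `(V, Q)`. -/
def IsMinimalModel {Y : LInftyOne 𝒲} (F : Hom Y X) : Prop :=
  Y.IsMinimal ∧ F.IsWeakEquivalence

/-- `R` is the `L∞[1]` structure `(H(V, q₁), 0, r₂, 0, 0, …)` whose only non-zero Taylor coefficient
is the bracket `r₂([v], [w]) = [q₂(v, w)]`. -/
def IsCohomologyStructure (R : LInftyOne X.cohomologyDegree) : Prop :=
  (∀ n, n ≠ 2 → ∀ x, R.taylor n x = 0) ∧
    ∀ v w : LinearMap.ker X.q₁, ∃ z : LinearMap.ker X.q₁, (z : V) = X.taylor 2 ![↑v, ↑w] ∧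
      R.taylor 2 ![GCohomology.mk X.q₁ v, GCohomology.mk X.q₁ w] = GCohomology.mk X.q₁ z

/-- `(V, Q)` is formal: there is a weak equivalence `(V, Q) ⇢ (H(V, q₁), 0, r₂, 0, 0, …)`. -/
def IsFormal : Prop :=
  ∃ R : LInftyOne X.cohomologyDegree, X.IsCohomologyStructure R ∧
    ∃ F : Hom X R, F.IsWeakEquivalence

/-- For a basis `e₁, …, eₙ` of `V⁰` and `φ ∈ (V¹)^∨`, the power series
`∑_I φ(q_{|I|}(e₁^{⊙ i₁} ⊙ ⋯ ⊙ eₙ^{⊙ iₙ})) / I! · x^I`, which is the transpose of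
`∑ₖ qₖ : ⨁ₖ (V⁰)^{⊙k} → V¹` evaluated at `φ`. -/
def kuranishiSeries {n : ℕ} (e : Module.Basis (Fin n) K (𝒱 0)) (φ : Module.Dual K (𝒱 1)) :
    MvPowerSeries (Fin n) K := fun I =>
  (∏ i, ((I i).factorial : K))⁻¹ *
    φ (DirectSum.decompose 𝒱
      (GSym.proj 𝒱 (X.Q (List.ofFn fun i => GSym.ι 𝒱 (e i : V) ^ I i).prod)) 1)

/-- The ideal of `K[[x₁, …, xₙ]]` generated by the image of `(V¹)^∨`. -/
def kuranishiIdeal {n : ℕ} (e : Module.Basis (Fin n) K (𝒱 0)) : Ideal (MvPowerSeries (Fin n) K) :=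
  Ideal.span (Set.range (X.kuranishiSeries e))

/-- The Kuranishi algebra `K[[x₁, …, xₙ]] / I` of a minimal `L∞[1]` algebra, computed in a basis of
its degree zero part. -/
abbrev KuranishiAlgebra {n : ℕ} (e : Module.Basis (Fin n) K (𝒱 0)) : Type u :=
  MvPowerSeries (Fin n) K ⧸ X.kuranishiIdeal e

end LInftyOne

/-- A `K`-algebra is quadratic if it is isomorphic to `K[[x₁, …, xₙ]] / I` with `I` generated by
homogeneous polynomials of degree two. -/
def IsQuadraticAlgebra (K : Type u) [Field K] (A : Type w) [CommRing A] [Algebra K A] : Prop :=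
  ∃ (n : ℕ) (S : Set (MvPolynomial (Fin n) K)), (∀ f ∈ S, f.IsHomogeneous 2) ∧
    Nonempty (A ≃ₐ[K] MvPowerSeries (Fin n) K ⧸
      Ideal.span ((fun f : MvPolynomial (Fin n) K => (f : MvPowerSeries (Fin n) K)) '' S))

end LInftyOne

end

noncomputable section

set_option linter.unusedSectionVars false
set_option linter.unusedSimpArgs false

/-! In characteristic zero `S(V)` is cofree: a coalgebra morphism is determined by its corestriction
(`coalgHom_ext`), and every degree-zero corestriction vanishing at `1` integrates to one by the
convolution exponential (`cexp_isCoalgHom`). Coderivations are likewise determined by their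
corestriction (`Q_eq`). Constructing `L∞[1]` morphisms thus becomes a question about corestrictions.
A morphism with bijective linear part is invertible, by comparing terms of highest weight, so weak
equivalences between minimal algebras are isomorphisms.

Minimal model. Write `H` for the tangent cohomology. As `H` lives in degrees 0 and 1, a
corestriction `S(V) → H` has a part `g` into `H⁰`, which must kill the image of `Q`, and a part into
`H¹`, which must satisfy one linear equation for each `x` of degree 0. Both problems are solved by
factoring linear maps (`exists_hom_of_zeroPart`, `exists_hom_ofZeroPart`), the brackets on `H` being
chosen along the way. The consistency conditions say that certain classes `π v` with `Q x = ι v`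
vanish. They follow by lowering the weight of `x` with corrections `Q y`, which exist by the Künneth
theorem for symmetric powers (`mem_range_extend`). The resulting morphism `G` from `V` to `H` is
reversed by an automorphism of `S(V)` that splits `V` into `H` and a linear contractible complex
(`exists_hom_of_cohomology`).

Kuranishi algebra. A power series is the same as a linear functional on `S(V⁰)`, convolution
becoming multiplication (`series_conv`). In the absence of negative degrees, and with `V¹` finite
dimensional, the Kuranishi ideal is exactly the annihilator of `ker Q` in `S(V⁰)`
(`mem_kuranishiIdeal_iff`). Hence isomorphic algebras have isomorphic Kuranishi algebras. If `V` is
formal, any minimal model is isomorphic to an algebra with only a binary bracket, whose Kuranishi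
ideal is generated by quadrics.

Conversely, let the Kuranishi ideal `I` be matched with an ideal `J` generated by quadrics. Both
ideals lie in the square of the maximal ideal, so the algebra isomorphism lifts to a coordinate
change, that is, to a coalgebra morphism `G` of `S(V⁰)`; a choice of basis makes its linear part the
identity. To extend `G` to a morphism onto the quadratic part, one needs `q₂` of the weight-two part
of `G x` to equal `v` whenever `Q x = ι v`. An element of `J` agrees with its quadratic part modulo
`𝔪 J`, whose pullback lies in `𝔪 I`, and `𝔪 I` vanishes on such `x` (`functional_wcomp_two`,
`exists_hom_quadratic`). Finally the quadratic part is the bracket of the cohomology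
(`q_ι_mul_ι_of_hom`). -/

namespace GSym

/-! ### Koszul signs and the coproduct of a product. -/

section Basic

variable {K : Type u} [Field K] {V : Type v} [AddCommGroup V] [Module K V]
variable (𝒱 : ℤ → Submodule K V) [DirectSum.Decomposition 𝒱]

theorem intUnits_smul_eq {M : Type*} [AddCommGroup M] [Module K M] (n : ℤ) (x : M) :
    (-1 : ℤˣ) ^ n • x = (-1 : K) ^ n • x := by
  rcases Int.even_or_odd n with h | h
  · rw [h.neg_one_zpow, h.neg_one_zpow, one_smul, one_smul]
  · rw [h.neg_one_zpow, h.neg_one_zpow, neg_smul, one_smul, Units.smul_def]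
    simp

variable {𝒱} in
/-- Left induction along products of homogeneous vectors. -/
theorem induction {P : GSym 𝒱 → Prop} (one : P 1) (add : ∀ x y, P x → P y → P (x + y))
    (smul : ∀ (c : K) x, P x → P (c • x))
    (ι_mul : ∀ (i : ℤ) (v : V), v ∈ 𝒱 i → ∀ x, P x → P (ι 𝒱 v * x)) (x : GSym 𝒱) : P x := by
  let M : Submodule K (GSym 𝒱) :=
    { carrier := {x | P x}
      add_mem' := fun {a b} ha hb => add a b ha hb
      zero_mem' := by simpa using smul 0 1 one
      smul_mem' := fun c x hx => smul c x hx }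
  have hd : ∀ k, degree 𝒱 k ≤ M := by
    intro k
    refine Submodule.span_le.2 ?_
    rintro _ ⟨l, hl, -, rfl⟩
    induction l with
    | nil => exact one
    | cons a l ih =>
      rw [List.map_cons, List.prod_cons]
      exact ι_mul a.1 a.2 (hl a (by simp)) _ (ih fun b hb => hl b (by simp [hb]))
  induction x using DirectSum.Decomposition.inductionOn (degree 𝒱) with
  | zero => exact M.zero_mem
  | homogeneous y => exact hd _ y.2
  | add x y hx hy => exact add x y hx hy

variable {𝒱} in
theorem linearMap_ext {N : Type*} [AddCommGroup N] [Module K N] {f g : GSym 𝒱 →ₗ[K] N}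
    (one : f 1 = g 1)
    (ι_mul : ∀ (i : ℤ) (v : V), v ∈ 𝒱 i → ∀ x, f x = g x → f (ι 𝒱 v * x) = g (ι 𝒱 v * x)) :
    f = g :=
  LinearMap.ext (induction one (fun x y hx hy => by rw [map_add, map_add, hx, hy])
    (fun c x hx => by rw [map_smul, map_smul, hx]) ι_mul)

/-- The operator `a ↦ (-1)^{i|a|} a`. -/
def sgn (i : ℤ) : GSym 𝒱 →ₗ[K] GSym 𝒱 :=
  DirectSum.toModule K ℤ (GSym 𝒱) (fun k => (-1 : K) ^ (i * k) • (degree 𝒱 k).subtype) ∘ₗ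
    (DirectSum.decomposeLinearEquiv (degree 𝒱)).toLinearMap

variable {𝒱}

theorem sgn_of_mem (i : ℤ) {k : ℤ} {x : GSym 𝒱} (hx : x ∈ degree 𝒱 k) :
    sgn 𝒱 i x = (-1 : K) ^ (i * k) • x := by
  simp only [sgn, LinearMap.comp_apply, LinearEquiv.coe_coe,
    DirectSum.decomposeLinearEquiv_apply, DirectSum.decompose_of_mem _ hx]
  rw [← DirectSum.lof_eq_of K, DirectSum.toModule_lof]
  rfl

theorem sgn_one_eq : sgn 𝒱 1 = sign 𝒱 := by simp [sgn, sign]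

theorem sign_of_mem {k : ℤ} {x : GSym 𝒱} (hx : x ∈ degree 𝒱 k) :
    sign 𝒱 x = (-1 : K) ^ k • x := by
  rw [← sgn_one_eq, sgn_of_mem 1 hx, one_mul]

theorem one_mem_degree : (1 : GSym 𝒱) ∈ degree 𝒱 0 := SetLike.GradedOne.one_mem

theorem ι_mul_mem_degree {i k : ℤ} {v : V} (hv : v ∈ 𝒱 i) {x : GSym 𝒱} (hx : x ∈ degree 𝒱 k) :
    ι 𝒱 v * x ∈ degree 𝒱 (i + k) :=
  SetLike.GradedMul.mul_mem (ι_mem_degree 𝒱 hv) hx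

/-- Two linear maps on `S(V)` agree if they agree on homogeneous elements. -/
theorem linearMap_ext_degree {N : Type*} [AddCommGroup N] [Module K N] {f g : GSym 𝒱 →ₗ[K] N}
    (h : ∀ (k : ℤ) (x : GSym 𝒱), x ∈ degree 𝒱 k → f x = g x) : f = g := by
  refine LinearMap.ext fun x => ?_
  induction x using DirectSum.Decomposition.inductionOn (degree 𝒱) with
  | zero => simp
  | homogeneous y => exact h _ _ y.2
  | add x y hx hy => rw [map_add, map_add, hx, hy]

theorem sgn_one (i : ℤ) : sgn 𝒱 i 1 = 1 := by
  rw [sgn_of_mem i one_mem_degree, mul_zero, zpow_zero, one_smul]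

theorem sgn_ι_mul (i : ℤ) {j : ℤ} {v : V} (hv : v ∈ 𝒱 j) (x : GSym 𝒱) :
    sgn 𝒱 i (ι 𝒱 v * x) = (-1 : K) ^ (i * j) • (ι 𝒱 v * sgn 𝒱 i x) := by
  suffices h : sgn 𝒱 i ∘ₗ LinearMap.mulLeft K (ι 𝒱 v) =
      (-1 : K) ^ (i * j) • (LinearMap.mulLeft K (ι 𝒱 v) ∘ₗ sgn 𝒱 i) from LinearMap.congr_fun h x
  refine linearMap_ext_degree fun k x hx => ?_
  simp only [LinearMap.comp_apply, LinearMap.mulLeft_apply, LinearMap.smul_apply]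
  rw [sgn_of_mem i (ι_mul_mem_degree hv hx), sgn_of_mem i hx, mul_smul_comm, smul_smul,
    mul_add, zpow_add₀ (by simp)]

theorem sgn_add (i j : ℤ) : sgn 𝒱 (i + j) = sgn 𝒱 i ∘ₗ sgn 𝒱 j := by
  refine linearMap_ext_degree fun k x hx => ?_
  rw [LinearMap.comp_apply, sgn_of_mem _ hx, sgn_of_mem _ hx, map_smul, sgn_of_mem _ hx, smul_smul,
    add_mul, zpow_add₀ (by simp), mul_comm]

theorem sgn_zero : sgn 𝒱 0 = LinearMap.id := by
  refine linearMap_ext_degree fun k x hx => ?_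
  rw [sgn_of_mem _ hx]; simp

theorem comul_one : comul 𝒱 1 = 1 ⊗ₜ 1 := by
  simp only [comul, LinearMap.comp_apply, AlgHom.toLinearMap_apply, map_one]
  rfl

theorem comulAlgHom_ι (v : V) : comulAlgHom 𝒱 (ι 𝒱 v) =
    GradedTensorProduct.includeLeft (degree 𝒱) (degree 𝒱) (ι 𝒱 v) +
      GradedTensorProduct.includeRight (degree 𝒱) (degree 𝒱) (ι 𝒱 v) := lift_ι _ _ _ _

/-- Since `Δ` is multiplicative, `Δ (v x) = (v ⊗ 1 + 1 ⊗ v) Δ x`; moving `v` past the first tensor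
factor costs the sign recorded by `sgn 𝒱 i`. This recursion drives nearly all inductions on products
below. -/
theorem comul_ι_mul {i : ℤ} {v : V} (hv : v ∈ 𝒱 i) (x : GSym 𝒱) :
    comul 𝒱 (ι 𝒱 v * x) =
      TensorProduct.map (LinearMap.mulLeft K (ι 𝒱 v)) LinearMap.id (comul 𝒱 x) +
        TensorProduct.map (sgn 𝒱 i) (LinearMap.mulLeft K (ι 𝒱 v)) (comul 𝒱 x) := by
  have key : ∀ z : GSym 𝒱 ⊗[K] GSym 𝒱,
      (GradedTensorProduct.of K (degree 𝒱) (degree 𝒱)).symm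
        ((GradedTensorProduct.includeLeft (degree 𝒱) (degree 𝒱) (ι 𝒱 v) +
          GradedTensorProduct.includeRight (degree 𝒱) (degree 𝒱) (ι 𝒱 v)) *
          GradedTensorProduct.of K (degree 𝒱) (degree 𝒱) z) =
      TensorProduct.map (LinearMap.mulLeft K (ι 𝒱 v)) LinearMap.id z +
        TensorProduct.map (sgn 𝒱 i) (LinearMap.mulLeft K (ι 𝒱 v)) z := by
    intro z
    induction z using TensorProduct.induction_on with
    | zero => simp
    | add x y hx hy =>
      rw [map_add, mul_add, map_add, hx, hy, map_add, map_add]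
      abel
    | tmul a b =>
      induction a using DirectSum.Decomposition.inductionOn (degree 𝒱) with
      | zero => simp
      | add x y hx hy =>
        rw [TensorProduct.add_tmul, map_add, mul_add, map_add, hx, hy, map_add,
          map_add]
        abel
      | @homogeneous k a =>
        have h1 := GradedTensorProduct.tmul_one_mul_coe_tmul (R := K) (degree 𝒱) (degree 𝒱)
          (ι 𝒱 v) a b
        have h2 := GradedTensorProduct.tmul_coe_mul_coe_tmul (R := K) (degree 𝒱) (degree 𝒱) 1
          ⟨ι 𝒱 v, ι_mem_degree 𝒱 hv⟩ a b
        rw [add_mul, map_add]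
        simp only [GradedTensorProduct.includeLeft_apply, GradedTensorProduct.includeRight_apply]
        erw [h1, h2]
        simp only [TensorProduct.map_tmul, LinearMap.mulLeft_apply, LinearMap.id_apply, one_mul,
          sgn_of_mem i a.2, ← TensorProduct.smul_tmul']
        congr 1
        exact intUnits_smul_eq (K := K) (i * k) _
  have := key (comul 𝒱 x)
  rw [← this]
  simp only [comul, LinearMap.comp_apply, AlgHom.toLinearMap_apply, map_mul, comulAlgHom_ι]
  rfl

end Basic

/-! ### Coassociativity, counit and graded cocommutativity. -/

section Coalgebra

variable {K : Type u} [Field K] {V : Type v} [AddCommGroup V] [Module K V]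
variable {𝒱 : ℤ → Submodule K V} [DirectSum.Decomposition 𝒱]

theorem comul_comp_mulLeft {i : ℤ} {v : V} (hv : v ∈ 𝒱 i) :
    comul 𝒱 ∘ₗ LinearMap.mulLeft K (ι 𝒱 v) =
      TensorProduct.map (LinearMap.mulLeft K (ι 𝒱 v)) LinearMap.id ∘ₗ comul 𝒱 +
        TensorProduct.map (sgn 𝒱 i) (LinearMap.mulLeft K (ι 𝒱 v)) ∘ₗ comul 𝒱 :=
  LinearMap.ext fun x => comul_ι_mul hv x

theorem sgn_comp_mulLeft (i : ℤ) {j : ℤ} {v : V} (hv : v ∈ 𝒱 j) :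
    sgn 𝒱 i ∘ₗ LinearMap.mulLeft K (ι 𝒱 v) =
      (-1 : K) ^ (i * j) • (LinearMap.mulLeft K (ι 𝒱 v) ∘ₗ sgn 𝒱 i) :=
  LinearMap.ext fun x => sgn_ι_mul i hv x

theorem sgn_comp_sgn_comm (i j : ℤ) : sgn 𝒱 i ∘ₗ sgn 𝒱 j = sgn 𝒱 j ∘ₗ sgn 𝒱 i := by
  rw [← sgn_add, ← sgn_add, add_comm]

theorem comul_comp_sgn (i : ℤ) :
    comul 𝒱 ∘ₗ sgn 𝒱 i = TensorProduct.map (sgn 𝒱 i) (sgn 𝒱 i) ∘ₗ comul 𝒱 := by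
  refine linearMap_ext (by simp [sgn_one, comul_one]) fun j v hv x hx => ?_
  simp only [LinearMap.comp_apply] at hx ⊢
  rw [sgn_ι_mul i hv, map_smul, comul_ι_mul hv, comul_ι_mul hv, hx]
  simp only [map_add, TensorProduct.map_map, sgn_comp_mulLeft i hv,
    sgn_comp_sgn_comm i j, TensorProduct.map_smul_left, TensorProduct.map_smul_right,
    LinearMap.smul_apply, smul_add, LinearMap.comp_id, LinearMap.id_comp]

theorem comul_coassoc :
    (TensorProduct.assoc K (GSym 𝒱) (GSym 𝒱) (GSym 𝒱)).toLinearMap ∘ₗ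
      (comul 𝒱).rTensor (GSym 𝒱) ∘ₗ comul 𝒱 = (comul 𝒱).lTensor (GSym 𝒱) ∘ₗ comul 𝒱 := by
  refine linearMap_ext (by simp [comul_one]) fun i v hv x hx => ?_
  simp only [LinearMap.comp_apply] at hx ⊢
  rw [comul_ι_mul hv, map_add, map_add, map_add]
  simp only [LinearMap.rTensor, LinearMap.lTensor, TensorProduct.map_map, comul_comp_mulLeft hv,
    comul_comp_sgn, LinearMap.id_comp, LinearMap.comp_id, TensorProduct.map_add_left,
    TensorProduct.map_add_right, LinearMap.add_apply, map_add]
  -- Naturality of the associator together with the induction hypothesis treats all three terms at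
  -- once.
  have h1 : ∀ a b c : GSym 𝒱 →ₗ[K] GSym 𝒱, TensorProduct.assoc K (GSym 𝒱) (GSym 𝒱) (GSym 𝒱)
      (TensorProduct.map (TensorProduct.map a b ∘ₗ comul 𝒱) c (comul 𝒱 x)) =
      TensorProduct.map a (TensorProduct.map b c ∘ₗ comul 𝒱) (comul 𝒱 x) := by
    intro a b c
    have h2 : TensorProduct.map (TensorProduct.map a b ∘ₗ comul 𝒱) c =
      TensorProduct.map (TensorProduct.map a b) c ∘ₗ (comul 𝒱).rTensor (GSym 𝒱) := by
      rw [LinearMap.rTensor, ← TensorProduct.map_comp, LinearMap.comp_id]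
    have h3 : TensorProduct.map a (TensorProduct.map b c ∘ₗ comul 𝒱) =
      TensorProduct.map a (TensorProduct.map b c) ∘ₗ (comul 𝒱).lTensor (GSym 𝒱) := by
      rw [LinearMap.lTensor, ← TensorProduct.map_comp, LinearMap.comp_id]
    rw [h2, h3, LinearMap.comp_apply, LinearMap.comp_apply, ← hx]
    exact LinearMap.congr_fun (TensorProduct.map_map_comp_assoc_eq a b c).symm _
  simp only [LinearEquiv.coe_coe, h1]
  simp only [TensorProduct.map_id, LinearMap.id_comp]
  rw [add_assoc]

theorem counit_ι (v : V) : counit 𝒱 (ι 𝒱 v) = 0 := lift_ι _ _ _ _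

theorem counit_ι_mul (v : V) (x : GSym 𝒱) : counit 𝒱 (ι 𝒱 v * x) = 0 := by
  rw [map_mul, counit_ι, zero_mul]

theorem rTensor_counit_comp_comul :
    (counit 𝒱).toLinearMap.rTensor (GSym 𝒱) ∘ₗ comul 𝒱 = TensorProduct.mk K K (GSym 𝒱) 1 := by
  refine linearMap_ext (by simp [comul_one]) fun i v hv x hx => ?_
  simp only [LinearMap.comp_apply] at hx ⊢
  have h1 : (counit 𝒱).toLinearMap ∘ₗ LinearMap.mulLeft K (ι 𝒱 v) = 0 :=
    LinearMap.ext fun x => counit_ι_mul v x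
  have h2 : (counit 𝒱).toLinearMap ∘ₗ sgn 𝒱 i = (counit 𝒱).toLinearMap := by
    refine linearMap_ext (by simp [sgn_one]) fun j w hw x hx => ?_
    simp [sgn_ι_mul i hw, counit_ι]
  have h3 : TensorProduct.map (counit 𝒱).toLinearMap (LinearMap.mulLeft K (ι 𝒱 v)) =
      TensorProduct.map LinearMap.id (LinearMap.mulLeft K (ι 𝒱 v)) ∘ₗ
        (counit 𝒱).toLinearMap.rTensor (GSym 𝒱) := by
    rw [LinearMap.rTensor, ← TensorProduct.map_comp, LinearMap.id_comp, LinearMap.comp_id]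
  rw [comul_ι_mul hv, map_add]
  rw [LinearMap.rTensor, TensorProduct.map_map, TensorProduct.map_map, h1, h2,
    LinearMap.id_comp, LinearMap.id_comp, h3, LinearMap.comp_apply, hx]
  simp

theorem lTensor_counit_comp_comul :
    (counit 𝒱).toLinearMap.lTensor (GSym 𝒱) ∘ₗ comul 𝒱 =
      (TensorProduct.mk K (GSym 𝒱) K).flip 1 := by
  refine linearMap_ext (by simp [comul_one]) fun i v hv x hx => ?_
  simp only [LinearMap.comp_apply] at hx ⊢
  have h1 : (counit 𝒱).toLinearMap ∘ₗ LinearMap.mulLeft K (ι 𝒱 v) = 0 :=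
    LinearMap.ext fun x => counit_ι_mul v x
  have h3 : TensorProduct.map (LinearMap.mulLeft K (ι 𝒱 v)) (counit 𝒱).toLinearMap =
      TensorProduct.map (LinearMap.mulLeft K (ι 𝒱 v)) LinearMap.id ∘ₗ
        (counit 𝒱).toLinearMap.lTensor (GSym 𝒱) := by
    rw [LinearMap.lTensor, ← TensorProduct.map_comp, LinearMap.id_comp, LinearMap.comp_id]
  rw [comul_ι_mul hv, map_add]
  rw [LinearMap.lTensor, TensorProduct.map_map, TensorProduct.map_map, h1,
    LinearMap.id_comp, LinearMap.comp_id, h3, LinearMap.comp_apply, hx]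
  simp

instance instCoalgebra : Coalgebra K (GSym 𝒱) where
  comul := comul 𝒱
  counit := (counit 𝒱).toLinearMap
  coassoc := comul_coassoc
  rTensor_counit_comp_comul := rTensor_counit_comp_comul
  lTensor_counit_comp_comul := lTensor_counit_comp_comul

/-- Both sides are algebra maps, so generators suffice; there the swap exchanges `v ⊗ 1` and `1 ⊗ v`
without sign because `1` has degree zero. -/
theorem comm_comulAlgHom (x : GSym 𝒱) :
    GradedTensorProduct.comm (R := K) (degree 𝒱) (degree 𝒱) (comulAlgHom 𝒱 x) =
      comulAlgHom 𝒱 x := by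
  suffices h : (GradedTensorProduct.comm (R := K) (degree 𝒱) (degree 𝒱)).toAlgHom.comp
      (comulAlgHom 𝒱) = comulAlgHom 𝒱 from DFunLike.congr_fun h x
  refine algHom_ext fun v => ?_
  change GradedTensorProduct.comm (R := K) (degree 𝒱) (degree 𝒱) (comulAlgHom 𝒱 (ι 𝒱 v)) = _
  induction v using DirectSum.Decomposition.inductionOn 𝒱 with
  | zero => simp
  | add v w hv hw => rw [map_add, map_add, map_add, hv, hw]
  | @homogeneous i v =>
    have h1 := GradedTensorProduct.comm_coe_tmul_coe (R := K) (degree 𝒱) (degree 𝒱)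
      ⟨ι 𝒱 v, ι_mem_degree 𝒱 v.2⟩ ⟨1, one_mem_degree⟩
    have h2 := GradedTensorProduct.comm_coe_tmul_coe (R := K) (degree 𝒱) (degree 𝒱)
      ⟨1, one_mem_degree⟩ ⟨ι 𝒱 v, ι_mem_degree 𝒱 v.2⟩
    rw [comulAlgHom_ι, map_add]
    simp only [GradedTensorProduct.includeLeft_apply, GradedTensorProduct.includeRight_apply]
    simp only [zero_mul, mul_zero] at h1 h2
    rw [h1, h2]
    erw [one_smul, one_smul]
    rw [add_comm]

end Coalgebra

/-! ### The convolution product. -/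

section Convolution

variable {K : Type u} [Field K] {V : Type v} [AddCommGroup V] [Module K V]
variable {𝒱 : ℤ → Submodule K V} [DirectSum.Decomposition 𝒱]
variable {A : Type*} [Ring A] [Algebra K A] {B : Type*} [Ring B] [Algebra K B]

/-- The convolution product of linear maps from `S(V)` to an algebra. -/
def conv (f g : GSym 𝒱 →ₗ[K] A) : GSym 𝒱 →ₗ[K] A :=
  LinearMap.mul' K A ∘ₗ TensorProduct.map f g ∘ₗ comul 𝒱

theorem conv_apply (f g : GSym 𝒱 →ₗ[K] A) (x : GSym 𝒱) :
    conv f g x = LinearMap.mul' K A (TensorProduct.map f g (comul 𝒱 x)) := rfl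

theorem conv_assoc (f g h : GSym 𝒱 →ₗ[K] A) : conv (conv f g) h = conv f (conv g h) :=
  congrArg WithConv.ofConv
    (mul_assoc (WithConv.toConv f) (WithConv.toConv g) (WithConv.toConv h))

theorem conv_add (f g h : GSym 𝒱 →ₗ[K] A) : conv f (g + h) = conv f g + conv f h := by
  simp only [conv, TensorProduct.map_add_right, LinearMap.add_comp, LinearMap.comp_add]

theorem add_conv (f g h : GSym 𝒱 →ₗ[K] A) : conv (f + g) h = conv f h + conv g h := by
  simp only [conv, TensorProduct.map_add_left, LinearMap.add_comp, LinearMap.comp_add]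

theorem smul_conv (c : K) (f g : GSym 𝒱 →ₗ[K] A) : conv (c • f) g = c • conv f g := by
  simp only [conv, TensorProduct.map_smul_left, LinearMap.smul_comp, LinearMap.comp_smul]

theorem conv_zero (f : GSym 𝒱 →ₗ[K] A) : conv f 0 = 0 := by
  simp only [conv, TensorProduct.map_zero_right, LinearMap.zero_comp, LinearMap.comp_zero]

theorem zero_conv (f : GSym 𝒱 →ₗ[K] A) : conv 0 f = 0 := by
  simp only [conv, TensorProduct.map_zero_left, LinearMap.zero_comp, LinearMap.comp_zero]

theorem conv_sub (f g h : GSym 𝒱 →ₗ[K] A) : conv f (g - h) = conv f g - conv f h := by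
  rw [eq_sub_iff_add_eq, ← conv_add, sub_add_cancel]

theorem sub_conv (f g h : GSym 𝒱 →ₗ[K] A) : conv (f - g) h = conv f h - conv g h := by
  rw [eq_sub_iff_add_eq, ← add_conv, sub_add_cancel]

/-- The unit of the convolution product. -/
def convUnit : GSym 𝒱 →ₗ[K] A := Algebra.linearMap K A ∘ₗ (counit 𝒱).toLinearMap

theorem convUnit_apply (x : GSym 𝒱) : (convUnit : GSym 𝒱 →ₗ[K] A) x = algebraMap K A (counit 𝒱 x) :=
  rfl

theorem convUnit_conv (f : GSym 𝒱 →ₗ[K] A) : conv convUnit f = f :=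
  congrArg WithConv.ofConv (one_mul (WithConv.toConv f))

theorem conv_convUnit (f : GSym 𝒱 →ₗ[K] A) : conv f convUnit = f :=
  congrArg WithConv.ofConv (mul_one (WithConv.toConv f))

theorem algHom_comp_conv (φ : A →ₐ[K] B) (f g : GSym 𝒱 →ₗ[K] A) :
    φ.toLinearMap ∘ₗ conv f g = conv (φ.toLinearMap ∘ₗ f) (φ.toLinearMap ∘ₗ g) :=
  LinearMap.algHom_comp_convMul_distrib φ (WithConv.toConv f) (WithConv.toConv g)

theorem conv_comp_of_comul_comp {W : Type*} [AddCommGroup W] [Module K W] {𝒲 : ℤ → Submodule K W}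
    [DirectSum.Decomposition 𝒲] {F : GSym 𝒱 →ₗ[K] GSym 𝒲}
    (hF : comul 𝒲 ∘ₗ F = TensorProduct.map F F ∘ₗ comul 𝒱) (f g : GSym 𝒲 →ₗ[K] A) :
    conv f g ∘ₗ F = conv (f ∘ₗ F) (g ∘ₗ F) := by
  simp only [conv, LinearMap.comp_assoc, hF, TensorProduct.map_comp]

theorem conv_one_apply (f g : GSym 𝒱 →ₗ[K] A) : conv f g 1 = f 1 * g 1 := by
  simp [conv_apply, comul_one]

theorem conv_ι_mul (f g : GSym 𝒱 →ₗ[K] A) {i : ℤ} {v : V} (hv : v ∈ 𝒱 i) (x : GSym 𝒱) :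
    conv f g (ι 𝒱 v * x) = conv (f ∘ₗ LinearMap.mulLeft K (ι 𝒱 v)) g x +
      conv (f ∘ₗ sgn 𝒱 i) (g ∘ₗ LinearMap.mulLeft K (ι 𝒱 v)) x := by
  simp only [conv_apply, comul_ι_mul hv, map_add, TensorProduct.map_map, LinearMap.comp_id]

theorem conv_ι_apply (f g : GSym 𝒱 →ₗ[K] A) (v : V) :
    conv f g (ι 𝒱 v) = f (ι 𝒱 v) * g 1 + f 1 * g (ι 𝒱 v) := by
  induction v using DirectSum.Decomposition.inductionOn 𝒱 with
  | zero => simp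
  | add v w hv hw => simp only [map_add, hv, hw, add_mul, mul_add]; abel
  | homogeneous v =>
    have h := conv_ι_mul f g v.2 1
    rw [mul_one] at h
    rw [h, conv_one_apply, conv_one_apply]
    simp [sgn_one]

/-- To compare two convolution products it suffices to compare the bilinear maps on homogeneous
tensors. -/
theorem conv_congr {f g f' g' : GSym 𝒱 →ₗ[K] A}
    (h : ∀ (i j : ℤ) (a b : GSym 𝒱), a ∈ degree 𝒱 i → b ∈ degree 𝒱 j → f a * g b = f' a * g' b) :
    conv f g = conv f' g' := by
  have : LinearMap.mul' K A ∘ₗ TensorProduct.map f g = LinearMap.mul' K A ∘ₗ TensorProduct.map f' g' := by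
    refine TensorProduct.ext ?_
    refine linearMap_ext_degree fun i a ha => ?_
    refine linearMap_ext_degree fun j b hb => ?_
    exact h i j a b ha hb
  simp only [conv, ← LinearMap.comp_assoc, this]

variable (𝒱) in
/-- The homogeneous elements of degree `k` of `S(V) ⊗ S(V)`. -/
def tensorDegree (k : ℤ) : Submodule K (GSym 𝒱 ⊗[K] GSym 𝒱) :=
  Submodule.span K {z | ∃ (i j : ℤ) (a b : GSym 𝒱), i + j = k ∧ a ∈ degree 𝒱 i ∧ b ∈ degree 𝒱 j ∧
    z = a ⊗ₜ b}

theorem comul_mem_tensorDegree {k : ℤ} {x : GSym 𝒱} (hx : x ∈ degree 𝒱 k) :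
    comul 𝒱 x ∈ tensorDegree 𝒱 k := by
  suffices h : degree 𝒱 k ≤ (tensorDegree 𝒱 k).comap (comul 𝒱) from h hx
  clear hx x
  refine Submodule.span_le.2 ?_
  rintro _ ⟨l, hl, rfl, rfl⟩
  induction l with
  | nil =>
    simp only [List.map_nil, List.prod_nil, List.sum_nil, Submodule.comap_coe, Set.mem_preimage,
      comul_one]
    exact Submodule.subset_span ⟨0, 0, 1, 1, rfl, one_mem_degree, one_mem_degree, rfl⟩
  | cons p l ih =>
    have hp : p.2 ∈ 𝒱 p.1 := hl p (by simp)
    have ih := ih fun b hb => hl b (by simp [hb])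
    simp only [List.map_cons, List.prod_cons, List.sum_cons, Submodule.comap_coe, Set.mem_preimage,
      SetLike.mem_coe, comul_ι_mul hp] at ih ⊢
    generalize comul 𝒱 (l.map fun a => ι 𝒱 a.2).prod = z at ih
    induction ih using Submodule.span_induction with
    | mem z hz =>
      obtain ⟨i, j, a, b, hij, ha, hb, rfl⟩ := hz
      rw [← hij]
      refine Submodule.add_mem _ ?_ ?_
      · exact Submodule.subset_span ⟨p.1 + i, j, _, _, by ring, ι_mul_mem_degree hp ha, hb, rfl⟩
      · refine Submodule.subset_span ⟨i, p.1 + j, _, _, by ring, ?_, ι_mul_mem_degree hp hb, rfl⟩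
        rw [sgn_of_mem _ ha]
        exact Submodule.smul_mem _ _ ha
    | zero => simp
    | add x y _ _ hx hy =>
      rw [map_add, map_add, add_add_add_comm]
      exact Submodule.add_mem _ hx hy
    | smul c x _ hx =>
      rw [map_smul, map_smul, ← smul_add]
      exact Submodule.smul_mem _ _ hx

theorem conv_mem_degree {W : Type*} [AddCommGroup W] [Module K W] {𝒲 : ℤ → Submodule K W}
    {f g : GSym 𝒱 →ₗ[K] GSym 𝒲} {m n : ℤ}
    (hf : ∀ ⦃k x⦄, x ∈ degree 𝒱 k → f x ∈ degree 𝒲 (k + m))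
    (hg : ∀ ⦃k x⦄, x ∈ degree 𝒱 k → g x ∈ degree 𝒲 (k + n)) ⦃k : ℤ⦄ ⦃x : GSym 𝒱⦄
    (hx : x ∈ degree 𝒱 k) : conv f g x ∈ degree 𝒲 (k + (m + n)) := by
  rw [conv_apply]
  have h := comul_mem_tensorDegree hx
  generalize comul 𝒱 x = z at h
  induction h using Submodule.span_induction with
  | mem z hz =>
    obtain ⟨i, j, a, b, hij, ha, hb, rfl⟩ := hz
    rw [TensorProduct.map_tmul, LinearMap.mul'_apply,
      show k + (m + n) = (i + m) + (j + n) by rw [← hij]; ring]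
    exact SetLike.GradedMul.mul_mem (hf ha) (hg hb)
  | zero => simp
  | add x y _ _ hx hy => rw [map_add, map_add]; exact Submodule.add_mem _ hx hy
  | smul c x _ hx => rw [map_smul, map_smul]; exact Submodule.smul_mem _ _ hx

variable {W : Type*} [AddCommGroup W] [Module K W] {𝒲 : ℤ → Submodule K W}
  [DirectSum.Decomposition 𝒲]

variable (𝒲) in
/-- The inclusion `a ↦ a ⊗ 1`. -/
abbrev inl : GSym 𝒲 →ₐ[K] (degree 𝒲) ᵍ⊗[K] (degree 𝒲) :=
  GradedTensorProduct.includeLeft (degree 𝒲) (degree 𝒲)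

variable (𝒲) in
/-- The inclusion `b ↦ 1 ⊗ b`. -/
abbrev inr : GSym 𝒲 →ₐ[K] (degree 𝒲) ᵍ⊗[K] (degree 𝒲) :=
  GradedTensorProduct.includeRight (degree 𝒲) (degree 𝒲)

theorem inl_mul_inr (a b : GSym 𝒲) :
    inl 𝒲 a * inr 𝒲 b = GradedTensorProduct.of K (degree 𝒲) (degree 𝒲) (a ⊗ₜ b) :=
  GradedTensorProduct.tmul_one_mul_one_tmul (R := K) (degree 𝒲) (degree 𝒲) a b

theorem inr_mul_inl {i j : ℤ} {a b : GSym 𝒲} (ha : a ∈ degree 𝒲 i) (hb : b ∈ degree 𝒲 j) :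
    inr 𝒲 b * inl 𝒲 a =
      (-1 : K) ^ (j * i) • GradedTensorProduct.of K (degree 𝒲) (degree 𝒲) (a ⊗ₜ b) := by
  have h := GradedTensorProduct.tmul_coe_mul_coe_tmul (R := K) (degree 𝒲) (degree 𝒲) 1
          ⟨b, hb⟩ ⟨a, ha⟩ 1
  rw [← intUnits_smul_eq (K := K)]
  simpa using h

theorem conv_inl_inr (f g : GSym 𝒱 →ₗ[K] GSym 𝒲) :
    conv ((inl 𝒲).toLinearMap ∘ₗ f) ((inr 𝒲).toLinearMap ∘ₗ g) =
      (GradedTensorProduct.of K (degree 𝒲) (degree 𝒲)).toLinearMap ∘ₗ TensorProduct.map f g ∘ₗ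
        comul 𝒱 := by
  rw [conv, ← LinearMap.comp_assoc, ← LinearMap.comp_assoc]
  congr 1
  refine TensorProduct.ext' fun a b => ?_
  exact inl_mul_inr _ _

/-- Cocommutativity swaps the two arguments with sign `(-1)^(j i)`, and reordering the values in the
graded tensor product gives `(-1)^((j+m) i)`; the product `(-1)^(m i)` is `sgn 𝒱 m`. The case `m =
0` serves exponentials, the case `m = 1` coderivations. -/
theorem conv_inr_inl {f g : GSym 𝒱 →ₗ[K] GSym 𝒲} {m : ℤ}
    (hf : ∀ ⦃k x⦄, x ∈ degree 𝒱 k → f x ∈ degree 𝒲 (k + m))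
    (hg : ∀ ⦃k x⦄, x ∈ degree 𝒱 k → g x ∈ degree 𝒲 k) :
    conv ((inr 𝒲).toLinearMap ∘ₗ f) ((inl 𝒲).toLinearMap ∘ₗ g) =
      conv ((inl 𝒲).toLinearMap ∘ₗ g ∘ₗ sgn 𝒱 m) ((inr 𝒲).toLinearMap ∘ₗ f) := by
  refine LinearMap.ext fun x => ?_
  have hx : comul 𝒱 x = (GradedTensorProduct.of K (degree 𝒱) (degree 𝒱)).symm
      (GradedTensorProduct.comm (R := K) (degree 𝒱) (degree 𝒱)
        (GradedTensorProduct.of K (degree 𝒱) (degree 𝒱) (comul 𝒱 x))) :=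
    congrArg (GradedTensorProduct.of K (degree 𝒱) (degree 𝒱)).symm (comm_comulAlgHom x).symm
  rw [conv_apply, hx, conv_apply]
  generalize comul 𝒱 x = z
  let T : GSym 𝒱 ⊗[K] GSym 𝒱 →ₗ[K] GSym 𝒱 ⊗[K] GSym 𝒱 :=
    (GradedTensorProduct.of K (degree 𝒱) (degree 𝒱)).symm.toLinearMap ∘ₗ
      (GradedTensorProduct.comm (R := K) (degree 𝒱) (degree 𝒱)).toLinearMap ∘ₗ
        (GradedTensorProduct.of K (degree 𝒱) (degree 𝒱)).toLinearMap
  suffices h : LinearMap.mul' K _ ∘ₗ TensorProduct.map ((inr 𝒲).toLinearMap ∘ₗ f)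
      ((inl 𝒲).toLinearMap ∘ₗ g) ∘ₗ T = LinearMap.mul' K _ ∘ₗ
      TensorProduct.map ((inl 𝒲).toLinearMap ∘ₗ g ∘ₗ sgn 𝒱 m) ((inr 𝒲).toLinearMap ∘ₗ f) from
    LinearMap.congr_fun h z
  refine TensorProduct.ext ?_
  refine linearMap_ext_degree fun i a ha => ?_
  refine linearMap_ext_degree fun j b hb => ?_
  have hT : T (a ⊗ₜ b) = (-1 : K) ^ (j * i) • (b ⊗ₜ a) := by
    have h := GradedTensorProduct.comm_coe_tmul_coe (R := K) (degree 𝒱) (degree 𝒱) ⟨a, ha⟩ ⟨b, hb⟩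
    refine (congrArg (GradedTensorProduct.of K (degree 𝒱) (degree 𝒱)).symm h).trans ?_
    refine (congrArg (GradedTensorProduct.of K (degree 𝒱) (degree 𝒱)).symm
      (intUnits_smul_eq (K := K) _ _)).trans ?_
    rw [map_smul]
    rfl
  simp only [LinearMap.compr₂_apply, LinearMap.comp_apply, TensorProduct.mk_apply, hT,
    LinearMap.compr₂ₛₗ_apply]
  simp only [map_smul, TensorProduct.map_tmul, LinearMap.comp_apply, LinearMap.mul'_apply,
    AlgHom.toLinearMap_apply]
  rw [inr_mul_inl (hg ha) (hf hb), sgn_of_mem _ ha, map_smul, map_smul, smul_mul_assoc,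
    inl_mul_inr, smul_smul, add_mul, zpow_add₀ (by simp), ← mul_assoc, ← mul_zpow]
  simp

end Convolution

/-! ### The weight grading `V^{⊙n}` and its filtration. -/

section Weight

variable {K : Type u} [Field K] {V : Type v} [AddCommGroup V] [Module K V]
variable (𝒱 : ℤ → Submodule K V) [DirectSum.Decomposition 𝒱]

/-- The algebra map `S(V) → S(V)[t]` sending `v` to `v t`. -/
def weightHom : GSym 𝒱 →ₐ[K] Polynomial (GSym 𝒱) :=
  lift 𝒱 ((Polynomial.monomial 1).restrictScalars K ∘ₗ ι 𝒱) (by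
    intro i j v w hv hw
    simp only [LinearMap.comp_apply, LinearMap.restrictScalars_apply,
      Polynomial.monomial_mul_monomial, ι_mul_ι 𝒱 hv hw]
    rw [Units.smul_def, map_zsmul, ← Units.smul_def])

/-- The projection `S(V) → V^{⊙n}`. -/
def wcomp (n : ℕ) : GSym 𝒱 →ₗ[K] GSym 𝒱 :=
  (Polynomial.lcoeff (GSym 𝒱) n).restrictScalars K ∘ₗ (weightHom 𝒱).toLinearMap

variable {𝒱}

theorem wcomp_one (n : ℕ) : wcomp 𝒱 n 1 = if n = 0 then 1 else 0 := by
  simp [wcomp, Polynomial.coeff_one]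

theorem wcomp_succ_ι_mul (n : ℕ) (v : V) (x : GSym 𝒱) :
    wcomp 𝒱 (n + 1) (ι 𝒱 v * x) = ι 𝒱 v * wcomp 𝒱 n x := by
  simp [wcomp, weightHom, lift_ι, Polynomial.coeff_monomial_mul]

theorem wcomp_zero_ι_mul (v : V) (x : GSym 𝒱) : wcomp 𝒱 0 (ι 𝒱 v * x) = 0 := by
  simp [wcomp, weightHom, lift_ι, Polynomial.mul_coeff_zero, Polynomial.coeff_monomial]

theorem exists_sum_wcomp (x : GSym 𝒱) :
    ∃ N, (∀ n, N ≤ n → wcomp 𝒱 n x = 0) ∧ ∑ n ∈ Finset.range N, wcomp 𝒱 n x = x := by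
  have hb : ∃ N, ∀ n, N ≤ n → wcomp 𝒱 n x = 0 := by
    refine ⟨(weightHom 𝒱 x).natDegree + 1, fun n hn => ?_⟩
    exact Polynomial.coeff_eq_zero_of_natDegree_lt (Nat.lt_of_succ_le hn)
  obtain ⟨N, hN⟩ := hb
  refine ⟨N, hN, ?_⟩
  suffices h : ∃ M, ∀ N, M ≤ N → ∑ n ∈ Finset.range N, wcomp 𝒱 n x = x by
    obtain ⟨M, hM⟩ := h
    refine Eq.trans ?_ (hM (max M N) (le_max_left _ _))
    refine Finset.sum_subset (Finset.range_mono (le_max_right _ _)) fun n _ hn => ?_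
    exact hN n (by simpa using hn)
  clear hN N
  induction x using induction with
  | one =>
    refine ⟨1, fun N hN => ?_⟩
    simp only [wcomp_one, Finset.sum_ite_eq', Finset.mem_range]
    rw [if_pos (by omega)]
  | add x y hx hy =>
    obtain ⟨M, hM⟩ := hx
    obtain ⟨M', hM'⟩ := hy
    refine ⟨max M M', fun N hN => ?_⟩
    simp only [map_add, Finset.sum_add_distrib]
    rw [hM N (by omega), hM' N (by omega)]
  | smul c x hx =>
    obtain ⟨M, hM⟩ := hx
    refine ⟨M, fun N hN => ?_⟩
    simp only [map_smul, ← Finset.smul_sum, hM N hN]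
  | ι_mul i v _ x hx =>
    obtain ⟨M, hM⟩ := hx
    refine ⟨M + 1, fun N hN => ?_⟩
    obtain ⟨N, rfl⟩ : ∃ n, N = n + 1 := ⟨N - 1, by omega⟩
    rw [Finset.sum_range_succ', wcomp_zero_ι_mul, add_zero]
    simp only [wcomp_succ_ι_mul, ← Finset.mul_sum, hM N (by omega)]

theorem eq_zero_of_wcomp {x : GSym 𝒱} (h : ∀ n, wcomp 𝒱 n x = 0) : x = 0 := by
  obtain ⟨N, -, hN⟩ := exists_sum_wcomp x
  rw [← hN]
  exact Finset.sum_eq_zero fun n _ => h n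

theorem eq_of_wcomp {x y : GSym 𝒱} (h : ∀ n, wcomp 𝒱 n x = wcomp 𝒱 n y) : x = y := by
  rw [← sub_eq_zero]
  exact eq_zero_of_wcomp fun n => by rw [map_sub, h, sub_self]

theorem wcomp_wcomp (m n : ℕ) (x : GSym 𝒱) :
    wcomp 𝒱 m (wcomp 𝒱 n x) = if m = n then wcomp 𝒱 n x else 0 := by
  induction x using induction generalizing m n with
  | one =>
    rw [wcomp_one]
    split_ifs with h1 h2 h2 <;> simp [wcomp_one, h1, h2]
    omega
  | add x y hx hy => simp only [map_add, hx, hy]; split_ifs <;> simp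
  | smul c x hx => simp only [map_smul, hx]; split_ifs <;> simp
  | ι_mul i v _ x hx =>
    rcases n with _ | n
    · simp [wcomp_zero_ι_mul]
    · rw [wcomp_succ_ι_mul]
      rcases m with _ | m
      · simp [wcomp_zero_ι_mul]
      · rw [wcomp_succ_ι_mul, hx]
        by_cases h : m = n <;> simp [h]

theorem wcomp_wcomp_self (n : ℕ) (x : GSym 𝒱) : wcomp 𝒱 n (wcomp 𝒱 n x) = wcomp 𝒱 n x := by
  simp [wcomp_wcomp]

theorem wcomp_zero (x : GSym 𝒱) : wcomp 𝒱 0 x = algebraMap K _ (counit 𝒱 x) := by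
  induction x using induction with
  | one => simp [wcomp_one]
  | add x y hx hy => simp only [map_add, hx, hy]
  | smul c x hx => rw [map_smul, map_smul, hx, smul_eq_mul, map_mul, Algebra.smul_def]
  | ι_mul i v _ x hx => rw [wcomp_zero_ι_mul, counit_ι_mul, map_zero]

theorem proj_ι_mul (v : V) (x : GSym 𝒱) : proj 𝒱 (ι 𝒱 v * x) = counit 𝒱 x • v := by
  induction x using induction with
  | one => simp [proj_ι]
  | add x y hx hy => simp only [mul_add, map_add, hx, hy, add_smul]
  | smul c x hx => simp only [mul_smul_comm, map_smul, hx, smul_assoc]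
  | ι_mul i w _ x hx => rw [proj_ι_mul_ι_mul, counit_ι_mul, zero_smul]

theorem wcomp_one_eq (x : GSym 𝒱) : wcomp 𝒱 1 x = ι 𝒱 (proj 𝒱 x) := by
  induction x using induction with
  | one => simp [wcomp_one, proj_one]
  | add x y hx hy => simp only [map_add, hx, hy]
  | smul c x hx => simp only [map_smul, hx]
  | ι_mul i v _ x hx =>
    rw [wcomp_succ_ι_mul, wcomp_zero, proj_ι_mul, map_smul, Algebra.smul_def, Algebra.commutes]

theorem wcomp_ι (n : ℕ) (v : V) : wcomp 𝒱 n (ι 𝒱 v) = if n = 1 then ι 𝒱 v else 0 := by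
  have := wcomp_wcomp n 1 (ι 𝒱 v)
  rwa [wcomp_one_eq, proj_ι] at this

theorem wcomp_sgn (n : ℕ) (i : ℤ) (x : GSym 𝒱) :
    wcomp 𝒱 n (sgn 𝒱 i x) = sgn 𝒱 i (wcomp 𝒱 n x) := by
  induction x using induction generalizing n with
  | one => rw [sgn_one, wcomp_one]; split_ifs <;> simp [sgn_one]
  | add x y hx hy => simp only [map_add, hx, hy]
  | smul c x hx => simp only [map_smul, hx]
  | ι_mul j v hv x hx =>
    rw [sgn_ι_mul i hv, map_smul]
    rcases n with _ | n
    · simp [wcomp_zero_ι_mul]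
    · rw [wcomp_succ_ι_mul, wcomp_succ_ι_mul, sgn_ι_mul i hv, hx]

theorem wcomp_mem_degree (n : ℕ) {k : ℤ} {x : GSym 𝒱} (hx : x ∈ degree 𝒱 k) :
    wcomp 𝒱 n x ∈ degree 𝒱 k := by
  suffices h : degree 𝒱 k ≤ (degree 𝒱 k).comap (wcomp 𝒱 n) from h hx
  clear hx x
  refine Submodule.span_le.2 ?_
  rintro _ ⟨l, hl, rfl, rfl⟩
  simp only [Submodule.comap_coe, Set.mem_preimage, SetLike.mem_coe]
  induction l generalizing n with
  | nil =>
    simp only [List.map_nil, List.prod_nil, List.sum_nil, wcomp_one]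
    split_ifs
    · exact one_mem_degree
    · exact Submodule.zero_mem _
  | cons p l ih =>
    simp only [List.map_cons, List.prod_cons, List.sum_cons]
    rcases n with _ | n
    · rw [wcomp_zero_ι_mul]; exact Submodule.zero_mem _
    · rw [wcomp_succ_ι_mul]
      exact ι_mul_mem_degree (hl p (by simp)) (ih n fun b hb => hl b (by simp [hb]))

variable (𝒱) in
/-- The filtration by weight: `fil n = ⨁_{k ≤ n} V^{⊙k}`. -/
def fil (n : ℕ) : Submodule K (GSym 𝒱) := ⨅ k : {k : ℕ // n < k}, LinearMap.ker (wcomp 𝒱 k)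

theorem mem_fil {n : ℕ} {x : GSym 𝒱} : x ∈ fil 𝒱 n ↔ ∀ k, n < k → wcomp 𝒱 k x = 0 := by
  simp [fil]

theorem fil_mono {m n : ℕ} (h : m ≤ n) : fil 𝒱 m ≤ fil 𝒱 n := fun _ hx =>
  mem_fil.2 fun k hk => mem_fil.1 hx k (by omega)

theorem exists_mem_fil (x : GSym 𝒱) : ∃ n, x ∈ fil 𝒱 n := by
  obtain ⟨N, hN, -⟩ := exists_sum_wcomp x
  exact ⟨N, mem_fil.2 fun k hk => hN k hk.le⟩

theorem wcomp_mem_fil {n : ℕ} (x : GSym 𝒱) : wcomp 𝒱 n x ∈ fil 𝒱 n :=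
  mem_fil.2 fun k hk => by rw [wcomp_wcomp, if_neg (by omega)]

theorem one_mem_fil (n : ℕ) : (1 : GSym 𝒱) ∈ fil 𝒱 n :=
  mem_fil.2 fun k hk => by rw [wcomp_one, if_neg (by omega)]

theorem ι_mem_fil (v : V) : ι 𝒱 v ∈ fil 𝒱 1 :=
  mem_fil.2 fun k hk => by rw [wcomp_ι, if_neg (by omega)]

theorem ι_mul_mem_fil {n : ℕ} (v : V) {x : GSym 𝒱} (hx : x ∈ fil 𝒱 n) :
    ι 𝒱 v * x ∈ fil 𝒱 (n + 1) := mem_fil.2 fun k hk => by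
  obtain ⟨k, rfl⟩ : ∃ m, k = m + 1 := ⟨k - 1, by omega⟩
  rw [wcomp_succ_ι_mul, mem_fil.1 hx k (by omega), mul_zero]

theorem sgn_mem_fil {n : ℕ} (i : ℤ) {x : GSym 𝒱} (hx : x ∈ fil 𝒱 n) : sgn 𝒱 i x ∈ fil 𝒱 n :=
  mem_fil.2 fun k hk => by rw [wcomp_sgn, mem_fil.1 hx k hk, map_zero]

theorem sub_wcomp_mem_fil {n : ℕ} {x : GSym 𝒱} (hx : x ∈ fil 𝒱 (n + 1)) :
    x - wcomp 𝒱 (n + 1) x ∈ fil 𝒱 n := mem_fil.2 fun k hk => by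
  rw [map_sub, wcomp_wcomp]
  split_ifs with h
  · rw [h, sub_self]
  · rw [mem_fil.1 hx k (by omega), sub_zero]

theorem mem_fil_of_wcomp_eq_zero {n : ℕ} {x : GSym 𝒱} (hx : x ∈ fil 𝒱 (n + 1))
    (h : wcomp 𝒱 (n + 1) x = 0) : x ∈ fil 𝒱 n := by
  simpa [h] using sub_wcomp_mem_fil hx

theorem eq_sum_of_mem_fil {n : ℕ} {x : GSym 𝒱} (hx : x ∈ fil 𝒱 n) :
    x = ∑ k ∈ Finset.range (n + 1), wcomp 𝒱 k x := by
  refine eq_of_wcomp fun m => ?_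
  simp only [map_sum, wcomp_wcomp, Finset.sum_ite_eq, Finset.mem_range]
  split_ifs with h
  · rfl
  · exact mem_fil.1 hx m (by omega)

theorem eq_of_mem_fil_zero {x : GSym 𝒱} (hx : x ∈ fil 𝒱 0) :
    x = algebraMap K _ (counit 𝒱 x) := by
  have h := eq_sum_of_mem_fil hx
  rwa [zero_add, Finset.sum_range_one, wcomp_zero] at h

theorem eq_of_mem_fil_one {x : GSym 𝒱} (hx : x ∈ fil 𝒱 1) :
    x = algebraMap K _ (counit 𝒱 x) + ι 𝒱 (proj 𝒱 x) := by
  have h := eq_sum_of_mem_fil hx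
  rwa [Finset.sum_range_succ, Finset.sum_range_one, wcomp_zero, wcomp_one_eq] at h

variable (𝒱) in
/-- The filtration by weight on `S(V) ⊗ S(V)`. -/
def tensorFil (n : ℕ) : Submodule K (GSym 𝒱 ⊗[K] GSym 𝒱) :=
  Submodule.span K {z | ∃ (i j : ℕ) (a b : GSym 𝒱), i + j = n ∧ a ∈ fil 𝒱 i ∧ b ∈ fil 𝒱 j ∧
    z = a ⊗ₜ b}

theorem tensorFil_mono {m n : ℕ} (h : m ≤ n) : tensorFil 𝒱 m ≤ tensorFil 𝒱 n := by
  refine Submodule.span_le.2 ?_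
  rintro _ ⟨i, j, a, b, hij, ha, hb, rfl⟩
  exact Submodule.subset_span ⟨i, j + (n - m), a, b, by omega, ha, fil_mono (by omega) hb, rfl⟩

theorem comul_mem_tensorFil {n : ℕ} {x : GSym 𝒱} (hx : x ∈ fil 𝒱 n) :
    comul 𝒱 x ∈ tensorFil 𝒱 n := by
  suffices h : ∀ k, comul 𝒱 (wcomp 𝒱 k x) ∈ tensorFil 𝒱 k by
    rw [eq_sum_of_mem_fil hx, map_sum]
    exact Submodule.sum_mem _ fun k hk => tensorFil_mono (by simpa [Nat.lt_succ_iff] using hk) (h k)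
  clear hx
  induction x using induction with
  | one =>
    intro k
    rw [wcomp_one]
    split_ifs
    · rw [comul_one]
      exact Submodule.subset_span ⟨0, k, 1, 1, by simp, one_mem_fil _, one_mem_fil _, rfl⟩
    · simp
  | add x y hx hy => intro k; rw [map_add, map_add]; exact Submodule.add_mem _ (hx k) (hy k)
  | smul c x hx => intro k; rw [map_smul, map_smul]; exact Submodule.smul_mem _ _ (hx k)
  | ι_mul i v hv x hx =>
    intro k
    rcases k with _ | k
    · rw [wcomp_zero_ι_mul, map_zero]; exact Submodule.zero_mem _
    rw [wcomp_succ_ι_mul, comul_ι_mul hv]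
    have h := hx k
    generalize comul 𝒱 (wcomp 𝒱 k x) = z at h
    induction h using Submodule.span_induction with
    | mem z hz =>
      obtain ⟨i, j, a, b, hij, ha, hb, rfl⟩ := hz
      refine Submodule.add_mem _ ?_ ?_
      · exact Submodule.subset_span ⟨i + 1, j, _, _, by omega, ι_mul_mem_fil v ha, hb, rfl⟩
      · exact Submodule.subset_span
          ⟨i, j + 1, _, _, by omega, sgn_mem_fil _ ha, ι_mul_mem_fil v hb, rfl⟩
    | zero => simp
    | add x y _ _ hx hy =>
      rw [map_add, map_add, add_add_add_comm]
      exact Submodule.add_mem _ hx hy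
    | smul c x _ hx =>
      rw [map_smul, map_smul, ← smul_add]
      exact Submodule.smul_mem _ _ hx

/-- A convolution product vanishes on an element of weight at most `n` if the corresponding
products do. -/
theorem conv_eq_zero_of_mem_fil {A : Type*} [Ring A] [Algebra K A] {f g : GSym 𝒱 →ₗ[K] A} {n : ℕ}
    (h : ∀ i j, i + j = n → ∀ a b, a ∈ fil 𝒱 i → b ∈ fil 𝒱 j → f a * g b = 0) {x : GSym 𝒱}
    (hx : x ∈ fil 𝒱 n) : conv f g x = 0 := by
  rw [conv_apply]
  have hx := comul_mem_tensorFil hx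
  generalize comul 𝒱 x = z at hx
  induction hx using Submodule.span_induction with
  | mem z hz =>
    obtain ⟨i, j, a, b, hij, ha, hb, rfl⟩ := hz
    exact h i j hij a b ha hb
  | zero => simp
  | add x y _ _ hx hy => rw [map_add, map_add, hx, hy, add_zero]
  | smul c x _ hx => rw [map_smul, map_smul, hx, smul_zero]

end Weight

/-! ### Derivations extending endomorphisms of `V`. -/

section Derivation

variable {K : Type u} [Field K] {V : Type v} [AddCommGroup V] [Module K V]
variable {𝒱 : ℤ → Submodule K V} [DirectSum.Decomposition 𝒱]

variable (𝒱) in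
/-- The graded derivation (and coderivation) of `S(V)` extending an endomorphism of `V`. -/
def extend (a : V →ₗ[K] V) : GSym 𝒱 →ₗ[K] GSym 𝒱 :=
  conv (ι 𝒱 ∘ₗ a ∘ₗ proj 𝒱) LinearMap.id

theorem extend_one (a : V →ₗ[K] V) : extend 𝒱 a 1 = 0 := by
  simp [extend, conv_one_apply, proj_one]

/-- Graded Leibniz rule: for `b` of degree `j`, the sign `(-1)^(i j)` of the coproduct meets the
sign `(-1)^((j+s) i)` of exchanging `a b` with `v`, leaving `(-1)^(s i)`. -/
theorem extend_ι_mul {a : V →ₗ[K] V} {s : ℤ} (ha : ∀ ⦃i v⦄, v ∈ 𝒱 i → a v ∈ 𝒱 (i + s)) {i : ℤ}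
    {v : V} (hv : v ∈ 𝒱 i) (x : GSym 𝒱) :
    extend 𝒱 a (ι 𝒱 v * x) = ι 𝒱 (a v) * x + (-1 : K) ^ (s * i) • (ι 𝒱 v * extend 𝒱 a x) := by
  rw [extend, conv_ι_mul _ _ hv]
  congr 1
  · have h : conv ((ι 𝒱 ∘ₗ a ∘ₗ proj 𝒱) ∘ₗ LinearMap.mulLeft K (ι 𝒱 v)) LinearMap.id =
        conv convUnit (LinearMap.mulLeft K (ι 𝒱 (a v))) := by
      refine conv_congr fun _ _ b c _ _ => ?_
      simp only [LinearMap.comp_apply, LinearMap.mulLeft_apply, proj_ι_mul, map_smul,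
        LinearMap.id_apply, convUnit_apply, Algebra.smul_def, mul_assoc]
    rw [h, convUnit_conv]
    rfl
  · suffices h : LinearMap.mul' K _ ∘ₗ TensorProduct.map ((ι 𝒱 ∘ₗ a ∘ₗ proj 𝒱) ∘ₗ sgn 𝒱 i)
        (LinearMap.id ∘ₗ LinearMap.mulLeft K (ι 𝒱 v)) =
        (-1 : K) ^ (s * i) • (LinearMap.mulLeft K (ι 𝒱 v) ∘ₗ LinearMap.mul' K _ ∘ₗ
          TensorProduct.map (ι 𝒱 ∘ₗ a ∘ₗ proj 𝒱) LinearMap.id) from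
      LinearMap.congr_fun h (comul 𝒱 x)
    refine TensorProduct.ext ?_
    refine linearMap_ext_degree fun j b hb => LinearMap.ext fun c => ?_
    simp only [LinearMap.compr₂ₛₗ_apply, TensorProduct.mk_apply, LinearMap.comp_apply,
      LinearMap.smul_apply, TensorProduct.map_tmul, LinearMap.mul'_apply, LinearMap.id_apply,
      LinearMap.mulLeft_apply]
    rw [sgn_of_mem i hb]
    simp only [map_smul, smul_mul_assoc]
    rw [← mul_assoc, ← mul_assoc, ι_mul_ι 𝒱 (ha (proj_mem 𝒱 hb)) hv, intUnits_smul_eq (K := K),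
      smul_mul_assoc, smul_smul, add_mul, zpow_add₀ (by simp), ← mul_assoc, mul_comm i j,
      ← mul_zpow]
    simp

theorem extend_ι (a : V →ₗ[K] V) (v : V) : extend 𝒱 a (ι 𝒱 v) = ι 𝒱 (a v) := by
  simp [extend, conv_ι_apply, proj_ι, proj_one]

theorem extend_id_ι_mul {i : ℤ} {v : V} (hv : v ∈ 𝒱 i) (x : GSym 𝒱) :
    extend 𝒱 LinearMap.id (ι 𝒱 v * x) = ι 𝒱 v * x + ι 𝒱 v * extend 𝒱 LinearMap.id x := by
  rw [extend_ι_mul (s := 0) (fun i v hv => by simpa using hv) hv]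
  simp

/-- The Euler operator. In characteristic zero it allows components of positive weight to be
recovered from lower ones. -/
theorem wcomp_extend_id (n : ℕ) (x : GSym 𝒱) :
    wcomp 𝒱 n (extend 𝒱 LinearMap.id x) = (n : K) • wcomp 𝒱 n x := by
  induction x using induction generalizing n with
  | one =>
    rw [extend_one, wcomp_one, map_zero]
    split_ifs with h <;> simp [h]
  | add x y hx hy => simp only [map_add, hx, hy, smul_add]
  | smul c x hx => simp only [map_smul, hx]; rw [smul_comm]
  | ι_mul i v hv x hx =>
    rw [extend_id_ι_mul hv, map_add]
    rcases n with _ | n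
    · simp [wcomp_zero_ι_mul]
    · rw [wcomp_succ_ι_mul, wcomp_succ_ι_mul, hx, Nat.cast_succ, add_smul, one_smul,
        mul_smul_comm, add_comm]

end Derivation

/-! ### Coalgebra morphisms and the functor `S`. -/

section Functoriality

variable {K : Type u} [Field K] {V : Type v} [AddCommGroup V] [Module K V]
variable {𝒱 : ℤ → Submodule K V} [DirectSum.Decomposition 𝒱]
variable {W : Type w} [AddCommGroup W] [Module K W] {𝒲 : ℤ → Submodule K W}
  [DirectSum.Decomposition 𝒲]

theorem wcomp_succ_conv_ι (n : ℕ) (f : GSym 𝒱 →ₗ[K] W) (G : GSym 𝒱 →ₗ[K] GSym 𝒲) (x : GSym 𝒱) :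
    wcomp 𝒲 (n + 1) (conv (ι 𝒲 ∘ₗ f) G x) = conv (ι 𝒲 ∘ₗ f) (wcomp 𝒲 n ∘ₗ G) x := by
  simp only [conv_apply]
  generalize comul 𝒱 x = z
  induction z using TensorProduct.induction_on with
  | zero => simp
  | add x y hx hy => simp only [map_add, hx, hy]
  | tmul a b => simp [wcomp_succ_ι_mul]

theorem wcomp_zero_conv_ι (f : GSym 𝒱 →ₗ[K] W) (G : GSym 𝒱 →ₗ[K] GSym 𝒲) (x : GSym 𝒱) :
    wcomp 𝒲 0 (conv (ι 𝒲 ∘ₗ f) G x) = 0 := by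
  simp only [conv_apply]
  generalize comul 𝒱 x = z
  induction z using TensorProduct.induction_on with
  | zero => simp
  | add x y hx hy => simp only [map_add, hx, hy, add_zero]
  | tmul a b => simp [wcomp_zero_ι_mul]

/-- Morphisms of counital coaugmented graded coalgebras. -/
structure IsCoalgHom (F : GSym 𝒱 →ₗ[K] GSym 𝒲) : Prop where
  map_degree : ∀ ⦃k : ℤ⦄ ⦃x : GSym 𝒱⦄, x ∈ degree 𝒱 k → F x ∈ degree 𝒲 k
  map_one : F 1 = 1
  counit_map : ∀ x, counit 𝒲 (F x) = counit 𝒱 x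
  comul_comp : comul 𝒲 ∘ₗ F = TensorProduct.map F F ∘ₗ comul 𝒱

theorem sgn_comp_of_map_degree {F : GSym 𝒱 →ₗ[K] GSym 𝒲}
    (hF : ∀ ⦃k : ℤ⦄ ⦃x : GSym 𝒱⦄, x ∈ degree 𝒱 k → F x ∈ degree 𝒲 k) (i : ℤ) :
    sgn 𝒲 i ∘ₗ F = F ∘ₗ sgn 𝒱 i := by
  refine linearMap_ext_degree fun k x hx => ?_
  rw [LinearMap.comp_apply, LinearMap.comp_apply, sgn_of_mem i hx, sgn_of_mem i (hF hx), map_smul]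

theorem IsCoalgHom.sign_comp {F : GSym 𝒱 →ₗ[K] GSym 𝒲} (hF : IsCoalgHom F) :
    sign 𝒲 ∘ₗ F = F ∘ₗ sign 𝒱 := by
  rw [← sgn_one_eq, ← sgn_one_eq, sgn_comp_of_map_degree hF.map_degree]

theorem IsCoalgHom.comp {U : Type*} [AddCommGroup U] [Module K U] {𝒰 : ℤ → Submodule K U}
    [DirectSum.Decomposition 𝒰] {G : GSym 𝒲 →ₗ[K] GSym 𝒰} {F : GSym 𝒱 →ₗ[K] GSym 𝒲}
    (hG : IsCoalgHom G) (hF : IsCoalgHom F) : IsCoalgHom (G ∘ₗ F) where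
  map_degree _ _ h := hG.map_degree (hF.map_degree h)
  map_one := by simp [hF.map_one, hG.map_one]
  counit_map x := by simp [hG.counit_map, hF.counit_map]
  comul_comp := by
    rw [← LinearMap.comp_assoc, hG.comul_comp, LinearMap.comp_assoc, hF.comul_comp,
      TensorProduct.map_comp, LinearMap.comp_assoc]

variable (𝒱 𝒲) in
/-- The algebra map `S(V) → S(W)` induced by a linear map of degree zero. -/
def map (φ : V →ₗ[K] W) (hφ : ∀ ⦃i v⦄, v ∈ 𝒱 i → φ v ∈ 𝒲 i) : GSym 𝒱 →ₐ[K] GSym 𝒲 :=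
  lift 𝒱 (ι 𝒲 ∘ₗ φ) fun _ _ _ _ hv hw => ι_mul_ι 𝒲 (hφ hv) (hφ hw)

variable {φ : V →ₗ[K] W} {hφ : ∀ ⦃i v⦄, v ∈ 𝒱 i → φ v ∈ 𝒲 i}

theorem map_ι (v : V) : map 𝒱 𝒲 φ hφ (ι 𝒱 v) = ι 𝒲 (φ v) := lift_ι _ _ _ _

theorem map_mem_degree ⦃k : ℤ⦄ ⦃x : GSym 𝒱⦄ (hx : x ∈ degree 𝒱 k) :
    map 𝒱 𝒲 φ hφ x ∈ degree 𝒲 k := by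
  suffices h : degree 𝒱 k ≤ (degree 𝒲 k).comap (map 𝒱 𝒲 φ hφ).toLinearMap from h hx
  refine Submodule.span_le.2 ?_
  rintro _ ⟨l, hl, rfl, rfl⟩
  refine Submodule.subset_span ⟨l.map fun a => (a.1, φ a.2), ?_, ?_, ?_⟩
  · intro a ha
    obtain ⟨b, hb, rfl⟩ := List.mem_map.1 ha
    exact hφ (hl b hb)
  · rw [List.map_map]; rfl
  · rw [AlgHom.toLinearMap_apply, map_list_prod, List.map_map, List.map_map]
    congr 1
    refine List.map_congr_left fun a _ => map_ι _

theorem map_isCoalgHom : IsCoalgHom (map 𝒱 𝒲 φ hφ).toLinearMap where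
  map_degree := map_mem_degree
  map_one := _root_.map_one (map 𝒱 𝒲 φ hφ)
  counit_map x := by
    suffices h : (counit 𝒲).comp (map 𝒱 𝒲 φ hφ) = counit 𝒱 from DFunLike.congr_fun h x
    exact algHom_ext fun v => by rw [AlgHom.comp_apply, map_ι, counit_ι, counit_ι]
  comul_comp := by
    refine linearMap_ext (by simp [comul_one]) fun i v hv x hx => ?_
    simp only [LinearMap.comp_apply, AlgHom.toLinearMap_apply] at hx ⊢
    rw [map_mul, map_ι, comul_ι_mul (hφ hv), comul_ι_mul hv, hx, map_add]
    simp only [TensorProduct.map_map]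
    have h1 : (map 𝒱 𝒲 φ hφ).toLinearMap ∘ₗ LinearMap.mulLeft K (ι 𝒱 v) =
        LinearMap.mulLeft K (ι 𝒲 (φ v)) ∘ₗ (map 𝒱 𝒲 φ hφ).toLinearMap :=
      LinearMap.ext fun y => by simp [map_ι]
    rw [h1, sgn_comp_of_map_degree map_mem_degree]
    rfl

theorem wcomp_map (n : ℕ) (x : GSym 𝒱) :
    wcomp 𝒲 n (map 𝒱 𝒲 φ hφ x) = map 𝒱 𝒲 φ hφ (wcomp 𝒱 n x) := by
  induction x using induction generalizing n with
  | one => rw [map_one, wcomp_one, wcomp_one]; split_ifs <;> simp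
  | add x y hx hy => simp only [map_add, hx, hy]
  | smul c x hx => simp only [map_smul, hx]
  | ι_mul i v hv x hx =>
    rw [map_mul, map_ι]
    rcases n with _ | n
    · simp [wcomp_zero_ι_mul]
    · rw [wcomp_succ_ι_mul, wcomp_succ_ι_mul, map_mul, map_ι, hx]

theorem map_mem_fil {n : ℕ} {x : GSym 𝒱} (hx : x ∈ fil 𝒱 n) : map 𝒱 𝒲 φ hφ x ∈ fil 𝒲 n :=
  mem_fil.2 fun k hk => by rw [wcomp_map, mem_fil.1 hx k hk, map_zero]

theorem proj_map (x : GSym 𝒱) : proj 𝒲 (map 𝒱 𝒲 φ hφ x) = φ (proj 𝒱 x) := by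
  have h := wcomp_map (φ := φ) (hφ := hφ) 1 x
  rw [wcomp_one_eq, wcomp_one_eq, map_ι] at h
  simpa [proj_ι] using congrArg (proj 𝒲) h

theorem map_id (h : ∀ ⦃i v⦄, v ∈ 𝒱 i → (LinearMap.id : V →ₗ[K] V) v ∈ 𝒱 i) (x : GSym 𝒱) :
    map 𝒱 𝒱 LinearMap.id h x = x := by
  suffices h : map 𝒱 𝒱 LinearMap.id h = AlgHom.id K _ from DFunLike.congr_fun h x
  exact algHom_ext fun v => by simp [map_ι]

theorem map_map {U : Type*} [AddCommGroup U] [Module K U] {𝒰 : ℤ → Submodule K U}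
    [DirectSum.Decomposition 𝒰] {ψ : W →ₗ[K] U} {hψ : ∀ ⦃i v⦄, v ∈ 𝒲 i → ψ v ∈ 𝒰 i}
    (x : GSym 𝒱) : map 𝒲 𝒰 ψ hψ (map 𝒱 𝒲 φ hφ x) =
      map 𝒱 𝒰 (ψ ∘ₗ φ) (fun _ _ h => hψ (hφ h)) x := by
  suffices h : (map 𝒲 𝒰 ψ hψ).comp (map 𝒱 𝒲 φ hφ) =
    map 𝒱 𝒰 (ψ ∘ₗ φ) (fun _ _ h => hψ (hφ h)) from DFunLike.congr_fun h x
  exact algHom_ext fun v => by simp [map_ι]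

theorem map_congr {ψ : V →ₗ[K] W} {hψ : ∀ ⦃i v⦄, v ∈ 𝒱 i → ψ v ∈ 𝒲 i} (h : φ = ψ) (x : GSym 𝒱) :
    map 𝒱 𝒲 φ hφ x = map 𝒱 𝒲 ψ hψ x := by subst h; rfl

end Functoriality

/-! ### Uniqueness of morphisms and coderivations with given corestriction. -/

section Uniqueness

variable {K : Type u} [Field K] [CharZero K] {V : Type v} [AddCommGroup V] [Module K V]
variable {𝒱 : ℤ → Submodule K V} [DirectSum.Decomposition 𝒱]
variable {W : Type w} [AddCommGroup W] [Module K W] {𝒲 : ℤ → Submodule K W}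
  [DirectSum.Decomposition 𝒲]

/-- The Euler operator is the convolution of the projection to `V` with the identity; composing it
with `F` gives the convolution of the corestriction of `F` with `F`. As `n + 1` is invertible, this
is a recursion on weight. -/
theorem wcomp_succ_of_comul_comp {F : GSym 𝒱 →ₗ[K] GSym 𝒲}
    (hF : comul 𝒲 ∘ₗ F = TensorProduct.map F F ∘ₗ comul 𝒱) (n : ℕ) (x : GSym 𝒱) :
    ((n + 1 : ℕ) : K) • wcomp 𝒲 (n + 1) (F x) =
      conv (ι 𝒲 ∘ₗ proj 𝒲 ∘ₗ F) (wcomp 𝒲 n ∘ₗ F) x := by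
  rw [← wcomp_extend_id, ← wcomp_succ_conv_ι]
  congr 1
  exact LinearMap.congr_fun (conv_comp_of_comul_comp hF _ _) x

/-- A coalgebra morphism to `S(W)` is determined by its corestriction to `W`. -/
theorem coalgHom_ext {F G : GSym 𝒱 →ₗ[K] GSym 𝒲} (hF : IsCoalgHom F) (hG : IsCoalgHom G)
    (h : proj 𝒲 ∘ₗ F = proj 𝒲 ∘ₗ G) : F = G := by
  have key : ∀ n, wcomp 𝒲 n ∘ₗ F = wcomp 𝒲 n ∘ₗ G := by
    intro n
    induction n with
    | zero =>
      refine LinearMap.ext fun x => ?_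
      simp only [LinearMap.comp_apply, wcomp_zero, hF.counit_map, hG.counit_map]
    | succ n ih =>
      refine LinearMap.ext fun x => ?_
      have h1 := wcomp_succ_of_comul_comp hF.comul_comp n x
      rw [h, ih, ← wcomp_succ_of_comul_comp hG.comul_comp n x] at h1
      exact smul_right_injective _ (Nat.cast_ne_zero.2 (Nat.succ_ne_zero n)) h1
  exact LinearMap.ext fun x => eq_of_wcomp fun n => LinearMap.congr_fun (key n) x

/-- A (twisted) coderivation with values in `S(W)` whose corestriction to `W` is zero vanishes. -/
theorem coderivation_eq_zero {D F T : GSym 𝒱 →ₗ[K] GSym 𝒲}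
    (hF : ∀ x, counit 𝒲 (F x) = counit 𝒱 x) (hT : ∀ x, counit 𝒲 (T x) = counit 𝒱 x)
    (hD : comul 𝒲 ∘ₗ D = (TensorProduct.map D F + TensorProduct.map T D) ∘ₗ comul 𝒱)
    (h : proj 𝒲 ∘ₗ D = 0) : D = 0 := by
  have hconv : ∀ f g : GSym 𝒲 →ₗ[K] GSym 𝒲, conv f g ∘ₗ D =
      conv (f ∘ₗ D) (g ∘ₗ F) + conv (f ∘ₗ T) (g ∘ₗ D) := by
    intro f g
    simp only [conv, LinearMap.comp_assoc, hD, LinearMap.add_comp, LinearMap.comp_add,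
      TensorProduct.map_comp]
  have hu : ∀ {G : GSym 𝒱 →ₗ[K] GSym 𝒲}, (∀ x, counit 𝒲 (G x) = counit 𝒱 x) →
      (convUnit : GSym 𝒲 →ₗ[K] GSym 𝒲) ∘ₗ G = convUnit := fun hG =>
    LinearMap.ext fun x => by rw [LinearMap.comp_apply, convUnit_apply, hG, convUnit_apply]
  have key : ∀ n, wcomp 𝒲 n ∘ₗ D = 0 := by
    intro n
    induction n with
    | zero =>
      -- The counit is idempotent under convolution, so `ε D = ε D + ε D`, which settles weight
      -- zero.
      have h1 := hconv convUnit convUnit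
      rw [convUnit_conv, hu hF, hu hT, convUnit_conv, conv_convUnit] at h1
      have h2 : (convUnit : GSym 𝒲 →ₗ[K] GSym 𝒲) ∘ₗ D = 0 := by simpa using h1
      refine LinearMap.ext fun x => ?_
      rw [LinearMap.comp_apply, wcomp_zero, ← convUnit_apply, ← LinearMap.comp_apply, h2]
    | succ n ih =>
      refine LinearMap.ext fun x => ?_
      have h1 : ((n + 1 : ℕ) : K) • wcomp 𝒲 (n + 1) (D x) =
          wcomp 𝒲 (n + 1) ((conv (ι 𝒲 ∘ₗ LinearMap.id ∘ₗ proj 𝒲) LinearMap.id ∘ₗ D) x) := by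
        rw [← wcomp_extend_id]; rfl
      -- One term contains the corestriction of `D`, zero by hypothesis; the other contains the
      -- weight `n` part of `D`, zero by induction.
      rw [hconv, LinearMap.id_comp, LinearMap.comp_assoc, h, LinearMap.comp_zero, zero_conv, zero_add,
        LinearMap.comp_assoc, wcomp_succ_conv_ι, LinearMap.id_comp, ih, conv_zero] at h1
      simpa [Nat.cast_add_one_ne_zero n] using h1
  exact LinearMap.ext fun x => eq_zero_of_wcomp fun n => LinearMap.congr_fun (key n) x

end Uniqueness

end GSym

/-! ### Homogeneous linear maps between graded spaces. -/

section Graded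

variable {K : Type*} [Field K] {M N : Type*} [AddCommGroup M] [Module K M] [AddCommGroup N]
  [Module K N] {ℳ : ℤ → Submodule K M} [DirectSum.Decomposition ℳ] {𝒩 : ℤ → Submodule K N}
  [DirectSum.Decomposition 𝒩]

theorem decompose_map_add {f : M →ₗ[K] N} {s : ℤ} (hf : ∀ ⦃i v⦄, v ∈ ℳ i → f v ∈ 𝒩 (i + s)) (v : M)
    (i : ℤ) : (DirectSum.decompose 𝒩 (f v) (i + s) : N) = f (DirectSum.decompose ℳ v i) := by
  induction v using DirectSum.Decomposition.inductionOn ℳ with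
  | zero => simp
  | @homogeneous j v =>
    by_cases h : j = i
    · subst h
      rw [DirectSum.decompose_of_mem_same ℳ v.2, DirectSum.decompose_of_mem_same 𝒩 (hf v.2)]
    · rw [DirectSum.decompose_of_mem_ne ℳ v.2 h,
        DirectSum.decompose_of_mem_ne 𝒩 (hf v.2) (by omega), map_zero]
  | add v w hv hw => simp [hv, hw]

theorem mem_of_map_mem {f : M →ₗ[K] N} (hf : ∀ ⦃i v⦄, v ∈ ℳ i → f v ∈ 𝒩 i)
    (hinj : Function.Injective f) {i : ℤ} {v : M} (hv : f v ∈ 𝒩 i) : v ∈ ℳ i := by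
  have h := decompose_map_add (s := 0) (f := f) (ℳ := ℳ) (𝒩 := 𝒩) (by simpa using hf) v i
  rw [add_zero, DirectSum.decompose_of_mem_same 𝒩 hv] at h
  rw [hinj h]
  exact (DirectSum.decompose ℳ v i).2

theorem eq_of_mem_of_mem_ne {i j : ℤ} (h : i ≠ j) {v : M} (hi : v ∈ ℳ i) (hj : v ∈ ℳ j) : v = 0 := by
  rw [← DirectSum.decompose_of_mem_same ℳ hi, DirectSum.decompose_of_mem_ne ℳ hj h.symm]

end Graded

namespace GSym

/-! ### The convolution exponential. -/

section Exponential

variable {K : Type u} [Field K] {V : Type v} [AddCommGroup V] [Module K V]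
variable {𝒱 : ℤ → Submodule K V} [DirectSum.Decomposition 𝒱]
variable {W : Type w} [AddCommGroup W] [Module K W] {𝒲 : ℤ → Submodule K W}
  [DirectSum.Decomposition 𝒲]

/-- The `n`-th convolution power. -/
def convPow {A : Type*} [Ring A] [Algebra K A] (f : GSym 𝒱 →ₗ[K] A) (n : ℕ) : GSym 𝒱 →ₗ[K] A :=
  ((WithConv.toConv f) ^ n).ofConv

theorem convPow_succ {A : Type*} [Ring A] [Algebra K A] (f : GSym 𝒱 →ₗ[K] A) (n : ℕ) :
    convPow f (n + 1) = conv f (convPow f n) :=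
  congrArg WithConv.ofConv (pow_succ' (WithConv.toConv f) n)

theorem convPow_zero {A : Type*} [Ring A] [Algebra K A] (f : GSym 𝒱 →ₗ[K] A) :
    convPow f 0 = convUnit :=
  congrArg WithConv.ofConv (pow_zero (WithConv.toConv f))

theorem algHom_comp_convPow {A B : Type*} [Ring A] [Algebra K A] [Ring B] [Algebra K B]
    (φ : A →ₐ[K] B) (f : GSym 𝒱 →ₗ[K] A) (n : ℕ) :
    φ.toLinearMap ∘ₗ convPow f n = convPow (φ.toLinearMap ∘ₗ f) n := by
  induction n with
  | zero =>
    rw [convPow_zero, convPow_zero]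
    exact LinearMap.ext fun x => by simp [convUnit_apply]
  | succ n ih => rw [convPow_succ, convPow_succ, algHom_comp_conv, ih]

theorem convPow_eq_zero_of_mem_fil {A : Type*} [Ring A] [Algebra K A] {f : GSym 𝒱 →ₗ[K] A}
    (h1 : f 1 = 0) {m n : ℕ} (hmn : m < n) {x : GSym 𝒱} (hx : x ∈ fil 𝒱 m) :
    convPow f n x = 0 := by
  induction n generalizing m x with
  | zero => omega
  | succ n ih =>
    rw [convPow_succ]
    refine conv_eq_zero_of_mem_fil (fun i j hij a b ha hb => ?_) hx
    rcases Nat.eq_zero_or_pos i with rfl | hi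
    · rw [eq_of_mem_fil_zero ha, Algebra.algebraMap_eq_smul_one, map_smul, h1, smul_zero, zero_mul]
    · rw [ih (by omega) hb, mul_zero]

theorem convPow_mem_degree {f : GSym 𝒱 →ₗ[K] GSym 𝒲}
    (hf : ∀ ⦃k x⦄, x ∈ degree 𝒱 k → f x ∈ degree 𝒲 k) (n : ℕ) ⦃k : ℤ⦄ ⦃x : GSym 𝒱⦄
    (hx : x ∈ degree 𝒱 k) : convPow f n x ∈ degree 𝒲 k := by
  induction n generalizing k x with
  | zero =>
    rw [convPow_zero, convUnit_apply]
    rcases eq_or_ne k 0 with rfl | hk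
    · rw [Algebra.algebraMap_eq_smul_one]
      exact Submodule.smul_mem _ _ one_mem_degree
    · have h1 := wcomp_mem_degree 0 hx
      have h2 : wcomp 𝒱 0 x ∈ degree 𝒱 0 := by
        rw [wcomp_zero, Algebra.algebraMap_eq_smul_one]
        exact Submodule.smul_mem _ _ one_mem_degree
      have h3 := eq_of_mem_of_mem_ne hk h1 h2
      have h4 := congrArg (counit 𝒱) h3
      rw [wcomp_zero, map_zero, AlgHom.commutes] at h4
      rw [show counit 𝒱 x = 0 from h4, map_zero]
      exact Submodule.zero_mem _
  | succ n ih =>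
    rw [convPow_succ]
    simpa using conv_mem_degree (m := 0) (n := 0) (by simpa using hf) (by simpa using ih) hx

theorem wcomp_convPow (f : GSym 𝒱 →ₗ[K] W) (m n : ℕ) (x : GSym 𝒱) :
    wcomp 𝒲 m (convPow (ι 𝒲 ∘ₗ f) n x) = if m = n then convPow (ι 𝒲 ∘ₗ f) n x else 0 := by
  induction n generalizing m x with
  | zero =>
    rw [convPow_zero, convUnit_apply, Algebra.algebraMap_eq_smul_one, map_smul, wcomp_one]
    split_ifs <;> simp
  | succ n ih =>
    rw [convPow_succ]
    rcases m with _ | m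
    · rw [wcomp_zero_conv_ι, if_neg (by omega)]
    · rw [wcomp_succ_conv_ι]
      by_cases h : m = n
      · rw [if_pos (by omega)]
        congr 2
        refine LinearMap.ext fun y => ?_
        rw [LinearMap.comp_apply, ih, if_pos h]
      · rw [if_neg (by omega)]
        have : wcomp 𝒲 m ∘ₗ convPow (ι 𝒲 ∘ₗ f) n = 0 := by
          refine LinearMap.ext fun y => ?_
          rw [LinearMap.comp_apply, ih, if_neg h, LinearMap.zero_apply]
        rw [this, conv_zero, LinearMap.zero_apply]

/-- The terms of the convolution exponential. -/
def expTerm (f : GSym 𝒱 →ₗ[K] W) (n : ℕ) : GSym 𝒱 →ₗ[K] GSym 𝒲 :=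
  (n.factorial : K)⁻¹ • convPow (ι 𝒲 ∘ₗ f) n

variable {f : GSym 𝒱 →ₗ[K] W}

theorem expTerm_eq_zero_of_mem_fil (h1 : f 1 = 0) {m n : ℕ} (hmn : m < n) {x : GSym 𝒱}
    (hx : x ∈ fil 𝒱 m) : (expTerm f n x : GSym 𝒲) = 0 := by
  rw [expTerm, LinearMap.smul_apply, convPow_eq_zero_of_mem_fil (by simp [h1]) hmn hx, smul_zero]

/-- `Δ` is an algebra map, so it sends the convolution power of `f` to the power of a sum `f ⊗ 1 + 1
⊗ f`. The two summands commute under convolution, and the binomial theorem divided by `n!` gives the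
formula. -/
theorem comul_comp_expTerm [CharZero K] (hf : ∀ ⦃k x⦄, x ∈ degree 𝒱 k → f x ∈ 𝒲 k) (n : ℕ) :
    comul 𝒲 ∘ₗ expTerm f n = ∑ p ∈ Finset.HasAntidiagonal.antidiagonal n,
      TensorProduct.map (expTerm f p.1) (expTerm f p.2) ∘ₗ comul 𝒱 := by
  have hd : ∀ ⦃k x⦄, x ∈ degree 𝒱 k → (ι 𝒲 ∘ₗ f) x ∈ degree 𝒲 k := fun k x hx =>
    ι_mem_degree 𝒲 (hf hx)
  have hsum : (comulAlgHom 𝒲).toLinearMap ∘ₗ ι 𝒲 ∘ₗ f =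
      (inl 𝒲).toLinearMap ∘ₗ (ι 𝒲 ∘ₗ f) + (inr 𝒲).toLinearMap ∘ₗ (ι 𝒲 ∘ₗ f) :=
    LinearMap.ext fun x => comulAlgHom_ι (f x)
  have hcomm : Commute (WithConv.toConv ((inl 𝒲).toLinearMap ∘ₗ (ι 𝒲 ∘ₗ f)))
      (WithConv.toConv ((inr 𝒲).toLinearMap ∘ₗ (ι 𝒲 ∘ₗ f))) := by
    have h := conv_inr_inl (f := ι 𝒲 ∘ₗ f) (m := 0) (by simpa using hd) hd
    rw [sgn_zero, LinearMap.comp_id] at h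
    exact (congrArg WithConv.toConv h).symm
  have hpow : convPow ((inl 𝒲).toLinearMap ∘ₗ (ι 𝒲 ∘ₗ f) + (inr 𝒲).toLinearMap ∘ₗ (ι 𝒲 ∘ₗ f)) n =
      ∑ p ∈ Finset.HasAntidiagonal.antidiagonal n, n.choose p.1 •
        conv (convPow ((inl 𝒲).toLinearMap ∘ₗ (ι 𝒲 ∘ₗ f)) p.1)
          (convPow ((inr 𝒲).toLinearMap ∘ₗ (ι 𝒲 ∘ₗ f)) p.2) := by
    have h := congrArg (WithConv.linearEquiv K _) (hcomm.add_pow' n)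
    rw [map_sum] at h
    exact h
  have hof : ∀ z, GradedTensorProduct.of K (degree 𝒲) (degree 𝒲) (comul 𝒲 z) =
    (comulAlgHom 𝒲).toLinearMap z := fun z => rfl
  refine LinearMap.ext fun x => (GradedTensorProduct.of K (degree 𝒲) (degree 𝒲)).injective ?_
  rw [LinearMap.comp_apply, hof, expTerm, LinearMap.smul_apply, map_smul, ← LinearMap.comp_apply,
    algHom_comp_convPow, hsum, hpow, LinearMap.sum_apply, LinearMap.sum_apply, Finset.smul_sum,
    map_sum]
  refine Finset.sum_congr rfl fun p hp => ?_
  rw [← algHom_comp_convPow, ← algHom_comp_convPow, conv_inl_inr]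
  simp only [LinearMap.smul_apply, LinearMap.comp_apply, expTerm, TensorProduct.map_smul_left,
    TensorProduct.map_smul_right, map_smul, LinearEquiv.coe_coe]
  rw [← Nat.cast_smul_eq_nsmul K, smul_smul, smul_smul]
  congr 1
  rw [Finset.HasAntidiagonal.mem_antidiagonal] at hp
  have h1 := Nat.choose_mul_factorial_mul_factorial (n := n) (k := p.1) (by omega)
  rw [show n - p.1 = p.2 by omega] at h1
  have h2 : ((n.choose p.1 : K) * p.1.factorial) * p.2.factorial = n.factorial := by
    exact_mod_cast h1
  have h3 : (p.1.factorial : K) ≠ 0 := Nat.cast_ne_zero.2 (Nat.factorial_ne_zero _)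
  have h4 : (p.2.factorial : K) ≠ 0 := Nat.cast_ne_zero.2 (Nat.factorial_ne_zero _)
  have h5 : (n.factorial : K) ≠ 0 := Nat.cast_ne_zero.2 (Nat.factorial_ne_zero _)
  field_simp
  linear_combination h2

theorem finite_support_expTerm (h1 : f 1 = 0) (x : GSym 𝒱) :
    (Function.support fun n => (expTerm f n x : GSym 𝒲)).Finite := by
  obtain ⟨m, hm⟩ := exists_mem_fil x
  refine (Finset.finite_toSet (Finset.range (m + 1))).subset fun n hn => ?_
  by_contra h
  exact hn (expTerm_eq_zero_of_mem_fil h1 (by simpa using h) hm)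

variable (𝒲) in
/-- The convolution exponential of a linear map `f : S(V) → W` with `f 1 = 0`: the coalgebra
morphism `S(V) → S(W)` with corestriction `f`. -/
def cexp (f : GSym 𝒱 →ₗ[K] W) (h1 : f 1 = 0) : GSym 𝒱 →ₗ[K] GSym 𝒲 where
  toFun x := ∑ᶠ n, expTerm f n x
  map_add' x y := by
    rw [← finsum_add_distrib (finite_support_expTerm h1 x) (finite_support_expTerm h1 y)]
    simp
  map_smul' c x := by
    rw [RingHom.id_apply, smul_finsum' c (finite_support_expTerm h1 x)]
    simp

theorem cexp_eq_sum (h1 : f 1 = 0) {m N : ℕ} (hN : m < N) {x : GSym 𝒱} (hx : x ∈ fil 𝒱 m) :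
    cexp 𝒲 f h1 x = ∑ n ∈ Finset.range N, expTerm f n x := by
  refine finsum_eq_sum_of_support_subset _ fun n hn => ?_
  by_contra h
  exact hn (expTerm_eq_zero_of_mem_fil h1 (by simp at h; omega) hx)

theorem wcomp_cexp (h1 : f 1 = 0) (n : ℕ) (x : GSym 𝒱) :
    wcomp 𝒲 n (cexp 𝒲 f h1 x) = expTerm f n x := by
  obtain ⟨m, hm⟩ := exists_mem_fil x
  rw [cexp_eq_sum h1 (show m < max m n + 1 by omega) hm, map_sum]
  simp only [expTerm, LinearMap.smul_apply, map_smul, wcomp_convPow, smul_ite, smul_zero,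
    Finset.sum_ite_eq, Finset.mem_range]
  rw [if_pos (by omega)]

theorem proj_cexp (h1 : f 1 = 0) : proj 𝒲 ∘ₗ cexp 𝒲 f h1 = f := by
  refine LinearMap.ext fun x => ?_
  have h := wcomp_cexp (𝒲 := 𝒲) h1 1 x
  rw [wcomp_one_eq, expTerm, convPow_succ, convPow_zero, conv_convUnit] at h
  have h2 := congrArg (proj 𝒲) h
  simpa [proj_ι] using h2

/-- On tensors of weight at most `m`, the terms with `p.1 + p.2 > m` vanish, so the product of the
two finite sums regroups along antidiagonals. -/
theorem map_cexp_of_mem_tensorFil (h1 : f 1 = 0) {m : ℕ} {z : GSym 𝒱 ⊗[K] GSym 𝒱}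
    (hz : z ∈ tensorFil 𝒱 m) : TensorProduct.map (cexp 𝒲 f h1) (cexp 𝒲 f h1) z =
      ∑ n ∈ Finset.range (m + 1), ∑ p ∈ Finset.HasAntidiagonal.antidiagonal n,
        TensorProduct.map (expTerm f p.1) (expTerm f p.2) z := by
  induction hz using Submodule.span_induction with
  | zero => simp
  | add x y _ _ hx hy => simp only [map_add, hx, hy, Finset.sum_add_distrib]
  | smul c x _ hx => simp only [map_smul, hx, Finset.smul_sum]
  | mem z hz =>
    obtain ⟨i, j, a, b, hij, ha, hb, rfl⟩ := hz
    simp only [Finset.Nat.sum_antidiagonal_eq_sum_range_succ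
      (fun p q => TensorProduct.map (expTerm f p) (expTerm f q) (a ⊗ₜ[K] b))]
    rw [Finset.sum_range_diag_flip (m + 1)
      (fun p q => TensorProduct.map (expTerm f p) (expTerm f q) (a ⊗ₜ[K] b))]
    rw [TensorProduct.map_tmul, cexp_eq_sum h1 (show i < m + 1 by omega) ha,
      cexp_eq_sum h1 (show j < m + 1 by omega) hb, TensorProduct.sum_tmul]
    refine Finset.sum_congr rfl fun p hp => ?_
    rw [TensorProduct.tmul_sum]
    refine (Finset.sum_subset (Finset.range_mono (by omega)) fun q hq hq' => ?_).symm
    simp only [Finset.mem_range] at hp hq hq'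
    rcases Nat.lt_or_ge i p with h | h
    · rw [expTerm_eq_zero_of_mem_fil h1 h ha, TensorProduct.zero_tmul]
    · rw [expTerm_eq_zero_of_mem_fil (n := q) h1 (by omega) hb,
        TensorProduct.tmul_zero]

/-- The existence half of cofreeness, `coalgHom_ext` being the uniqueness half. -/
theorem cexp_isCoalgHom [CharZero K] (h1 : f 1 = 0)
    (hf : ∀ ⦃k x⦄, x ∈ degree 𝒱 k → f x ∈ 𝒲 k) : IsCoalgHom (cexp 𝒲 f h1) where
  map_degree k x hx := by
    obtain ⟨m, hm⟩ := exists_mem_fil x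
    rw [cexp_eq_sum h1 (Nat.lt_succ_self m) hm]
    refine Submodule.sum_mem _ fun n _ => Submodule.smul_mem _ _ ?_
    exact convPow_mem_degree (fun k x hx => ι_mem_degree 𝒲 (hf hx)) n hx
  map_one := by
    rw [cexp_eq_sum h1 (Nat.lt_succ_self 0) (one_mem_fil 0), Finset.sum_range_one, expTerm,
      convPow_zero]
    simp [convUnit_apply]
  counit_map x := by
    have h := wcomp_cexp (𝒲 := 𝒲) h1 0 x
    rw [wcomp_zero, expTerm, convPow_zero] at h
    have h2 := congrArg (counit 𝒲) h
    simpa [convUnit_apply] using h2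
  comul_comp := by
    refine LinearMap.ext fun x => ?_
    obtain ⟨m, hm⟩ := exists_mem_fil x
    rw [LinearMap.comp_apply, LinearMap.comp_apply,
      map_cexp_of_mem_tensorFil h1 (comul_mem_tensorFil hm), cexp_eq_sum h1 (Nat.lt_succ_self m) hm,
      map_sum]
    refine Finset.sum_congr rfl fun n _ => ?_
    rw [← LinearMap.comp_apply, comul_comp_expTerm hf, LinearMap.sum_apply]
    rfl

end Exponential

/-! ### Coderivations from corestrictions, and top-weight terms of morphisms. -/

section LeadingTerm

variable {K : Type u} [Field K] {V : Type v} [AddCommGroup V] [Module K V]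
variable {𝒱 : ℤ → Submodule K V} [DirectSum.Decomposition 𝒱]
variable {W : Type w} [AddCommGroup W] [Module K W] {𝒲 : ℤ → Submodule K W}
  [DirectSum.Decomposition 𝒲]

/-- Applying the algebra map `Δ` to `r * id` gives `(r ⊗ 1 + 1 ⊗ r) * (inl * inr)`. In the second
term `1 ⊗ r` is moved past `inl`; since `r` has degree one, `conv_inr_inl` produces exactly the sign
of the coderivation rule. -/
theorem comul_comp_conv_ι_id {r : GSym 𝒱 →ₗ[K] V}
    (hr : ∀ ⦃k x⦄, x ∈ degree 𝒱 k → r x ∈ 𝒱 (k + 1)) :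
    comul 𝒱 ∘ₗ conv (ι 𝒱 ∘ₗ r) LinearMap.id =
      (TensorProduct.map (conv (ι 𝒱 ∘ₗ r) LinearMap.id) LinearMap.id +
        TensorProduct.map (sign 𝒱) (conv (ι 𝒱 ∘ₗ r) LinearMap.id)) ∘ₗ comul 𝒱 := by
  have hsum : (comulAlgHom 𝒱).toLinearMap ∘ₗ ι 𝒱 ∘ₗ r =
      (inl 𝒱).toLinearMap ∘ₗ (ι 𝒱 ∘ₗ r) + (inr 𝒱).toLinearMap ∘ₗ (ι 𝒱 ∘ₗ r) :=
    LinearMap.ext fun x => comulAlgHom_ι (r x)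
  have hid : (comulAlgHom 𝒱).toLinearMap ∘ₗ LinearMap.id =
      conv ((inl 𝒱).toLinearMap ∘ₗ LinearMap.id) ((inr 𝒱).toLinearMap ∘ₗ LinearMap.id) := by
    rw [conv_inl_inr, TensorProduct.map_id]
    rfl
  have h := conv_inr_inl (f := ι 𝒱 ∘ₗ r) (g := (LinearMap.id : GSym 𝒱 →ₗ[K] GSym 𝒱)) (m := 1)
    (fun k x hx => ι_mem_degree 𝒱 (hr hx)) (fun k x hx => hx)
  have key : (comulAlgHom 𝒱).toLinearMap ∘ₗ conv (ι 𝒱 ∘ₗ r) LinearMap.id =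
      conv ((inl 𝒱).toLinearMap ∘ₗ conv (ι 𝒱 ∘ₗ r) LinearMap.id)
        ((inr 𝒱).toLinearMap ∘ₗ LinearMap.id) +
      conv ((inl 𝒱).toLinearMap ∘ₗ sgn 𝒱 1)
        ((inr 𝒱).toLinearMap ∘ₗ conv (ι 𝒱 ∘ₗ r) LinearMap.id) := by
    rw [algHom_comp_conv, hsum, hid, add_conv, ← conv_assoc, ← conv_assoc, h, ← algHom_comp_conv,
      conv_assoc, ← algHom_comp_conv, LinearMap.id_comp]
  rw [conv_inl_inr, conv_inl_inr, sgn_one_eq] at key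
  rw [LinearMap.add_comp]
  exact key

theorem counit_sgn (i : ℤ) (x : GSym 𝒱) : counit 𝒱 (sgn 𝒱 i x) = counit 𝒱 x := by
  have h := wcomp_sgn 0 i x
  rw [wcomp_zero, wcomp_zero, Algebra.algebraMap_eq_smul_one, Algebra.algebraMap_eq_smul_one,
    map_smul, sgn_one] at h
  simpa using congrArg (counit 𝒱) h

theorem counit_sign (x : GSym 𝒱) : counit 𝒱 (sign 𝒱 x) = counit 𝒱 x := by
  rw [← sgn_one_eq, counit_sgn]

/-- The linear part of a linear map `S(V) → S(W)`. -/
def linPart (F : GSym 𝒱 →ₗ[K] GSym 𝒲) : V →ₗ[K] W := proj 𝒲 ∘ₗ F ∘ₗ ι 𝒱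

variable {F : GSym 𝒱 →ₗ[K] GSym 𝒲}

theorem IsCoalgHom.linPart_mem (hF : IsCoalgHom F) ⦃i : ℤ⦄ ⦃v : V⦄ (hv : v ∈ 𝒱 i) :
    linPart F v ∈ 𝒲 i :=
  proj_mem 𝒲 (hF.map_degree (ι_mem_degree 𝒱 hv))

theorem map_linear_of_mem_fil_one {M : Type*} [AddCommGroup M] [Module K M] {f : GSym 𝒱 →ₗ[K] M}
    (h1 : f 1 = 0) {x : GSym 𝒱} (hx : x ∈ fil 𝒱 1) : f x = f (ι 𝒱 (proj 𝒱 x)) := by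
  conv_lhs => rw [eq_of_mem_fil_one hx]
  rw [map_add, Algebra.algebraMap_eq_smul_one, map_smul, h1, smul_zero, zero_add]

theorem map_linear_of_mem_fil_zero {M : Type*} [AddCommGroup M] [Module K M] {f : GSym 𝒱 →ₗ[K] M}
    (h1 : f 1 = 0) {x : GSym 𝒱} (hx : x ∈ fil 𝒱 0) : f x = 0 := by
  rw [eq_of_mem_fil_zero hx, Algebra.algebraMap_eq_smul_one, map_smul, h1, smul_zero]

variable [CharZero K]

theorem IsCoalgHom.map_mem_fil (hF : IsCoalgHom F) {n : ℕ} {x : GSym 𝒱} (hx : x ∈ fil 𝒱 n) :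
    F x ∈ fil 𝒲 n := by
  refine mem_fil.2 fun m hm => ?_
  induction m generalizing n x with
  | zero => omega
  | succ m ih =>
    have h := wcomp_succ_of_comul_comp hF.comul_comp m x
    have h0 : conv (ι 𝒲 ∘ₗ proj 𝒲 ∘ₗ F) (wcomp 𝒲 m ∘ₗ F) x = 0 := by
      refine conv_eq_zero_of_mem_fil (fun i j hij a b ha hb => ?_) hx
      rcases Nat.eq_zero_or_pos i with rfl | hi
      · rw [map_linear_of_mem_fil_zero (by simp [hF.map_one, proj_one]) ha, zero_mul]
      · rw [LinearMap.comp_apply (wcomp 𝒲 m), ih hb (by omega), mul_zero]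
    rw [h0] at h
    simpa [Nat.cast_add_one_ne_zero m] using h

/-- The top weight component of a coalgebra morphism is induced by its linear part. -/
theorem IsCoalgHom.wcomp_apply (hF : IsCoalgHom F) {n : ℕ} {x : GSym 𝒱} (hx : x ∈ fil 𝒱 n) :
    wcomp 𝒲 n (F x) = map 𝒱 𝒲 (linPart F) hF.linPart_mem (wcomp 𝒱 n x) := by
  induction n generalizing x with
  | zero =>
    rw [wcomp_zero, wcomp_zero, hF.counit_map, AlgHom.commutes]
  | succ n ih =>
    set M := map 𝒱 𝒲 (linPart F) hF.linPart_mem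
    have h := wcomp_succ_of_comul_comp hF.comul_comp n x
    have h' := wcomp_succ_of_comul_comp (map_isCoalgHom (φ := linPart F)
      (hφ := hF.linPart_mem)).comul_comp n x
    -- Weight above one on the left leaves weight below `n` on the right, where the right map
    -- vanishes; in weight at most one the two corestrictions coincide.
    have h0 : conv (ι 𝒲 ∘ₗ proj 𝒲 ∘ₗ F - ι 𝒲 ∘ₗ proj 𝒲 ∘ₗ M.toLinearMap) (wcomp 𝒲 n ∘ₗ F) x = 0 := by
      refine conv_eq_zero_of_mem_fil (fun i j hij a b ha hb => ?_) hx
      rcases Nat.lt_or_ge 1 i with hi | hi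
      · rw [LinearMap.comp_apply (wcomp 𝒲 n), mem_fil.1 (hF.map_mem_fil hb) n (by omega), mul_zero]
      · rw [map_linear_of_mem_fil_one _ (fil_mono hi ha)]
        · simp [M, map_ι, linPart, proj_ι]
        · simp [hF.map_one, M]
    have h0' : conv (ι 𝒲 ∘ₗ proj 𝒲 ∘ₗ M.toLinearMap)
        (wcomp 𝒲 n ∘ₗ F - wcomp 𝒲 n ∘ₗ M.toLinearMap) x = 0 := by
      refine conv_eq_zero_of_mem_fil (fun i j hij a b ha hb => ?_) hx
      rcases Nat.eq_zero_or_pos i with rfl | hi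
      · rw [map_linear_of_mem_fil_zero (by simp [proj_one]) ha, zero_mul]
      · have hb' : (wcomp 𝒲 n ∘ₗ F - wcomp 𝒲 n ∘ₗ M.toLinearMap) b = 0 := by
          simp only [LinearMap.sub_apply, LinearMap.comp_apply, AlgHom.toLinearMap_apply]
          rw [ih (fil_mono (by omega) hb), wcomp_map, sub_self]
        rw [hb', mul_zero]
    rw [sub_conv, LinearMap.sub_apply, sub_eq_zero] at h0
    rw [conv_sub, LinearMap.sub_apply, sub_eq_zero] at h0'
    rw [h0, h0', ← h', AlgHom.toLinearMap_apply, wcomp_map] at h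
    exact smul_right_injective _ (Nat.cast_ne_zero.2 (Nat.succ_ne_zero n)) h

theorem IsCoalgHom.apply_ι (hF : IsCoalgHom F) (v : V) : F (ι 𝒱 v) = ι 𝒲 (linPart F v) := by
  rw [eq_of_mem_fil_one (hF.map_mem_fil (ι_mem_fil v)), hF.counit_map, counit_ι, map_zero, zero_add]
  rfl

theorem linPart_comp {U : Type*} [AddCommGroup U] [Module K U] {𝒰 : ℤ → Submodule K U}
    [DirectSum.Decomposition 𝒰] {G : GSym 𝒲 →ₗ[K] GSym 𝒰} (hF : IsCoalgHom F) :
    linPart (G ∘ₗ F) = linPart G ∘ₗ linPart F :=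
  LinearMap.ext fun v => by
    change proj 𝒰 (G (F (ι 𝒱 v))) = _
    rw [hF.apply_ι]; rfl

/-- A coalgebra morphism whose linear part is bijective is bijective. -/
theorem IsCoalgHom.bijective (hF : IsCoalgHom F) (hbij : Function.Bijective (linPart F)) :
    Function.Bijective F := by
  let e := LinearEquiv.ofBijective (linPart F) hbij
  have he : ∀ ⦃i v⦄, v ∈ 𝒲 i → e.symm.toLinearMap v ∈ 𝒱 i := fun i v hv =>
    mem_of_map_mem hF.linPart_mem hbij.1 (by
      change e (e.symm v) ∈ _
      rwa [e.apply_symm_apply])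
  set M := map 𝒱 𝒲 (linPart F) hF.linPart_mem with hM
  have h1 : ∀ x, map 𝒲 𝒱 e.symm.toLinearMap he (M x) = x := fun x => by
    rw [hM, map_map, map_congr (ψ := LinearMap.id) (hψ := fun _ _ h => h), map_id]
    exact LinearMap.ext fun v => e.symm_apply_apply v
  have h2 : ∀ x, M (map 𝒲 𝒱 e.symm.toLinearMap he x) = x := fun x => by
    rw [hM, map_map, map_congr (ψ := LinearMap.id) (hψ := fun _ _ h => h), map_id]
    exact LinearMap.ext fun v => e.apply_symm_apply v
  constructor
  · rw [injective_iff_map_eq_zero]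
    intro x hx
    obtain ⟨n, hn⟩ := exists_mem_fil x
    have key : ∀ n, x ∈ fil 𝒱 n → wcomp 𝒱 n x = 0 := fun n hn => by
      have h := hF.wcomp_apply hn
      rw [hx, map_zero] at h
      rw [← h1 (wcomp 𝒱 n x), ← h, map_zero]
    induction n with
    | zero => rw [eq_of_mem_fil_zero hn, ← wcomp_zero, key 0 hn]
    | succ n ih => exact ih (mem_fil_of_wcomp_eq_zero hn (key _ hn))
  · intro y
    obtain ⟨n, hn⟩ := exists_mem_fil y
    induction n generalizing y with
    | zero =>
      refine ⟨algebraMap K _ (counit 𝒲 y), ?_⟩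
      rw [Algebra.algebraMap_eq_smul_one, map_smul, hF.map_one, ← Algebra.algebraMap_eq_smul_one,
        ← eq_of_mem_fil_zero hn]
    | succ n ih =>
      -- An approximate preimage: inverting the linear part on the top-weight term leaves an error
      -- of smaller weight.
      set x := map 𝒲 𝒱 e.symm.toLinearMap he (wcomp 𝒲 (n + 1) y) with hx
      have hxf : x ∈ fil 𝒱 (n + 1) := GSym.map_mem_fil (wcomp_mem_fil _)
      have hy : y - F x ∈ fil 𝒲 n := by
        refine mem_fil_of_wcomp_eq_zero (Submodule.sub_mem _ hn (hF.map_mem_fil hxf)) ?_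
        rw [map_sub, hF.wcomp_apply hxf, hx, wcomp_map, wcomp_wcomp_self, ← hM, h2, sub_self]
      obtain ⟨z, hz⟩ := ih _ hy
      exact ⟨z + x, by rw [map_add, hz, sub_add_cancel]⟩

theorem IsCoalgHom.symm {E : GSym 𝒱 ≃ₗ[K] GSym 𝒲} (hE : IsCoalgHom E.toLinearMap) :
    IsCoalgHom E.symm.toLinearMap where
  map_degree k x hx := mem_of_map_mem (f := E.toLinearMap) hE.map_degree E.injective (by simpa using hx)
  map_one := by
    rw [LinearEquiv.coe_coe, LinearEquiv.symm_apply_eq]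
    exact hE.map_one.symm
  counit_map x := by
    have := hE.counit_map (E.symm x)
    simpa using this.symm
  comul_comp := by
    have h := hE.comul_comp
    refine LinearMap.ext fun x => ?_
    have h1 := LinearMap.congr_fun h (E.symm x)
    simp only [LinearMap.comp_apply, LinearEquiv.coe_coe, LinearEquiv.apply_symm_apply] at h1
    simp only [LinearMap.comp_apply, LinearEquiv.coe_coe]
    rw [h1, TensorProduct.map_map]
    simp

end LeadingTerm

end GSym

section Graded

variable {R M N P Q : Type*} [CommRing R] [AddCommGroup M] [Module R M] [AddCommGroup N]
  [Module R N] [AddCommGroup P] [Module R P] [AddCommGroup Q] [Module R Q]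

theorem tensorMap_sub_left (f g : M →ₗ[R] P) (h : N →ₗ[R] Q) :
    TensorProduct.map (f - g) h = TensorProduct.map f h - TensorProduct.map g h := by
  rw [eq_sub_iff_add_eq, ← TensorProduct.map_add_left, sub_add_cancel]

theorem tensorMap_sub_right (f : M →ₗ[R] P) (g h : N →ₗ[R] Q) :
    TensorProduct.map f (g - h) = TensorProduct.map f g - TensorProduct.map f h := by
  rw [eq_sub_iff_add_eq, ← TensorProduct.map_add_right, sub_add_cancel]

end Graded

namespace GSym

/-! ### The projection onto `S(V⁰)`. -/

section DegreeZero

variable {K : Type u} [Field K] {V : Type v} [AddCommGroup V] [Module K V]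
variable {𝒱 : ℤ → Submodule K V} [DirectSum.Decomposition 𝒱]

theorem component_mem {i j : ℤ} {v : V} (hv : v ∈ 𝒱 j) : GCohomology.component 𝒱 i v ∈ 𝒱 j := by
  rw [GCohomology.component_apply]
  by_cases h : j = i
  · subst h; exact (DirectSum.decompose 𝒱 v j).2
  · rw [DirectSum.decompose_of_mem_ne 𝒱 hv h]; exact Submodule.zero_mem _

theorem component_of_mem {i : ℤ} {v : V} (hv : v ∈ 𝒱 i) : GCohomology.component 𝒱 i v = v :=
  DirectSum.decompose_of_mem_same 𝒱 hv

theorem component_of_mem_ne {i j : ℤ} (h : j ≠ i) {v : V} (hv : v ∈ 𝒱 j) :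
    GCohomology.component 𝒱 i v = 0 := DirectSum.decompose_of_mem_ne 𝒱 hv h

theorem component_apply_mem (i : ℤ) (v : V) : GCohomology.component 𝒱 i v ∈ 𝒱 i :=
  (DirectSum.decompose 𝒱 v i).2

variable (𝒱) in
/-- The projection of `S(V)` onto `S(V⁰)`. -/
def zeroPart : GSym 𝒱 →ₐ[K] GSym 𝒱 :=
  map 𝒱 𝒱 (GCohomology.component 𝒱 0) fun _ _ => component_mem

theorem zeroPart_ι (v : V) : zeroPart 𝒱 (ι 𝒱 v) = ι 𝒱 (GCohomology.component 𝒱 0 v) := map_ι _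

theorem zeroPart_isCoalgHom : IsCoalgHom (zeroPart 𝒱).toLinearMap := map_isCoalgHom

theorem zeroPart_mem (x : GSym 𝒱) : zeroPart 𝒱 x ∈ degree 𝒱 0 := by
  induction x using induction with
  | one => rw [map_one]; exact one_mem_degree
  | add x y hx hy => rw [map_add]; exact Submodule.add_mem _ hx hy
  | smul c x hx => rw [map_smul]; exact Submodule.smul_mem _ _ hx
  | ι_mul i v _ x hx =>
    rw [map_mul, zeroPart_ι]
    have h := ι_mul_mem_degree (component_apply_mem 0 v) hx
    rwa [zero_add] at h

theorem zeroPart_of_mem_ne {k : ℤ} (hk : k ≠ 0) {x : GSym 𝒱} (hx : x ∈ degree 𝒱 k) :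
    zeroPart 𝒱 x = 0 :=
  eq_of_mem_of_mem_ne hk (map_mem_degree hx) (zeroPart_mem x)

/-- Without negative degrees, a nonzero product of total degree at most zero has only factors of
degree zero. -/
theorem zeroPart_of_mem (hneg : ∀ i < 0, 𝒱 i = ⊥) {k : ℤ} (hk : k ≤ 0) {x : GSym 𝒱}
    (hx : x ∈ degree 𝒱 k) : zeroPart 𝒱 x = x := by
  suffices h : degree 𝒱 k ≤ LinearMap.eqLocus (zeroPart 𝒱).toLinearMap LinearMap.id from h hx
  refine Submodule.span_le.2 ?_
  rintro _ ⟨l, hl, hlk, rfl⟩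
  by_cases h : ∃ a ∈ l, a.1 < 0
  · obtain ⟨a, ha, ha0⟩ := h
    have h0 : a.2 = 0 := by simpa [hneg _ ha0] using hl a ha
    have : (l.map fun a => ι 𝒱 a.2).prod = 0 :=
      List.prod_eq_zero (List.mem_map.2 ⟨a, ha, by rw [h0, map_zero]⟩)
    rw [this]
    exact Submodule.zero_mem _
  · push Not at h
    have hz : ∀ a ∈ l, a.1 = 0 := by
      have hs : (l.map Prod.fst).sum = 0 :=
        le_antisymm (hlk ▸ hk) (List.sum_nonneg (by simpa using fun b c hb => h (b, c) hb))
      intro a ha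
      exact List.all_zero_of_le_zero_le_of_sum_eq_zero
        (by simpa using fun b c hb => h (b, c) hb) hs (List.mem_map.2 ⟨a, ha, rfl⟩)
    change zeroPart 𝒱 _ = _
    rw [map_list_prod, List.map_map]
    congr 1
    refine List.map_congr_left fun a ha => ?_
    rw [Function.comp_apply, zeroPart_ι, component_of_mem]
    rw [← hz a ha]
    exact hl a ha

theorem eq_zero_of_mem_degree_neg (hneg : ∀ i < 0, 𝒱 i = ⊥) {k : ℤ} (hk : k < 0) {x : GSym 𝒱}
    (hx : x ∈ degree 𝒱 k) : x = 0 := by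
  rw [← zeroPart_of_mem hneg hk.le hx, zeroPart_of_mem_ne hk.ne hx]

theorem wcomp_extend {a : V →ₗ[K] V} {s : ℤ} (ha : ∀ ⦃i v⦄, v ∈ 𝒱 i → a v ∈ 𝒱 (i + s)) (n : ℕ)
    (x : GSym 𝒱) : wcomp 𝒱 n (extend 𝒱 a x) = extend 𝒱 a (wcomp 𝒱 n x) := by
  induction x using induction generalizing n with
  | one => rw [extend_one, wcomp_one, map_zero]; split_ifs <;> simp [extend_one]
  | add x y hx hy => simp only [map_add, hx, hy]
  | smul c x hx => simp only [map_smul, hx]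
  | ι_mul i v hv x hx =>
    rw [extend_ι_mul ha hv, map_add, map_smul]
    rcases n with _ | n
    · simp [wcomp_zero_ι_mul]
    · rw [wcomp_succ_ι_mul, wcomp_succ_ι_mul, wcomp_succ_ι_mul, extend_ι_mul ha hv, hx]

theorem extend_mem_degree {a : V →ₗ[K] V} {s : ℤ} (ha : ∀ ⦃i v⦄, v ∈ 𝒱 i → a v ∈ 𝒱 (i + s)) ⦃k : ℤ⦄
    ⦃x : GSym 𝒱⦄ (hx : x ∈ degree 𝒱 k) : extend 𝒱 a x ∈ degree 𝒱 (k + s) := by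
  have := conv_mem_degree (f := ι 𝒱 ∘ₗ a ∘ₗ proj 𝒱) (g := LinearMap.id) (m := s) (n := 0)
    (fun k x hx => ι_mem_degree 𝒱 (ha (proj_mem 𝒱 hx))) (fun k x hx => by simpa using hx) hx
  rwa [add_zero] at this

theorem proj_conv_ι_id (r : GSym 𝒱 →ₗ[K] V) :
    proj 𝒱 ∘ₗ conv (ι 𝒱 ∘ₗ r) LinearMap.id = r := by
  refine LinearMap.ext fun x => ?_
  have h := wcomp_succ_conv_ι 0 r LinearMap.id x
  have h1 : wcomp 𝒱 0 ∘ₗ LinearMap.id = convUnit := LinearMap.ext fun x => by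
    rw [LinearMap.comp_apply, wcomp_zero, convUnit_apply]; rfl
  rw [h1, conv_convUnit, zero_add, wcomp_one_eq] at h
  simpa [proj_ι] using congrArg (proj 𝒱) h

end DegreeZero

end GSym

namespace LInftyOne

open GSym

variable {K : Type u} [Field K] [CharZero K]
variable {V : Type v} [AddCommGroup V] [Module K V] {𝒱 : ℤ → Submodule K V}
  [DirectSum.Decomposition 𝒱]
variable {W : Type w} [AddCommGroup W] [Module K W] {𝒲 : ℤ → Submodule K W}
  [DirectSum.Decomposition 𝒲]
variable {U : Type*} [AddCommGroup U] [Module K U] {𝒰 : ℤ → Submodule K U}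
  [DirectSum.Decomposition 𝒰]

/-! ### `L∞[1]` algebras and morphisms through their corestrictions. -/

section Structure

variable (X : LInftyOne 𝒱)

/-- The corestriction `∑ₙ qₙ : S(V) → V` of the coderivation. -/
def q : GSym 𝒱 →ₗ[K] V := proj 𝒱 ∘ₗ X.Q

theorem q_mem ⦃k : ℤ⦄ ⦃x : GSym 𝒱⦄ (hx : x ∈ degree 𝒱 k) : X.q x ∈ 𝒱 (k + 1) :=
  proj_mem 𝒱 (X.map_degree hx)

theorem q_one : X.q 1 = 0 := X.map_one

theorem q_ι (v : V) : X.q (ι 𝒱 v) = X.q₁ v := rfl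

/-- The difference is a coderivation with zero corestriction, hence zero: `Q` is rebuilt from its
Taylor coefficients. -/
theorem Q_eq : X.Q = conv (ι 𝒱 ∘ₗ X.q) LinearMap.id := by
  rw [← sub_eq_zero]
  refine coderivation_eq_zero (F := LinearMap.id) (T := sign 𝒱) (fun _ => rfl) counit_sign ?_ ?_
  · rw [LinearMap.comp_sub, X.comul_comp, comul_comp_conv_ι_id X.q_mem, ← LinearMap.sub_comp]
    congr 1
    rw [tensorMap_sub_left, tensorMap_sub_right]
    abel
  · rw [LinearMap.comp_sub, proj_conv_ι_id, q, sub_self]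

theorem Q_one : X.Q 1 = 0 := by
  rw [Q_eq, conv_one_apply, LinearMap.comp_apply, q_one, map_zero, zero_mul]

theorem counit_Q (x : GSym 𝒱) : counit 𝒱 (X.Q x) = 0 := by
  have h := wcomp_zero_conv_ι X.q LinearMap.id x
  rw [← Q_eq, wcomp_zero] at h
  simpa using congrArg (counit 𝒱) h

/-- The coderivation `Q` agrees with its linear part up to terms of lower weight. -/
theorem wcomp_Q {n k : ℕ} (hk : n ≤ k) {x : GSym 𝒱} (hx : x ∈ fil 𝒱 n) :
    wcomp 𝒱 k (X.Q x) = extend 𝒱 X.q₁ (wcomp 𝒱 k x) := by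
  rw [← wcomp_extend X.q₁_mem, ← sub_eq_zero, ← map_sub, Q_eq, extend, ← LinearMap.sub_apply,
    ← sub_conv, ← LinearMap.comp_sub]
  rcases k with _ | k
  · exact wcomp_zero_conv_ι _ _ _
  · rw [wcomp_succ_conv_ι]
    refine conv_eq_zero_of_mem_fil (fun i j hij a b ha hb => ?_) hx
    rcases Nat.lt_or_ge 1 i with hi | hi
    · rw [LinearMap.comp_id, mem_fil.1 hb k (by omega), mul_zero]
    · rw [LinearMap.comp_apply, map_linear_of_mem_fil_one _ (fil_mono hi ha)]
      · simp [q_ι, proj_ι]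
      · simp [q_one, proj_one]

theorem Q_mem_fil {n : ℕ} {x : GSym 𝒱} (hx : x ∈ fil 𝒱 n) : X.Q x ∈ fil 𝒱 n :=
  mem_fil.2 fun k hk => by rw [X.wcomp_Q hk.le hx, mem_fil.1 hx k hk, map_zero]

theorem Q_ι (v : V) : X.Q (ι 𝒱 v) = ι 𝒱 (X.q₁ v) := by
  rw [eq_of_mem_fil_one (X.Q_mem_fil (ι_mem_fil v)), counit_Q, map_zero, zero_add]
  rfl

theorem Q_Q (x : GSym 𝒱) : X.Q (X.Q x) = 0 := LinearMap.congr_fun X.comp_self x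

theorem q₁_q₁ (v : V) : X.q₁ (X.q₁ v) = 0 := by
  have h := X.Q_Q (ι 𝒱 v)
  rw [Q_ι, Q_ι] at h
  simpa [proj_ι] using congrArg (proj 𝒱) h

variable {X} {Y : LInftyOne 𝒲} {Z : LInftyOne 𝒰}

theorem Hom.isCoalgHom (F : Hom X Y) : IsCoalgHom F.F :=
  ⟨F.map_degree, F.map_one, F.counit_map, F.comul_comp⟩

/-- A coalgebra morphism is an `L∞[1]` morphism if it is compatible with the corestrictions. -/
theorem comm_of_proj {F : GSym 𝒱 →ₗ[K] GSym 𝒲} (hF : IsCoalgHom F)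
    (h : proj 𝒲 ∘ₗ F ∘ₗ X.Q = Y.q ∘ₗ F) : F ∘ₗ X.Q = Y.Q ∘ₗ F := by
  rw [← sub_eq_zero]
  refine coderivation_eq_zero (F := F) (T := F ∘ₗ sign 𝒱) hF.counit_map
    (fun x => by rw [LinearMap.comp_apply, hF.counit_map, counit_sign]) ?_ ?_
  · have h1 : comul 𝒲 ∘ₗ F ∘ₗ X.Q = (TensorProduct.map (F ∘ₗ X.Q) F +
        TensorProduct.map (F ∘ₗ sign 𝒱) (F ∘ₗ X.Q)) ∘ₗ comul 𝒱 := by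
      rw [← LinearMap.comp_assoc, hF.comul_comp, LinearMap.comp_assoc, X.comul_comp,
        ← LinearMap.comp_assoc, LinearMap.comp_add, ← TensorProduct.map_comp,
        ← TensorProduct.map_comp, LinearMap.comp_id]
    have h2 : comul 𝒲 ∘ₗ Y.Q ∘ₗ F = (TensorProduct.map (Y.Q ∘ₗ F) F +
        TensorProduct.map (F ∘ₗ sign 𝒱) (Y.Q ∘ₗ F)) ∘ₗ comul 𝒱 := by
      rw [← LinearMap.comp_assoc, Y.comul_comp, LinearMap.comp_assoc, hF.comul_comp,
        ← LinearMap.comp_assoc, LinearMap.add_comp, ← TensorProduct.map_comp,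
        ← TensorProduct.map_comp, LinearMap.id_comp, hF.sign_comp]
    rw [LinearMap.comp_sub, h1, h2, ← LinearMap.sub_comp]
    congr 1
    rw [tensorMap_sub_left, tensorMap_sub_right]
    abel
  · rw [LinearMap.comp_sub, h, ← LinearMap.comp_assoc]
    exact sub_self _

/-- The `L∞[1]` morphism with a given underlying coalgebra morphism. -/
def Hom.ofCoalgHom {F : GSym 𝒱 →ₗ[K] GSym 𝒲} (hF : IsCoalgHom F) (h : F ∘ₗ X.Q = Y.Q ∘ₗ F) :
    Hom X Y := ⟨F, hF.map_degree, hF.map_one, hF.counit_map, hF.comul_comp, h⟩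

/-- Composition of `L∞[1]` morphisms. -/
def Hom.comp (G : Hom Y Z) (F : Hom X Y) : Hom X Z :=
  Hom.ofCoalgHom (G.isCoalgHom.comp F.isCoalgHom) (by
    rw [LinearMap.comp_assoc, F.comm, ← LinearMap.comp_assoc, G.comm, LinearMap.comp_assoc])

theorem Hom.comp_f₁ (G : Hom Y Z) (F : Hom X Y) : (G.comp F).f₁ = G.f₁ ∘ₗ F.f₁ :=
  linPart_comp F.isCoalgHom

theorem Hom.comm_apply (F : Hom X Y) (x : GSym 𝒱) : F.F (X.Q x) = Y.Q (F.F x) :=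
  LinearMap.congr_fun F.comm x

theorem Hom.f₁_q₁ (F : Hom X Y) (v : V) : F.f₁ (X.q₁ v) = Y.q₁ (F.f₁ v) := by
  have h := F.comm_apply (ι 𝒱 v)
  rw [Q_ι, F.isCoalgHom.apply_ι, F.isCoalgHom.apply_ι, Q_ι] at h
  have h' := congrArg (proj 𝒲) h
  rwa [proj_ι, proj_ι] at h'

theorem Hom.IsWeakEquivalence.comp {G : Hom Y Z} {F : Hom X Y} (hG : G.IsWeakEquivalence)
    (hF : F.IsWeakEquivalence) : (G.comp F).IsWeakEquivalence := by
  constructor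
  · intro v hv h
    rw [Hom.comp_f₁] at h
    exact hF.1 v hv (hG.1 _ (by rw [← F.f₁_q₁, hv, map_zero]) h)
  · intro w hw
    obtain ⟨u, hu, u', hu'⟩ := hG.2 w hw
    obtain ⟨v, hv, v', hv'⟩ := hF.2 u hu
    refine ⟨v, hv, u' + G.f₁ v', ?_⟩
    rw [Hom.comp_f₁, LinearMap.comp_apply, map_add, hu', ← G.f₁_q₁, hv', map_sub]
    abel

theorem Hom.IsWeakEquivalence.bijective {F : Hom X Y} (hF : F.IsWeakEquivalence)
    (hX : X.IsMinimal) (hY : Y.IsMinimal) : Function.Bijective F.f₁ := by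
  rw [IsMinimal] at hX hY
  constructor
  · rw [injective_iff_map_eq_zero]
    intro v hv
    simpa [hX] using hF.1 v (by simp [hX]) (by rw [hv]; exact Submodule.zero_mem _)
  · intro w
    obtain ⟨v, -, u, hu⟩ := hF.2 w (by simp [hY])
    refine ⟨v, ?_⟩
    rw [hY, LinearMap.zero_apply] at hu
    exact (sub_eq_zero.1 hu.symm).symm

/-- The inverse of a bijective `L∞[1]` morphism. -/
theorem Hom.exists_inverse (F : Hom X Y) (hF : Function.Bijective F.f₁) :
    ∃ G : Hom Y X, (∀ x, G.F (F.F x) = x) ∧ ∀ y, F.F (G.F y) = y := by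
  let E := LinearEquiv.ofBijective F.F (F.isCoalgHom.bijective hF)
  have hE : IsCoalgHom E.toLinearMap := F.isCoalgHom
  refine ⟨Hom.ofCoalgHom hE.symm ?_, E.symm_apply_apply, E.apply_symm_apply⟩
  refine LinearMap.ext fun y => E.injective ?_
  have := F.comm_apply (E.symm y)
  change E (E.symm (Y.Q y)) = F.F (X.Q (E.symm y))
  rw [this, E.apply_symm_apply]
  exact congrArg Y.Q (E.apply_symm_apply y).symm

end Structure

/-! ### Structures with brackets from `V⁰` to `V¹` only. -/

section TwoTerm

/-- The `L∞[1]` structure with corestriction `r`, where `r` factors through `S(V⁰)` and has values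
in `V¹`. -/
def ofZeroPart (r : GSym 𝒱 →ₗ[K] V) (h0 : r ∘ₗ (zeroPart 𝒱).toLinearMap = r)
    (h1 : ∀ x, r x ∈ 𝒱 1) (hr1 : r 1 = 0) : LInftyOne 𝒱 :=
  have hdeg : ∀ ⦃k x⦄, x ∈ degree 𝒱 k → r x ∈ 𝒱 (k + 1) := fun k x hx => by
    rcases eq_or_ne k 0 with rfl | hk
    · simpa using h1 x
    · rw [← h0, LinearMap.comp_apply, AlgHom.toLinearMap_apply, zeroPart_of_mem_ne hk hx, map_zero]
      exact Submodule.zero_mem _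
  have hmap : ∀ ⦃k x⦄, x ∈ degree 𝒱 k → conv (ι 𝒱 ∘ₗ r) LinearMap.id x ∈ degree 𝒱 (k + 1) :=
    fun k x hx => by
      simpa using conv_mem_degree (f := ι 𝒱 ∘ₗ r) (g := LinearMap.id) (m := 1) (n := 0)
        (fun k x hx => ι_mem_degree 𝒱 (hdeg hx)) (fun k x hx => by simpa using hx) hx
  { Q := conv (ι 𝒱 ∘ₗ r) LinearMap.id
    map_degree := hmap
    comul_comp := comul_comp_conv_ι_id hdeg
    map_one := by
      rw [conv_one_apply, LinearMap.comp_apply, hr1, map_zero, zero_mul, map_zero]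
    comp_self := by
      set R := conv (ι 𝒱 ∘ₗ r) LinearMap.id with hR
      have hc := comul_comp_conv_ι_id hdeg
      rw [← hR] at hc
      -- This anticommutation cancels the cross terms, making `R ∘ R` an untwisted coderivation.
      have hs : sign 𝒱 ∘ₗ R = -(R ∘ₗ sign 𝒱) := by
        refine linearMap_ext_degree fun k x hx => ?_
        rw [LinearMap.neg_apply, LinearMap.comp_apply, LinearMap.comp_apply, sign_of_mem hx,
          sign_of_mem (hmap hx), map_smul, zpow_add_one₀ (by simp)]
        simp
      have hss : sign 𝒱 ∘ₗ sign 𝒱 = LinearMap.id := by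
        refine linearMap_ext_degree fun k x hx => ?_
        rw [LinearMap.comp_apply, sign_of_mem hx, map_smul, sign_of_mem hx, smul_smul, ← mul_zpow]
        simp
      refine coderivation_eq_zero (F := LinearMap.id) (T := LinearMap.id) (fun _ => rfl)
        (fun _ => rfl) ?_ ?_
      · rw [← LinearMap.comp_assoc, hc, LinearMap.comp_assoc, hc, ← LinearMap.comp_assoc]
        congr 1
        simp only [LinearMap.comp_add, LinearMap.add_comp, ← TensorProduct.map_comp, hs, hss,
          LinearMap.id_comp, LinearMap.comp_id]
        rw [← neg_one_smul K (R ∘ₗ sign 𝒱), TensorProduct.map_smul_left]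
        module
      -- The corestriction of `R ∘ R` is zero: `r` sees only `S(V⁰)`, while every term of `R x`
      -- contains a factor from `V¹`.
      · rw [← LinearMap.comp_assoc, hR, proj_conv_ι_id, ← h0, LinearMap.comp_assoc,
          algHom_comp_conv]
        have : (zeroPart 𝒱).toLinearMap ∘ₗ ι 𝒱 ∘ₗ r ∘ₗ (zeroPart 𝒱).toLinearMap = 0 := by
          refine LinearMap.ext fun x => ?_
          simp only [LinearMap.comp_apply, AlgHom.toLinearMap_apply, zeroPart_ι]
          rw [component_of_mem_ne (j := 1) (by norm_num) (h1 _), map_zero, LinearMap.zero_apply]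
        rw [this, zero_conv, LinearMap.comp_zero] }

theorem q_ofZeroPart {r : GSym 𝒱 →ₗ[K] V} {h0 : r ∘ₗ (zeroPart 𝒱).toLinearMap = r}
    {h1 : ∀ x, r x ∈ 𝒱 1} {hr1 : r 1 = 0} : (ofZeroPart r h0 h1 hr1).q = r :=
  proj_conv_ι_id r

end TwoTerm

end LInftyOne

/-! ### Factorization of linear maps and homogeneous parts. -/

section Graded

variable {K : Type*} [Field K] {M N P : Type*} [AddCommGroup M] [Module K M] [AddCommGroup N]
  [Module K N] [AddCommGroup P] [Module K P]

/-- This factorization replaces explicit tree formulas for the transferred structure: a map is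
prescribed on an image, and only compatibility with the relations has to be checked. -/
theorem LinearMap.exists_comp_eq_of_ker_le_ker (A : M →ₗ[K] N) (B : M →ₗ[K] P)
    (h : LinearMap.ker A ≤ LinearMap.ker B) : ∃ C : N →ₗ[K] P, C ∘ₗ A = B := by
  obtain ⟨C, hC⟩ := LinearMap.exists_extend
    ((LinearMap.ker A).liftQ B h ∘ₗ A.quotKerEquivRange.symm.toLinearMap)
  refine ⟨C, LinearMap.ext fun x => ?_⟩
  have h1 := LinearMap.congr_fun hC (A.rangeRestrict x)
  have h2 : A.quotKerEquivRange.symm (A.rangeRestrict x) = (LinearMap.ker A).mkQ x := by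
    rw [LinearEquiv.symm_apply_eq]; rfl
  simp only [LinearMap.comp_apply, LinearEquiv.coe_coe, h2] at h1
  exact h1

variable (ℳ : ℤ → Submodule K M) [DirectSum.Decomposition ℳ] (𝒩 : ℤ → Submodule K N)
  [DirectSum.Decomposition 𝒩]

/-- The homogeneous part of degree `s` of a linear map between graded spaces. -/
def gradedPart (a : M →ₗ[K] N) (s : ℤ) : M →ₗ[K] N :=
  DirectSum.toModule K ℤ N (fun k => GCohomology.component 𝒩 (k + s) ∘ₗ a ∘ₗ (ℳ k).subtype) ∘ₗ
    (DirectSum.decomposeLinearEquiv ℳ).toLinearMap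

variable {ℳ 𝒩}

theorem gradedPart_of_mem (a : M →ₗ[K] N) (s : ℤ) {k : ℤ} {v : M} (hv : v ∈ ℳ k) :
    gradedPart ℳ 𝒩 a s v = GCohomology.component 𝒩 (k + s) (a v) := by
  simp only [gradedPart, LinearMap.comp_apply, LinearEquiv.coe_coe,
    DirectSum.decomposeLinearEquiv_apply, DirectSum.decompose_of_mem _ hv]
  rw [← DirectSum.lof_eq_of K, DirectSum.toModule_lof]
  rfl

theorem gradedPart_mem (a : M →ₗ[K] N) (s : ℤ) ⦃k : ℤ⦄ ⦃v : M⦄ (hv : v ∈ ℳ k) :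
    gradedPart ℳ 𝒩 a s v ∈ 𝒩 (k + s) := by
  rw [gradedPart_of_mem a s hv]
  exact GSym.component_apply_mem _ _

theorem linearMap_ext_graded {f g : M →ₗ[K] N} (h : ∀ k, ∀ v ∈ ℳ k, f v = g v) : f = g := by
  refine LinearMap.ext fun x => ?_
  induction x using DirectSum.Decomposition.inductionOn ℳ with
  | zero => simp
  | homogeneous y => exact h _ _ y.2
  | add x y hx hy => rw [map_add, map_add, hx, hy]

end Graded

/-! ### Contraction of a complex onto its cohomology. -/

namespace GCohomology

variable {K : Type u} [Field K] {V : Type v} [AddCommGroup V] [Module K V]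

/-- A contraction of a complex onto its cohomology. -/
structure Contraction (𝒱 : ℤ → Submodule K V) (d : V →ₗ[K] V) where
  /-- The projection onto the cohomology. -/
  π : V →ₗ[K] GCohomology d
  /-- The inclusion of the cohomology. -/
  i : GCohomology d →ₗ[K] V
  /-- The homotopy. -/
  h : V →ₗ[K] V
  π_mem : ∀ ⦃k v⦄, v ∈ 𝒱 k → π v ∈ degree 𝒱 d k
  i_mem : ∀ ⦃k x⦄, x ∈ degree 𝒱 d k → i x ∈ 𝒱 k
  h_mem : ∀ ⦃k v⦄, v ∈ 𝒱 k → h v ∈ 𝒱 (k + -1)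
  π_ker : ∀ z : LinearMap.ker d, π z = mk d z
  π_d : ∀ v, π (d v) = 0
  d_i : ∀ x, d (i x) = 0
  π_i : ∀ x, π (i x) = x
  π_h : ∀ v, π (h v) = 0
  homotopy : ∀ v, d (h v) + h (d v) = v - i (π v)

/-- Over a field there is `s` of degree `-1` with `d s d = d`. Then `v - s d v` is a cocycle, whose
class defines `π`, and `s` composed with `1 - s d - i π` is the homotopy. -/
theorem exists_contraction {𝒱 : ℤ → Submodule K V} [DirectSum.Decomposition 𝒱] {d : V →ₗ[K] V}
    [DirectSum.Decomposition (degree 𝒱 d)]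
    (hd : ∀ ⦃i : ℤ⦄ ⦃v : V⦄, v ∈ 𝒱 i → d v ∈ 𝒱 (i + 1)) (hdd : ∀ v, d (d v) = 0) :
    Nonempty (Contraction 𝒱 d) := by
  obtain ⟨s, hs, hdsd⟩ : ∃ s : V →ₗ[K] V, (∀ ⦃k v⦄, v ∈ 𝒱 k → s v ∈ 𝒱 (k + -1)) ∧
      ∀ v, d (s (d v)) = d v := by
    obtain ⟨g, hg⟩ := LinearMap.exists_rightInverse_of_surjective d.rangeRestrict
      (LinearMap.range_eq_top.2 d.surjective_rangeRestrict)
    obtain ⟨s0, hs0⟩ := LinearMap.exists_extend g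
    -- Since `d` is homogeneous of degree 1, the degree `-1` part of an arbitrary section satisfies
    -- the same identity.
    refine ⟨gradedPart 𝒱 𝒱 s0 (-1), gradedPart_mem s0 (-1), fun v => ?_⟩
    have h0 : ∀ v, d (s0 (d v)) = d v := fun v => by
      have h1 := LinearMap.congr_fun hs0 (d.rangeRestrict v)
      have h2 := congrArg Subtype.val (LinearMap.congr_fun hg (d.rangeRestrict v))
      change s0 (d v) = _ at h1
      rw [h1]
      exact h2
    suffices h : d ∘ₗ gradedPart 𝒱 𝒱 s0 (-1) ∘ₗ d = d from LinearMap.congr_fun h v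
    refine linearMap_ext_graded (ℳ := 𝒱) fun k v hv => ?_
    rw [LinearMap.comp_apply, LinearMap.comp_apply, gradedPart_of_mem s0 (-1) (hd hv),
      map_component hd, h0, show k + 1 + -1 + 1 = k + 1 by ring]
    exact GSym.component_of_mem (hd hv)
  have hdi : ∀ v, d (v - s (d v)) = 0 := fun v => by rw [map_sub, hdsd, sub_self]
  let π : V →ₗ[K] GCohomology d :=
    mk d ∘ₗ (LinearMap.id - s ∘ₗ d).codRestrict (LinearMap.ker d) fun v => hdi v
  have hπ : ∀ v, π v = mk d ⟨v - s (d v), hdi v⟩ := fun v => rfl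
  have hπker : ∀ z : LinearMap.ker d, π z = mk d z := fun z => by
    rw [hπ]
    refine congrArg (mk d) (Subtype.ext ?_)
    change (z : V) - s (d z) = z
    rw [LinearMap.mem_ker.1 z.2, map_zero, sub_zero]
  have hmk : ∀ z : LinearMap.ker d, mk d z = 0 ↔ (z : V) ∈ LinearMap.range d := fun z =>
    Submodule.Quotient.mk_eq_zero _
  have hπd : ∀ v, π (d v) = 0 := fun v => by
    have h := hπker ⟨d v, hdd v⟩
    change π (d v) = _ at h
    rw [h, hmk]
    exact ⟨v, rfl⟩
  obtain ⟨i0, hi0⟩ := LinearMap.exists_rightInverse_of_surjective (mk d)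
    (LinearMap.range_eq_top.2 (Submodule.mkQ_surjective _))
  let i : GCohomology d →ₗ[K] V := gradedPart (degree 𝒱 d) 𝒱 ((LinearMap.ker d).subtype ∘ₗ i0) 0
  have hi : ∀ ⦃k x⦄, x ∈ degree 𝒱 d k → i x ∈ 𝒱 k := fun k x hx => by
    simpa using gradedPart_mem (ℳ := degree 𝒱 d) (𝒩 := 𝒱)
      ((LinearMap.ker d).subtype ∘ₗ i0) 0 hx
  have hi' : ∀ ⦃k x⦄, x ∈ degree 𝒱 d k → i x = component 𝒱 k (i0 x) := fun k x hx => by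
    have h := gradedPart_of_mem (𝒩 := 𝒱) ((LinearMap.ker d).subtype ∘ₗ i0) 0 hx
    rw [add_zero] at h
    exact h
  have hdi' : ∀ x, d (i x) = 0 := fun x => by
    suffices h : d ∘ₗ i = 0 from LinearMap.congr_fun h x
    refine linearMap_ext_graded (ℳ := degree 𝒱 d) fun k x hx => ?_
    rw [LinearMap.comp_apply, hi' hx, map_component hd, LinearMap.mem_ker.1 (i0 x).2, map_zero,
      LinearMap.zero_apply]
  have hπi : ∀ x, π (i x) = x := fun x => by
    suffices h : π ∘ₗ i = LinearMap.id from LinearMap.congr_fun h x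
    refine linearMap_ext_graded (ℳ := degree 𝒱 d) fun k x hx => ?_
    rw [LinearMap.comp_apply, LinearMap.id_apply]
    have h1 : π (i0 x) = x := by
      rw [hπker]; exact LinearMap.congr_fun hi0 x
    obtain ⟨z, hz, rfl⟩ := hx
    have h2 : ((i0 (mk d z) - z : LinearMap.ker d) : V) ∈ LinearMap.range d := by
      rw [← hmk, map_sub, ← hπker (i0 _), h1, sub_self]
    obtain ⟨w, hw⟩ := h2
    have h3 : (i0 (mk d z) : V) = z + d w := by rw [hw]; simp
    have hz' : (z : V) ∈ 𝒱 k := hz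
    have h4 : component 𝒱 k (d w) = d (component 𝒱 (k - 1) w) := by
      rw [map_component hd, sub_add_cancel]
    rw [hi' ⟨z, hz, rfl⟩, h3, map_add, GSym.component_of_mem hz', h4, map_add, hπd, hπker, add_zero]
  have hran : ∀ v, v - s (d v) - i (π v) ∈ LinearMap.range d := fun v => by
    have h := hmk (⟨v - s (d v), hdi v⟩ - ⟨i (π v), hdi' _⟩)
    refine h.1 ?_
    rw [map_sub, ← hπ, ← hπker, hπi, sub_self]
  have hπs : ∀ v, π (s (d v)) = 0 := fun v => by
    rw [hπ, hmk]
    change s (d v) - s (d (s (d v))) ∈ _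
    rw [hdsd, sub_self]
    exact Submodule.zero_mem _
  -- The factor `1 - s d - i π` takes values in the range of `d`, and `π s d = 0`; this gives the
  -- side condition `π h = 0`.
  refine ⟨⟨π, i, s ∘ₗ (LinearMap.id - s ∘ₗ d - i ∘ₗ π), ?_, hi, ?_, hπker, hπd, hdi', hπi, ?_, ?_⟩⟩
  · intro k v hv
    refine ⟨⟨v - s (d v), hdi v⟩, ?_, rfl⟩
    refine Submodule.sub_mem _ hv ?_
    have := hs (hd hv)
    rwa [add_neg_cancel_right] at this
  · intro k v hv
    refine hs (Submodule.sub_mem _ (Submodule.sub_mem _ hv ?_) (hi ?_))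
    · have := hs (hd hv)
      rwa [LinearMap.comp_apply, ← add_neg_cancel_right k 1]
    · refine ⟨⟨v - s (d v), hdi v⟩, ?_, rfl⟩
      refine Submodule.sub_mem _ hv ?_
      have := hs (hd hv)
      rwa [add_neg_cancel_right] at this
  · intro v
    obtain ⟨w, hw⟩ := hran v
    change π (s (v - s (d v) - i (π v))) = 0
    rw [← hw, hπs]
  · intro v
    obtain ⟨w, hw⟩ := hran v
    change d (s (v - s (d v) - i (π v))) + s (d v - s (d (d v)) - i (π (d v))) = _
    rw [← hw, hdsd, hw, hdd, hπd, map_zero, map_zero, sub_zero, sub_zero]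
    abel

end GCohomology

namespace GSym

/-! ### A Künneth theorem for symmetric powers. -/

section Kunneth

variable {K : Type u} [Field K] [CharZero K] {V : Type v} [AddCommGroup V] [Module K V]
variable {𝒱 : ℤ → Submodule K V} [DirectSum.Decomposition 𝒱]

theorem extend_extend_eq_zero {d : V →ₗ[K] V}
    (hd : ∀ ⦃i : ℤ⦄ ⦃v : V⦄, v ∈ 𝒱 i → d v ∈ 𝒱 (i + 1)) (hdd : ∀ v, d (d v) = 0) (x : GSym 𝒱) :
    extend 𝒱 d (extend 𝒱 d x) = 0 := by
  induction x using induction with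
  | one => rw [extend_one, map_zero]
  | add x y hx hy => rw [map_add, map_add, hx, hy, add_zero]
  | smul c x hx => rw [map_smul, map_smul, hx, smul_zero]
  | ι_mul i v hv x hx =>
    rw [extend_ι_mul hd hv, map_add, extend_ι_mul hd (hd hv), hdd, map_zero, zero_mul, map_smul,
      extend_ι_mul hd hv, hx, mul_zero, smul_zero, add_zero, zero_add, ← add_smul]
    rcases Int.even_or_odd i with h | h
    · simp [zpow_add₀, h.neg_one_zpow]
    · simp [zpow_add₀, h.neg_one_zpow]

variable {d : V →ₗ[K] V} [DirectSum.Decomposition (GCohomology.degree 𝒱 d)]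

/-- `N = D θ + θ D` is the derivation extending `1 - i π`, so it counts the factors in the
contractible complement of `H`, and `S(V)` is the sum of its eigenspaces for natural numbers. On the
sum `G` of those with positive eigenvalue, `N` is invertible in characteristic zero and commutes
with `D`, so cycles in `G` are boundaries. A cycle killed by `S(π)` lies in `G`, because `x - S(i π)
x` always does. -/
theorem mem_range_extend (c : GCohomology.Contraction 𝒱 d)
    (hd : ∀ ⦃i : ℤ⦄ ⦃v : V⦄, v ∈ 𝒱 i → d v ∈ 𝒱 (i + 1)) (hdd : ∀ v, d (d v) = 0) {z : GSym 𝒱}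
    (hz : extend 𝒱 d z = 0) (hπ : map 𝒱 (GCohomology.degree 𝒱 d) c.π c.π_mem z = 0) :
    ∃ y, extend 𝒱 d y = z := by
  set D := extend 𝒱 d with hD
  set θ := extend 𝒱 c.h with hθ
  have hDD : ∀ x, D (D x) = 0 := extend_extend_eq_zero hd hdd
  let N : Module.End K (GSym 𝒱) := D ∘ₗ θ + θ ∘ₗ D
  have hN : ∀ x, N x = D (θ x) + θ (D x) := fun x => rfl
  have hN1 : N 1 = 0 := by rw [hN, hD, hθ, extend_one, extend_one, map_zero, map_zero, add_zero]
  have hNι : ∀ ⦃k v⦄, v ∈ 𝒱 k → ∀ x, N (ι 𝒱 v * x) = ι 𝒱 (v - c.i (c.π v)) * x + ι 𝒱 v * N x := by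
    intro k v hv x
    rw [hN, hN, ← c.homotopy]
    have e1 := extend_ι_mul c.h_mem hv x
    have e2 := extend_ι_mul hd hv x
    have e3 := extend_ι_mul hd (c.h_mem hv) x
    have e4 := extend_ι_mul hd hv (θ x)
    have e5 := extend_ι_mul c.h_mem (hd hv) x
    have e6 := extend_ι_mul c.h_mem hv (D x)
    rw [← hD] at e2 e3 e4
    rw [← hθ] at e1 e5 e6
    rw [e1, e2, map_add, map_add, map_smul, map_smul, e3, e4, e5, e6]
    rcases Int.even_or_odd k with h | h
    · simp [zpow_add₀, h.neg_one_zpow, add_mul, mul_add]; abel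
    · simp [zpow_add₀, h.neg_one_zpow, add_mul, mul_add]; abel
  let E : ℕ → Submodule K (GSym 𝒱) := fun k => N.eigenspace (k : K)
  have hE : ∀ {k x}, x ∈ E k ↔ N x = (k : K) • x := Module.End.mem_eigenspace_iff
  let G : Submodule K (GSym 𝒱) := ⨆ k : ℕ, E (k + 1)
  have hmem : ∀ v, ∀ k, v ∈ 𝒱 k → c.i (c.π v) ∈ 𝒱 k := fun v k hv => c.i_mem (c.π_mem hv)
  have hu : ∀ v k, v ∈ 𝒱 k → ∀ j x, x ∈ E j → ι 𝒱 (c.i (c.π v)) * x ∈ E j := by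
    intro v k hv j x hx
    -- A factor in the image of `i` is annihilated by `1 - i π` and keeps the eigenvalue; a factor
    -- in the image of `1 - i π` raises it by one.
    rw [hE, hNι (hmem v k hv), c.π_i, sub_self, map_zero, zero_mul, zero_add, hE.1 hx,
      mul_smul_comm]
  have hw : ∀ v k, v ∈ 𝒱 k → ∀ j x, x ∈ E j → ι 𝒱 (v - c.i (c.π v)) * x ∈ E (j + 1) := by
    intro v k hv j x hx
    rw [hE, hNι (Submodule.sub_mem _ hv (hmem v k hv)), hE.1 hx]
    simp only [map_sub, c.π_i, sub_self, sub_zero, mul_smul_comm, map_zero]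
    push_cast
    rw [add_smul, one_smul, add_comm]
  have hsplit : ∀ v (x : GSym 𝒱), ι 𝒱 v * x = ι 𝒱 (c.i (c.π v)) * x + ι 𝒱 (v - c.i (c.π v)) * x := by
    intro v x
    rw [map_sub, sub_mul]; abel
  have htop : ∀ x, x ∈ ⨆ k, E k := by
    intro x
    induction x using induction with
    | one => exact Submodule.mem_iSup_of_mem 0 (hE.2 (by simp [hN1]))
    | add x y hx hy => exact Submodule.add_mem _ hx hy
    | smul c x hx => exact Submodule.smul_mem _ _ hx
    | ι_mul k v hv x hx =>
      induction hx using Submodule.iSup_induction' with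
      | mem j x hx =>
        rw [hsplit]
        exact Submodule.add_mem _ (Submodule.mem_iSup_of_mem j (hu v k hv j x hx))
          (Submodule.mem_iSup_of_mem (j + 1) (hw v k hv j x hx))
      | zero => simp
      | add x y _ _ hx hy => rw [mul_add]; exact Submodule.add_mem _ hx hy
  let ip : V →ₗ[K] V := c.i ∘ₗ c.π
  have hdiff : ∀ x, x - map 𝒱 𝒱 ip (fun _ _ h => c.i_mem (c.π_mem h)) x ∈ G := by
    intro x
    induction x using induction with
    | one => rw [map_one, sub_self]; exact Submodule.zero_mem _
    | add x y hx hy => rw [map_add, add_sub_add_comm]; exact Submodule.add_mem _ hx hy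
    | smul c x hx => rw [map_smul, ← smul_sub]; exact Submodule.smul_mem _ _ hx
    | ι_mul k v hv x hx =>
      rw [map_mul, map_ι, hsplit, add_sub_right_comm]
      change ι 𝒱 (c.i (c.π v)) * x - ι 𝒱 (c.i (c.π v)) * _ + _ ∈ G
      rw [← mul_sub]
      refine Submodule.add_mem _ ?_ ?_
      · generalize x - map 𝒱 𝒱 ip _ x = y at hx
        induction hx using Submodule.iSup_induction' with
        | mem j x hx => exact Submodule.mem_iSup_of_mem j (hu v k hv _ x hx)
        | zero => simp
        | add x y _ _ hx hy => rw [mul_add]; exact Submodule.add_mem _ hx hy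
      · have := htop x
        clear hx
        induction this using Submodule.iSup_induction' with
        | mem j x hx => exact Submodule.mem_iSup_of_mem j (hw v k hv _ x hx)
        | zero => simp
        | add x y _ _ hx hy => rw [mul_add]; exact Submodule.add_mem _ hx hy
  have hzG : z ∈ G := by
    have h := hdiff z
    have h2 := map_map (φ := c.π) (hφ := c.π_mem) (ψ := c.i) (hψ := c.i_mem) z
    rw [hπ, map_zero] at h2
    change z - map 𝒱 𝒱 (c.i ∘ₗ c.π) _ z ∈ G at h
    rwa [← h2, sub_zero] at h
  have hND : ∀ x, N (D x) = D (N x) := fun x => by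
    rw [hN, hN, hDD, map_zero, add_zero, map_add, hDD, zero_add]
  have hDG : ∀ x ∈ G, D x ∈ G := by
    intro x hx
    induction hx using Submodule.iSup_induction' with
    | mem j x hx =>
      exact Submodule.mem_iSup_of_mem j (hE.2 (by rw [hND, hE.1 hx, map_smul]))
    | zero => simp
    | add x y _ _ hx hy => rw [map_add]; exact Submodule.add_mem _ hx hy
  have hsurj : ∀ x ∈ G, ∃ y ∈ G, N y = x := by
    intro x hx
    induction hx using Submodule.iSup_induction' with
    | mem j x hx =>
      refine ⟨((j + 1 : ℕ) : K)⁻¹ • x, Submodule.smul_mem _ _ (Submodule.mem_iSup_of_mem j hx), ?_⟩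
      rw [map_smul, hE.1 hx, smul_smul, inv_mul_cancel₀ (Nat.cast_ne_zero.2 (Nat.succ_ne_zero j)),
        one_smul]
    | zero => exact ⟨0, Submodule.zero_mem _, map_zero _⟩
    | add x y _ _ hx hy =>
      obtain ⟨x', hx', rfl⟩ := hx
      obtain ⟨y', hy', rfl⟩ := hy
      exact ⟨x' + y', Submodule.add_mem _ hx' hy', map_add _ _ _⟩
  have hinj : ∀ x ∈ G, N x = 0 → x = 0 := by
    intro x hx hNx
    have hind := (Module.End.eigenspaces_iSupIndep N) 0
    refine (Submodule.disjoint_def.1 hind) x (Module.End.mem_eigenspace_iff.2 (by simpa using hNx)) ?_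
    refine (iSup_le fun j => ?_ : G ≤ _) hx
    exact le_iSup₂_of_le ((j + 1 : ℕ) : K) (Nat.cast_ne_zero.2 (Nat.succ_ne_zero j)) le_rfl
  obtain ⟨y, hy, hyz⟩ := hsurj z hzG
  -- `N (D y) = D z = 0` and `N` is injective on `G`, so `z = N y = D (θ y)`.
  have hDy : D y = 0 := hinj _ (hDG y hy) (by rw [hND, hyz, hz])
  refine ⟨θ y, ?_⟩
  rw [← hyz, hN, hDy, map_zero, add_zero]

end Kunneth

end GSym

theorem LinearMap.exists_comp_eq_on {K S T U V W : Type*} [Field K] [AddCommGroup S] [Module K S]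
    [AddCommGroup T] [Module K T] [AddCommGroup U] [Module K U] [AddCommGroup V] [Module K V]
    [AddCommGroup W] [Module K W] (P : Submodule K S) (N : Submodule K V) (Q : S →ₗ[K] T)
    (j : V →ₗ[K] T) (A : S →ₗ[K] U) (B : V →ₗ[K] W)
    (h : ∀ x ∈ P, ∀ v ∈ N, Q x = j v → A x = 0 → B v = 0) :
    ∃ C : U →ₗ[K] W, ∀ x ∈ P, ∀ v ∈ N, Q x = j v → C (A x) = B v := by
  let M : Submodule K (S × V) := P.prod N ⊓ LinearMap.eqLocus (Q ∘ₗ LinearMap.fst K S V)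
    (j ∘ₗ LinearMap.snd K S V)
  obtain ⟨C, hC⟩ := LinearMap.exists_comp_eq_of_ker_le_ker
    ((A ∘ₗ LinearMap.fst K S V).domRestrict M) ((B ∘ₗ LinearMap.snd K S V).domRestrict M)
    fun z hz => h z.1.1 z.2.1.1 z.1.2 z.2.1.2 z.2.2 hz
  exact ⟨C, fun x hx v hv hxv => LinearMap.congr_fun hC ⟨(x, v), ⟨hx, hv⟩, hxv⟩⟩

/-! ### Morphisms to targets in degrees 0 and 1. -/

namespace LInftyOne

open GSym

variable {K : Type u} [Field K] [CharZero K]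
variable {V : Type v} [AddCommGroup V] [Module K V] {𝒱 : ℤ → Submodule K V}
  [DirectSum.Decomposition 𝒱]
variable {W : Type w} [AddCommGroup W] [Module K W] {𝒲 : ℤ → Submodule K W}
  [DirectSum.Decomposition 𝒲]

/-- The corestriction is `g + g'` with `g` valued in `W⁰` and `g'` in `W¹`. Compatibility with the
structures reduces to `g ∘ Q = 0` and to `g' (Q x) = Y.q (cexp g x)` for `x` of degree 0. Since also
`g' = π` is wanted on `V¹`, the solution exists as soon as the two prescriptions agree where `Q x =
ι v`, which is the last hypothesis. -/
theorem exists_hom_of_zeroPart (X : LInftyOne 𝒱) (Y : LInftyOne 𝒲)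
    (h𝒲 : ∀ i : ℤ, i ≠ 0 → i ≠ 1 → 𝒲 i = ⊥) {π : V →ₗ[K] W}
    (hπ : ∀ ⦃k v⦄, v ∈ 𝒱 k → π v ∈ 𝒲 k) {g : GSym 𝒱 →ₗ[K] W} (hg1 : g 1 = 0)
    (hg : ∀ ⦃k x⦄, x ∈ degree 𝒱 k → g x ∈ 𝒲 k) (hg0 : ∀ x, g x ∈ 𝒲 0)
    (hgQ : ∀ x, g (X.Q x) = 0) (hgι : ∀ v ∈ 𝒱 0, g (ι 𝒱 v) = π v)
    (h : ∀ x ∈ degree 𝒱 0, ∀ v ∈ 𝒱 1, X.Q x = ι 𝒱 v → Y.q (cexp 𝒲 g hg1 x) = π v) :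
    ∃ F : Hom X Y, F.f₁ = π := by
  let A : (𝒱 1 × degree 𝒱 0) →ₗ[K] GSym 𝒱 :=
    (ι 𝒱 ∘ₗ (𝒱 1).subtype).coprod (X.Q ∘ₗ (degree 𝒱 0).subtype)
  let B : (𝒱 1 × degree 𝒱 0) →ₗ[K] W :=
    (π ∘ₗ (𝒱 1).subtype).coprod (Y.q ∘ₗ cexp 𝒲 g hg1 ∘ₗ (degree 𝒱 0).subtype)
  obtain ⟨C, hC⟩ := LinearMap.exists_comp_eq_of_ker_le_ker A B (by
    rintro ⟨v, x⟩ hvx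
    have h1 : ι 𝒱 v.1 + X.Q x.1 = 0 := hvx
    change π v.1 + Y.q (cexp 𝒲 g hg1 x.1) = 0
    have h2 := h (-x.1) (Submodule.neg_mem _ x.2) v.1 v.2
      (by rw [map_neg]; exact (eq_neg_of_add_eq_zero_left h1).symm)
    rw [← h2, map_neg, map_neg, neg_add_cancel])
  have hCι : ∀ v ∈ 𝒱 1, C (ι 𝒱 v) = π v := fun v hv => by
    have := LinearMap.congr_fun hC (⟨v, hv⟩, 0)
    simpa [A, B] using this
  have hCQ : ∀ x ∈ degree 𝒱 0, C (X.Q x) = Y.q (cexp 𝒲 g hg1 x) := fun x hx => by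
    have := LinearMap.congr_fun hC (0, ⟨x, hx⟩)
    simpa [A, B] using this
  let g' : GSym 𝒱 →ₗ[K] W :=
    GCohomology.component 𝒲 1 ∘ₗ C ∘ₗ GCohomology.component (degree 𝒱) 1
  have hg' : ∀ x ∈ degree 𝒱 1, g' x = GCohomology.component 𝒲 1 (C x) := fun x hx => by
    change GCohomology.component 𝒲 1 (C (GCohomology.component (degree 𝒱) 1 x)) = _
    rw [component_of_mem hx]
  have hg'' : ∀ k : ℤ, k ≠ 1 → ∀ x ∈ degree 𝒱 k, g' x = 0 := fun k hk x hx => by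
    change GCohomology.component 𝒲 1 (C (GCohomology.component (degree 𝒱) 1 x)) = _
    rw [component_of_mem_ne hk hx, map_zero, map_zero]
  have hgne : ∀ k : ℤ, k ≠ 0 → ∀ x ∈ degree 𝒱 k, g x = 0 := fun k hk x hx =>
    eq_of_mem_of_mem_ne hk (hg hx) (hg0 x)
  have hf1 : (g + g') 1 = 0 := by
    rw [LinearMap.add_apply, hg1, hg'' 0 (by norm_num) 1 one_mem_degree, add_zero]
  have hf : ∀ ⦃k x⦄, x ∈ degree 𝒱 k → (g + g') x ∈ 𝒲 k := fun k x hx => by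
    refine Submodule.add_mem _ (hg hx) ?_
    rcases eq_or_ne k 1 with rfl | hk
    · exact component_apply_mem _ _
    · rw [hg'' k hk x hx]; exact Submodule.zero_mem _
  have hF := cexp_isCoalgHom (𝒲 := 𝒲) hf1 hf
  have hG := cexp_isCoalgHom (𝒲 := 𝒲) hg1 hg
  set F := cexp 𝒲 (g + g') hf1 with hFdef
  have hpF : ∀ x, proj 𝒲 (F x) = g x + g' x := fun x => LinearMap.congr_fun (proj_cexp hf1) x
  -- In degree 0 the morphism depends on `g` alone, so the equation for `g'` is linear.
  have hzF : (zeroPart 𝒲).toLinearMap ∘ₗ F = cexp 𝒲 g hg1 := by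
    refine coalgHom_ext (zeroPart_isCoalgHom.comp hF) hG ?_
    rw [proj_cexp]
    refine LinearMap.ext fun x => ?_
    change proj 𝒲 (zeroPart 𝒲 (F x)) = g x
    have hg'1 : g' x ∈ 𝒲 1 := component_apply_mem _ _
    rw [zeroPart, proj_map, hpF, map_add, component_of_mem (hg0 x),
      component_of_mem_ne (i := 0) (by norm_num) hg'1, add_zero]
  have hneg : ∀ i < 0, 𝒲 i = ⊥ := fun i hi => h𝒲 i (by omega) (by omega)
  have hbot : ∀ k : ℤ, k ≠ 0 → k ≠ 1 → ∀ y ∈ 𝒲 k, y = 0 := fun k h0 h1 y hy => by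
    simpa [h𝒲 k h0 h1] using hy
  refine ⟨Hom.ofCoalgHom hF (comm_of_proj hF ?_), ?_⟩
  · refine linearMap_ext_degree fun k x hx => ?_
    change proj 𝒲 (F (X.Q x)) = Y.q (F x)
    have hQx := X.map_degree hx
    rw [hpF, hgQ, zero_add]
    rcases eq_or_ne k 0 with rfl | hk0
    · rw [zero_add] at hQx
      have h1 := Y.q_mem (hF.map_degree hx)
      have h2 : F x = cexp 𝒲 g hg1 x := by
        rw [← hzF]; exact (zeroPart_of_mem hneg le_rfl (hF.map_degree hx)).symm
      rw [zero_add, h2] at h1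
      rw [hg' _ hQx, hCQ x hx, component_of_mem h1, h2]
    · rcases eq_or_ne k (-1) with rfl | hk1
      · rw [hg'' _ (by norm_num) _ hQx, eq_zero_of_mem_degree_neg hneg (by norm_num) (hF.map_degree hx),
          map_zero]
      · rw [hg'' _ (by omega) _ hQx,
          hbot (k + 1) (by omega) (by omega) _ (Y.q_mem (hF.map_degree hx))]
  · refine linearMap_ext_graded (ℳ := 𝒱) fun k v hv => ?_
    change proj 𝒲 (F (ι 𝒱 v)) = π v
    have hv' := ι_mem_degree 𝒱 hv
    rw [hpF]
    rcases eq_or_ne k 0 with rfl | hk0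
    · rw [hg'' _ (by norm_num) _ hv', hgι v hv, add_zero]
    · rw [hgne _ hk0 _ hv', zero_add]
      rcases eq_or_ne k 1 with rfl | hk1
      · rw [hg' _ hv', hCι v hv, component_of_mem (hπ hv)]
      · rw [hg'' _ hk1 _ hv', hbot _ hk0 hk1 _ (hπ hv)]

/-- Here the brackets on `W` are found together with the morphism: `r` must send the part of `cexp g
x` of weight at least two to `π v` whenever `Q x = ι v`, and `hker` is what makes this well defined.
Discarding weights 0 and 1 makes the result minimal. -/
theorem exists_hom_ofZeroPart (X : LInftyOne 𝒱)
    (h𝒲 : ∀ i : ℤ, i ≠ 0 → i ≠ 1 → 𝒲 i = ⊥) {π : V →ₗ[K] W}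
    (hπ : ∀ ⦃k v⦄, v ∈ 𝒱 k → π v ∈ 𝒲 k) {g : GSym 𝒱 →ₗ[K] W} (hg1 : g 1 = 0)
    (hg : ∀ ⦃k x⦄, x ∈ degree 𝒱 k → g x ∈ 𝒲 k) (hg0 : ∀ x, g x ∈ 𝒲 0)
    (hgQ : ∀ x, g (X.Q x) = 0) (hgι : ∀ v ∈ 𝒱 0, g (ι 𝒱 v) = π v)
    (hker : ∀ x ∈ degree 𝒱 0, cexp 𝒲 g hg1 x ∈ fil 𝒲 1 → ∀ v ∈ 𝒱 1, X.Q x = ι 𝒱 v → π v = 0) :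
    ∃ (r : GSym 𝒲 →ₗ[K] W) (h0 : r ∘ₗ (zeroPart 𝒲).toLinearMap = r) (h1 : ∀ x, r x ∈ 𝒲 1)
      (hr1 : r 1 = 0), (∀ v, r (ι 𝒲 v) = 0) ∧
      ∃ G : Hom X (ofZeroPart r h0 h1 hr1), G.f₁ = π := by
  have hneg : ∀ i < 0, 𝒲 i = ⊥ := fun i hi => h𝒲 i (by omega) (by omega)
  have hG := cexp_isCoalgHom (𝒲 := 𝒲) hg1 hg
  obtain ⟨top, htop⟩ : ∃ top : GSym 𝒲 →ₗ[K] GSym 𝒲, ∀ y, top y = y - wcomp 𝒲 0 y - wcomp 𝒲 1 y :=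
    ⟨LinearMap.id - wcomp 𝒲 0 - wcomp 𝒲 1, fun _ => rfl⟩
  obtain ⟨C, hC⟩ : ∃ C : GSym 𝒲 →ₗ[K] W, ∀ x ∈ degree 𝒱 0, ∀ v ∈ 𝒱 1,
      X.Q x = ι 𝒱 v → C (top (cexp 𝒲 g hg1 x)) = π v := by
    refine LinearMap.exists_comp_eq_on (degree 𝒱 0) (𝒱 1) X.Q (ι 𝒱) (top ∘ₗ cexp 𝒲 g hg1) π
      fun x hx v hv hxv h => hker x hx ?_ v hv hxv
    rw [LinearMap.comp_apply, htop, sub_sub, sub_eq_zero] at h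
    rw [h]
    exact Submodule.add_mem _ (fil_mono (Nat.zero_le 1) (wcomp_mem_fil _)) (wcomp_mem_fil _)
  have htop1 : top 1 = 0 := by simp [htop, wcomp_one]
  have htopι : ∀ v, top (ι 𝒲 v) = 0 := fun v => by simp [htop, wcomp_ι]
  obtain ⟨r, hr⟩ : ∃ r : GSym 𝒲 →ₗ[K] W,
      ∀ x, r x = GCohomology.component 𝒲 1 (C (top (zeroPart 𝒲 x))) :=
    ⟨GCohomology.component 𝒲 1 ∘ₗ C ∘ₗ top ∘ₗ (zeroPart 𝒲).toLinearMap, fun _ => rfl⟩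
  have h0 : r ∘ₗ (zeroPart 𝒲).toLinearMap = r := LinearMap.ext fun x => by
    rw [LinearMap.comp_apply, AlgHom.toLinearMap_apply, hr, hr,
      zeroPart_of_mem hneg le_rfl (zeroPart_mem x)]
  have h1 : ∀ x, r x ∈ 𝒲 1 := fun x => by rw [hr]; exact component_apply_mem _ _
  have hr1 : r 1 = 0 := by rw [hr, _root_.map_one, htop1, map_zero, map_zero]
  refine ⟨r, h0, h1, hr1, fun v => ?_, ?_⟩
  · rw [hr, zeroPart_ι, htopι, map_zero, map_zero]
  · refine exists_hom_of_zeroPart X _ h𝒲 hπ hg1 hg hg0 hgQ hgι fun x hx v hv h => ?_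
    rw [q_ofZeroPart, hr, zeroPart_of_mem hneg le_rfl (hG.map_degree hx), hC x hx v hv h,
      component_of_mem (hπ hv)]

/-- Transport of an `L∞[1]` structure along a coalgebra automorphism. -/
def conj (X : LInftyOne 𝒱) {E : GSym 𝒱 ≃ₗ[K] GSym 𝒱} (hE : IsCoalgHom E.toLinearMap) :
    LInftyOne 𝒱 where
  Q := E.toLinearMap ∘ₗ X.Q ∘ₗ E.symm.toLinearMap
  map_degree _ _ hx := hE.map_degree (X.map_degree (hE.symm.map_degree hx))
  comul_comp := by
    have hs := hE.symm
    have h1 : E.toLinearMap ∘ₗ E.symm.toLinearMap = LinearMap.id := by ext x; simp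
    rw [← LinearMap.comp_assoc, hE.comul_comp, LinearMap.comp_assoc,
      ← LinearMap.comp_assoc E.symm.toLinearMap X.Q, X.comul_comp, LinearMap.comp_assoc,
      hs.comul_comp, ← LinearMap.comp_assoc, ← LinearMap.comp_assoc, LinearMap.comp_add,
      LinearMap.add_comp]
    simp only [← TensorProduct.map_comp, LinearMap.comp_id, LinearMap.id_comp, LinearMap.comp_assoc]
    rw [h1, hs.sign_comp, ← LinearMap.comp_assoc (sign 𝒱), h1, LinearMap.id_comp]
  map_one := by
    have h := hE.symm.map_one
    rw [LinearMap.comp_apply, LinearMap.comp_apply, h, X.Q_one, map_zero, map_zero]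
  comp_self := by
    refine LinearMap.ext fun x => ?_
    simp [X.Q_Q]

/-! ### The minimal model on the cohomology. -/

section Transfer

variable (X : LInftyOne 𝒱) (c : GCohomology.Contraction 𝒱 X.q₁)

/-- The top-weight term of `x` is a cycle for the derivation induced by `q₁`, with zero class in
`S(H)`; a primitive `y` exists by Künneth and may be taken of pure degree and weight. As `Q` equals
that derivation in top weight, `x - Q y` has lower weight. -/
theorem exists_sub_Q_mem_fil {n : ℕ} {k : ℤ} {x : GSym 𝒱} (hx : x ∈ degree 𝒱 k)
    (hxn : x ∈ fil 𝒱 (n + 1)) (hQ : wcomp 𝒱 (n + 1) (X.Q x) = 0)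
    (hπ : map 𝒱 X.cohomologyDegree c.π c.π_mem (wcomp 𝒱 (n + 1) x) = 0) :
    ∃ y ∈ degree 𝒱 (k - 1), x - X.Q y ∈ fil 𝒱 n := by
  have hD : extend 𝒱 X.q₁ (wcomp 𝒱 (n + 1) x) = 0 := by rw [← X.wcomp_Q le_rfl hxn, hQ]
  obtain ⟨y, hy⟩ := mem_range_extend c X.q₁_mem X.q₁_q₁ hD hπ
  have hy' : extend 𝒱 X.q₁ (GCohomology.component (degree 𝒱) (k - 1) y) = wcomp 𝒱 (n + 1) x := by
    rw [GCohomology.map_component (d := extend 𝒱 X.q₁) (extend_mem_degree X.q₁_mem), hy,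
      sub_add_cancel, component_of_mem (wcomp_mem_degree _ hx)]
  refine ⟨wcomp 𝒱 (n + 1) (GCohomology.component (degree 𝒱) (k - 1) y),
    wcomp_mem_degree _ (component_apply_mem _ _), ?_⟩
  refine mem_fil_of_wcomp_eq_zero
    (Submodule.sub_mem _ hxn (X.Q_mem_fil (wcomp_mem_fil _))) ?_
  rw [map_sub, X.wcomp_Q le_rfl (wcomp_mem_fil _), wcomp_wcomp_self, ← wcomp_extend X.q₁_mem, hy',
    wcomp_wcomp_self, sub_self]

theorem π_eq_zero_of_mem_fil_one {x : GSym 𝒱} (hx : x ∈ fil 𝒱 1) {v : V} (h : X.Q x = ι 𝒱 v) :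
    c.π v = 0 := by
  rw [map_linear_of_mem_fil_one (f := X.Q) X.Q_one hx, Q_ι] at h
  have h' := congrArg (proj 𝒱) h
  rw [proj_ι, proj_ι] at h'
  rw [← h', c.π_d]

/-- The values on `V⁰`, on `1` and on the image of `Q` are compatible: if `Q y = ι v` with `y` of
degree `-1`, the classes met in lowering the weight of `y` lie in the degree `-1` part of `S(H)`,
which is zero. In weight at most one, `v` is a `q₁`-boundary. -/
theorem exists_zero_corestriction (hdeg : ∀ i : ℤ, i ≠ 0 → i ≠ 1 → X.cohomologyDegree i = ⊥) :
    ∃ g : GSym 𝒱 →ₗ[K] X.TangentCohomology, g 1 = 0 ∧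
      (∀ ⦃k x⦄, x ∈ degree 𝒱 k → g x ∈ X.cohomologyDegree k) ∧ (∀ x, g x ∈ X.cohomologyDegree 0) ∧ (∀ x, g (X.Q x) = 0) ∧
      ∀ v ∈ 𝒱 0, g (ι 𝒱 v) = c.π v := by
  set ℋ := X.cohomologyDegree with hℋ
  have hneg : ∀ i < 0, ℋ i = ⊥ := fun i hi => hdeg i (by omega) (by omega)
  have π_eq_zero : ∀ n, ∀ y ∈ degree 𝒱 (-1), y ∈ fil 𝒱 n → ∀ v, X.Q y = ι 𝒱 v → c.π v = 0 := by
    intro n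
    induction n with
    | zero => intro y _ hyn v h; exact X.π_eq_zero_of_mem_fil_one c (fil_mono (Nat.zero_le 1) hyn) h
    | succ n ih =>
      intro y hy hyn v h
      rcases Nat.eq_zero_or_pos n with rfl | hn
      · exact X.π_eq_zero_of_mem_fil_one c hyn h
      obtain ⟨z, hz, hz'⟩ := X.exists_sub_Q_mem_fil c hy hyn
        (by rw [h, wcomp_ι, if_neg (by omega)])
        (eq_zero_of_mem_degree_neg hneg (by norm_num) (map_mem_degree (wcomp_mem_degree _ hy)))
      refine ih _ (Submodule.sub_mem _ hy ?_) hz' v ?_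
      · simpa using X.map_degree hz
      · rw [map_sub, X.Q_Q, sub_zero, h]
  let A : (𝒱 0 × degree 𝒱 (-1)) × K →ₗ[K] GSym 𝒱 :=
    ((ι 𝒱 ∘ₗ (𝒱 0).subtype).coprod (X.Q ∘ₗ (degree 𝒱 (-1)).subtype)).coprod
      (Algebra.linearMap K (GSym 𝒱))
  let B : (𝒱 0 × degree 𝒱 (-1)) × K →ₗ[K] X.TangentCohomology :=
    ((c.π ∘ₗ (𝒱 0).subtype).coprod 0).coprod 0
  obtain ⟨C, hC⟩ := LinearMap.exists_comp_eq_of_ker_le_ker A B (by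
    rintro ⟨⟨v, x⟩, a⟩ h
    have h1 : ι 𝒱 v.1 + X.Q x.1 + algebraMap K _ a = 0 := h
    change c.π v.1 + 0 + 0 = 0
    rw [add_zero, add_zero]
    have h2 : a = 0 := by
      have := congrArg (counit 𝒱) h1
      simpa [counit_ι, counit_Q] using this
    rw [h2, map_zero, add_zero] at h1
    obtain ⟨n, hn⟩ := exists_mem_fil (-x.1)
    exact π_eq_zero n _ (Submodule.neg_mem _ x.2) hn _
      (by rw [map_neg]; exact (eq_neg_of_add_eq_zero_left h1).symm))
  have hC1 : C 1 = 0 := by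
    have := LinearMap.congr_fun hC (0, 1)
    simpa [A, B] using this
  have hCι : ∀ v ∈ 𝒱 0, C (ι 𝒱 v) = c.π v := fun v hv => by
    have := LinearMap.congr_fun hC ((⟨v, hv⟩, 0), 0)
    simpa [A, B] using this
  have hCQ : ∀ x ∈ degree 𝒱 (-1), C (X.Q x) = 0 := fun x hx => by
    have := LinearMap.congr_fun hC ((0, ⟨x, hx⟩), 0)
    simpa [A, B] using this
  refine ⟨GCohomology.component ℋ 0 ∘ₗ C ∘ₗ GCohomology.component (degree 𝒱) 0, ?_, ?_,
    fun x => component_apply_mem _ _, ?_, ?_⟩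
  · simp only [LinearMap.comp_apply]
    rw [component_of_mem (one_mem_degree (𝒱 := 𝒱)), hC1, map_zero]
  · intro k x hx
    rcases eq_or_ne k 0 with rfl | hk
    · exact component_apply_mem _ _
    · simp only [LinearMap.comp_apply]
      rw [component_of_mem_ne hk hx, map_zero, map_zero]
      exact Submodule.zero_mem _
  · intro x
    simp only [LinearMap.comp_apply]
    have := GCohomology.map_component X.map_degree (-1) x
    rw [neg_add_cancel] at this
    rw [← this, hCQ _ (component_apply_mem _ _), map_zero]
  · intro v hv
    simp only [LinearMap.comp_apply]
    rw [component_of_mem (ι_mem_degree 𝒱 hv), hCι v hv, component_of_mem (c.π_mem hv)]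

/-- The same descent in degree 0, where `S(H)` no longer vanishes. The class of the top term of `x`
is now the top term of `G x`, which is zero above weight one by hypothesis. -/
theorem π_eq_zero_of_cexp_mem_fil_one
    (hdeg : ∀ i : ℤ, i ≠ 0 → i ≠ 1 → X.cohomologyDegree i = ⊥)
    {g : GSym 𝒱 →ₗ[K] X.TangentCohomology} (hg1 : g 1 = 0)
    (hg : ∀ ⦃k x⦄, x ∈ degree 𝒱 k → g x ∈ X.cohomologyDegree k)
    (hg0 : ∀ x, g x ∈ X.cohomologyDegree 0)
    (hgQ : ∀ x, g (X.Q x) = 0) (hgι : ∀ v ∈ 𝒱 0, g (ι 𝒱 v) = c.π v) {x : GSym 𝒱} (hx : x ∈ degree 𝒱 0)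
    (hGx : cexp X.cohomologyDegree g hg1 x ∈ fil X.cohomologyDegree 1) {v : V}
    (hv : X.Q x = ι 𝒱 v) : c.π v = 0 := by
  set ℋ := X.cohomologyDegree with hℋ
  have hneg : ∀ i < 0, ℋ i = ⊥ := fun i hi => hdeg i (by omega) (by omega)
  have hG := cexp_isCoalgHom (𝒲 := ℋ) hg1 hg
  set G := cexp ℋ g hg1 with hGdef
  -- `G` is a morphism to the zero structure on `H`, so corrections by `Q z` leave `G x` unchanged.
  have hGQ : ∀ x, G (X.Q x) = 0 := fun x => by
    have hq0 : (ofZeroPart (𝒱 := ℋ) (0 : GSym ℋ →ₗ[K] X.TangentCohomology) (LinearMap.zero_comp _)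
        (fun x => Submodule.zero_mem _) rfl).Q = 0 := by
      change conv (ι ℋ ∘ₗ 0) LinearMap.id = 0
      rw [LinearMap.comp_zero, zero_conv]
    have := comm_of_proj (X := X) (Y := ofZeroPart (𝒱 := ℋ) 0 (LinearMap.zero_comp _)
      (fun x => Submodule.zero_mem _) rfl) hG (by
        rw [q_ofZeroPart, LinearMap.zero_comp, ← LinearMap.comp_assoc, proj_cexp]
        exact LinearMap.ext hgQ)
    rw [hq0, LinearMap.zero_comp] at this
    exact LinearMap.congr_fun this x
  have hGlin : linPart G = GCohomology.component ℋ 0 ∘ₗ c.π := by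
    refine linearMap_ext_graded (ℳ := 𝒱) fun k v hv => ?_
    have h1 : linPart G v = g (ι 𝒱 v) := LinearMap.congr_fun (proj_cexp hg1) _
    rw [h1, LinearMap.comp_apply]
    rcases eq_or_ne k 0 with rfl | hk
    · rw [hgι v hv, component_of_mem (c.π_mem hv)]
    · rw [eq_of_mem_of_mem_ne hk (hg (ι_mem_degree 𝒱 hv)) (hg0 _),
        component_of_mem_ne hk (c.π_mem hv)]
  have π_eq_zero : ∀ n, ∀ x ∈ degree 𝒱 0, x ∈ fil 𝒱 n → G x ∈ fil ℋ 1 → ∀ v, X.Q x = ι 𝒱 v →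
      c.π v = 0 := by
    intro n
    induction n with
    | zero => intro y _ hyn _ v h; exact X.π_eq_zero_of_mem_fil_one c (fil_mono (Nat.zero_le 1) hyn) h
    | succ n ih =>
      intro y hy hyn hGy v h
      rcases Nat.eq_zero_or_pos n with rfl | hn
      · exact X.π_eq_zero_of_mem_fil_one c hyn h
      have h1 := hG.wcomp_apply hyn
      rw [mem_fil.1 hGy _ (by omega), GSym.map_congr (𝒲 := ℋ) (ψ := GCohomology.component ℋ 0 ∘ₗ c.π)
        (hψ := fun _ _ h => component_mem (c.π_mem h)) hGlin,
        ← GSym.map_map (𝒲 := ℋ) (hφ := c.π_mem) (hψ := fun _ _ h => component_mem h)] at h1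
      have h2 := zeroPart_of_mem hneg le_rfl
        (map_mem_degree (φ := c.π) (hφ := c.π_mem) (wcomp_mem_degree (n + 1) hy))
      obtain ⟨z, hz, hz'⟩ := X.exists_sub_Q_mem_fil c hy hyn
        (by rw [h, wcomp_ι, if_neg (by omega)]) (h2.symm.trans h1.symm)
      refine ih _ (Submodule.sub_mem _ hy ?_) hz' ?_ v ?_
      · simpa using X.map_degree hz
      · rwa [map_sub, hGQ, sub_zero]
      · rw [map_sub, X.Q_Q, sub_zero, h]
  obtain ⟨n, hn⟩ := exists_mem_fil x
  exact π_eq_zero n x hx hn hGx v hv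

theorem exists_hom_cohomology (hdeg : ∀ i : ℤ, i ≠ 0 → i ≠ 1 → X.cohomologyDegree i = ⊥) :
    ∃ (r : GSym X.cohomologyDegree →ₗ[K] X.TangentCohomology)
      (h0 : r ∘ₗ (zeroPart X.cohomologyDegree).toLinearMap = r)
      (h1 : ∀ x, r x ∈ X.cohomologyDegree 1) (hr1 : r 1 = 0),
      (∀ v, r (ι X.cohomologyDegree v) = 0) ∧
      ∃ G : Hom X (ofZeroPart r h0 h1 hr1), G.f₁ = c.π := by
  obtain ⟨g, hg1, hg, hg0, hgQ, hgι⟩ := X.exists_zero_corestriction c hdeg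
  exact exists_hom_ofZeroPart X hdeg c.π_mem hg1 hg hg0 hgQ hgι fun x hx hGx v _ hxv =>
    X.π_eq_zero_of_cexp_mem_fil_one c hdeg hg1 hg hg0 hgQ hgι hx hGx hxv

/-- The coalgebra map with corestriction `f` has linear part `i π + d h + h d = 1`, so it is an
automorphism. Transporting the structure of `V` along it gives `i r S(π) + q₁`, the sum of the
structure on `H` and a linear one, for which `S(i)` is visibly a morphism. -/
theorem exists_hom_of_cohomology {R : LInftyOne X.cohomologyDegree} (G : Hom X R)
    (hG : G.f₁ = c.π) : ∃ F : Hom R X, F.f₁ = c.i := by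
  set ℋ := X.cohomologyDegree with hℋ
  have hg1 : proj ℋ (G.F 1) = 0 := by rw [G.map_one, proj_one]
  let f : GSym 𝒱 →ₗ[K] V :=
    c.i ∘ₗ proj ℋ ∘ₗ G.F + X.q₁ ∘ₗ c.h ∘ₗ proj 𝒱 + c.h ∘ₗ X.q
  have hf : ∀ x, f x = c.i (proj ℋ (G.F x)) + X.q₁ (c.h (proj 𝒱 x)) + c.h (X.q x) := fun x => rfl
  have hf1 : f 1 = 0 := by
    rw [hf, hg1, proj_one, q_one]; simp
  have hfdeg : ∀ ⦃k x⦄, x ∈ degree 𝒱 k → f x ∈ 𝒱 k := fun k x hx => by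
    rw [hf]
    refine Submodule.add_mem _ (Submodule.add_mem _ (c.i_mem (proj_mem ℋ (G.map_degree hx))) ?_) ?_
    · have := X.q₁_mem (c.h_mem (proj_mem 𝒱 hx))
      rwa [neg_add_cancel_right] at this
    · have := c.h_mem (X.q_mem hx)
      rwa [add_neg_cancel_right] at this
  have hΦ := cexp_isCoalgHom (𝒲 := 𝒱) hf1 hfdeg
  have hpΦ : ∀ x, proj 𝒱 (cexp 𝒱 f hf1 x) = f x := fun x => LinearMap.congr_fun (proj_cexp hf1) x
  have hlin : linPart (cexp 𝒱 f hf1) = LinearMap.id := by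
    refine LinearMap.ext fun v => ?_
    change proj 𝒱 (cexp 𝒱 f hf1 (ι 𝒱 v)) = v
    have h1 : proj ℋ (G.F (ι 𝒱 v)) = c.π v := by rw [← hG]; rfl
    rw [hpΦ, hf, h1, proj_ι, q_ι, add_assoc, c.homotopy]
    abel
  let E := LinearEquiv.ofBijective (cexp 𝒱 f hf1)
    (hΦ.bijective (by rw [hlin]; exact Function.bijective_id))
  have hE : IsCoalgHom E.toLinearMap := hΦ
  have hE' : ∀ x, E x = cexp 𝒱 f hf1 x := fun x => rfl
  have hπE : ∀ x, map 𝒱 ℋ c.π c.π_mem (E x) = G.F x := by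
    suffices h : (map 𝒱 ℋ c.π c.π_mem).toLinearMap ∘ₗ E.toLinearMap = G.F from
      fun x => LinearMap.congr_fun h x
    refine coalgHom_ext (map_isCoalgHom.comp hE) G.isCoalgHom (LinearMap.ext fun x => ?_)
    change proj ℋ (map 𝒱 ℋ c.π c.π_mem (E x)) = proj ℋ (G.F x)
    rw [proj_map, hE', hpΦ, hf, map_add, map_add, c.π_i, c.π_d, c.π_h, add_zero, add_zero]
  -- Both `f (Q x)`, apart from its term in the image of `i`, and `q₁ (f x)` reduce to `q₁ (h (q
  -- x))`.
  have hq : ∀ y, (X.conj hE).q y = c.i (R.q (map 𝒱 ℋ c.π c.π_mem y)) + X.q₁ (proj 𝒱 y) := by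
    intro y
    obtain ⟨x, rfl⟩ := E.surjective y
    change proj 𝒱 (E (X.Q (E.symm (E x)))) = _
    rw [E.symm_apply_apply, hπE, hE', hE', hpΦ, hpΦ, hf, hf, G.comm_apply, map_add, map_add, c.d_i,
      X.q₁_q₁, zero_add, zero_add]
    change c.i (R.q (G.F x)) + X.q₁ (c.h (X.q x)) + c.h (proj 𝒱 (X.Q (X.Q x))) = _
    rw [X.Q_Q, map_zero, map_zero, add_zero]
  have hι : IsCoalgHom (map ℋ 𝒱 c.i c.i_mem).toLinearMap := map_isCoalgHom
  let F1 : Hom R (X.conj hE) := Hom.ofCoalgHom hι (comm_of_proj hι (by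
    refine LinearMap.ext fun x => ?_
    change proj 𝒱 (map ℋ 𝒱 c.i c.i_mem (R.Q x)) = (X.conj hE).q (map ℋ 𝒱 c.i c.i_mem x)
    rw [hq, proj_map, proj_map, c.d_i, add_zero, GSym.map_map, GSym.map_congr (ψ := LinearMap.id)
      (hψ := fun _ _ h => h) (LinearMap.ext c.π_i), map_id]
    rfl))
  let F2 : Hom (X.conj hE) X := Hom.ofCoalgHom hE.symm (by
    refine LinearMap.ext fun x => ?_
    change E.symm (E (X.Q (E.symm x))) = X.Q (E.symm x)
    rw [E.symm_apply_apply])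
  refine ⟨F2.comp F1, ?_⟩
  have h1 : F1.f₁ = c.i := LinearMap.ext fun v => by
    change proj 𝒱 (map ℋ 𝒱 c.i c.i_mem (ι ℋ v)) = c.i v
    rw [map_ι, proj_ι]
  have h2 : F2.f₁ = LinearMap.id := LinearMap.ext fun v => by
    change proj 𝒱 (E.symm (ι 𝒱 v)) = v
    have : E (ι 𝒱 v) = ι 𝒱 v := by
      have := hE.apply_ι v
      change E (ι 𝒱 v) = ι 𝒱 (linPart (cexp 𝒱 f hf1) v) at this
      rwa [hlin] at this
    rw [← this, E.symm_apply_apply, proj_ι]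
  rw [Hom.comp_f₁, h1, h2, LinearMap.id_comp]

theorem isWeakEquivalence_of_f₁_eq_i {R : LInftyOne X.cohomologyDegree} (hR : R.IsMinimal)
    {F : Hom R X} (hF : F.f₁ = c.i) : F.IsWeakEquivalence := by
  rw [IsMinimal] at hR
  constructor
  · rintro v - ⟨w, hw⟩
    rw [hF] at hw
    rw [← c.π_i v, ← hw, c.π_d]
    exact Submodule.zero_mem _
  · intro w hw
    refine ⟨c.π w, by simp [hR], c.h w, ?_⟩
    have := c.homotopy w
    rw [hw, map_zero, add_zero] at this
    rw [hF, this]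

theorem isWeakEquivalence_of_f₁_eq_π {R : LInftyOne X.cohomologyDegree} (hR : R.IsMinimal)
    {F : Hom X R} (hF : F.f₁ = c.π) : F.IsWeakEquivalence := by
  rw [IsMinimal] at hR
  constructor
  · rintro v hv ⟨w, hw⟩
    rw [hF, hR] at hw
    have := c.homotopy v
    rw [← hw, hv] at this
    exact ⟨c.h v, by simpa using this⟩
  · intro w _
    exact ⟨c.i w, c.d_i w, by rw [hF, c.π_i, sub_self]; exact Submodule.zero_mem _⟩

end Transfer

end LInftyOne

/-! ### Power series as functionals on `S(V⁰)`. -/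

namespace GSym

variable {K : Type u} [Field K]
variable {V : Type v} [AddCommGroup V] [Module K V] {𝒱 : ℤ → Submodule K V}
  [DirectSum.Decomposition 𝒱]
variable {n : ℕ} (e : Module.Basis (Fin n) K (𝒱 0))

/-- The monomial `e₁^{⊙ i₁} ⊙ ⋯ ⊙ eₙ^{⊙ iₙ}`. -/
def mono (I : Fin n →₀ ℕ) : GSym 𝒱 := (List.ofFn fun i => ι 𝒱 (e i : V) ^ I i).prod

theorem ι_mem_center {v : V} (hv : v ∈ 𝒱 0) : ι 𝒱 v ∈ Subalgebra.center K (GSym 𝒱) := by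
  rw [Subalgebra.mem_center_iff]
  intro x
  induction x using induction with
  | one => rw [one_mul, mul_one]
  | add x y hx hy => rw [add_mul, mul_add, hx, hy]
  | smul c x hx => rw [smul_mul_assoc, mul_smul_comm, hx]
  | ι_mul i w hw x hx =>
    have h := ι_mul_ι 𝒱 hw hv
    rw [mul_zero, zpow_zero, one_smul] at h
    rw [mul_assoc, hx, ← mul_assoc, h, mul_assoc]

/-- The algebra map `K[x₁, …, xₙ] → S(V)`, `xᵢ ↦ eᵢ`. -/
def ofPoly : MvPolynomial (Fin n) K →ₐ[K] GSym 𝒱 :=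
  (Subalgebra.center K (GSym 𝒱)).val.comp
    (MvPolynomial.aeval fun i => ⟨ι 𝒱 (e i : V), ι_mem_center (e i).2⟩)

theorem ofPoly_X (i : Fin n) : ofPoly e (MvPolynomial.X i) = ι 𝒱 (e i : V) := by
  simp [ofPoly]

theorem ofPoly_monomial (I : Fin n →₀ ℕ) : ofPoly e (MvPolynomial.monomial I 1) = mono e I := by
  rw [ofPoly, AlgHom.comp_apply, MvPolynomial.aeval_monomial, map_one, one_mul,
    Finsupp.prod_fintype _ _ (by simp), ← List.prod_ofFn, mono, map_list_prod, List.map_ofFn]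
  rfl

/-- The algebra map `S(V) → K[x₁, …, xₙ]` which is `V → V⁰` in coordinates on `V`. -/
def toPoly : GSym 𝒱 →ₐ[K] MvPolynomial (Fin n) K :=
  lift 𝒱 (e.constr K (fun i => (MvPolynomial.X i : MvPolynomial (Fin n) K)) ∘ₗ
    DirectSum.component K ℤ (fun k => 𝒱 k) 0 ∘ₗ
      (DirectSum.decomposeLinearEquiv 𝒱).toLinearMap) (by
    have h0 : ∀ {i : ℤ} {v : V}, i ≠ 0 → v ∈ 𝒱 i →
        DirectSum.component K ℤ (fun k => 𝒱 k) 0 (DirectSum.decompose 𝒱 v) = 0 := fun hi hv =>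
      Subtype.ext (component_of_mem_ne hi hv)
    intro i j v w hv hw
    simp only [LinearMap.comp_apply, LinearEquiv.coe_coe, DirectSum.decomposeLinearEquiv_apply]
    rcases eq_or_ne i 0 with rfl | hi
    · rw [zero_mul, zpow_zero, one_smul, mul_comm]
    · rw [h0 hi hv, map_zero, zero_mul, mul_zero, smul_zero])

theorem toPoly_ι_of_mem {v : V} (hv : v ∈ 𝒱 0) :
    toPoly e (ι 𝒱 v) = e.constr K (fun i => (MvPolynomial.X i : MvPolynomial (Fin n) K)) ⟨v, hv⟩ := by
  rw [toPoly, lift_ι]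
  simp only [LinearMap.comp_apply, LinearEquiv.coe_coe, DirectSum.decomposeLinearEquiv_apply]
  congr 1
  exact Subtype.ext (component_of_mem hv)

theorem toPoly_ι_of_mem_ne {i : ℤ} (hi : i ≠ 0) {v : V} (hv : v ∈ 𝒱 i) : toPoly e (ι 𝒱 v) = 0 := by
  rw [toPoly, lift_ι]
  simp only [LinearMap.comp_apply, LinearEquiv.coe_coe, DirectSum.decomposeLinearEquiv_apply]
  rw [show DirectSum.component K ℤ (fun k => 𝒱 k) 0 (DirectSum.decompose 𝒱 v) = 0 from
    Subtype.ext (component_of_mem_ne hi hv), map_zero]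

theorem toPoly_ofPoly (p : MvPolynomial (Fin n) K) : toPoly e (ofPoly e p) = p := by
  suffices h : (toPoly e).comp (ofPoly e) = AlgHom.id K _ from DFunLike.congr_fun h p
  refine MvPolynomial.algHom_ext fun i => ?_
  rw [AlgHom.comp_apply, ofPoly_X, toPoly_ι_of_mem e (e i).2, AlgHom.id_apply]
  exact e.constr_basis K _ i

theorem ofPoly_toPoly (x : GSym 𝒱) : ofPoly e (toPoly e x) = zeroPart 𝒱 x := by
  suffices h : (ofPoly e).comp (toPoly e) = zeroPart 𝒱 from DFunLike.congr_fun h x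
  refine algHom_ext fun v => ?_
  induction v using DirectSum.Decomposition.inductionOn 𝒱 with
  | zero => simp
  | add v w hv hw => simp only [map_add, hv, hw]
  | @homogeneous i v =>
    rw [AlgHom.comp_apply, zeroPart_ι]
    rcases eq_or_ne i 0 with rfl | hi
    · rw [toPoly_ι_of_mem e v.2, component_of_mem v.2]
      have : (ofPoly e).toLinearMap ∘ₗ
          e.constr K (fun i => (MvPolynomial.X i : MvPolynomial (Fin n) K)) =
          ι 𝒱 ∘ₗ (𝒱 0).subtype := e.ext fun i => by
        rw [LinearMap.comp_apply, e.constr_basis, AlgHom.toLinearMap_apply, ofPoly_X]; rfl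
      exact LinearMap.congr_fun this v
    · rw [toPoly_ι_of_mem_ne e hi v.2, component_of_mem_ne hi v.2, map_zero, map_zero]

theorem toPoly_mono (I : Fin n →₀ ℕ) : toPoly e (mono e I) = MvPolynomial.monomial I 1 := by
  rw [← ofPoly_monomial, toPoly_ofPoly]

theorem zeroPart_mono (I : Fin n →₀ ℕ) : zeroPart 𝒱 (mono e I) = mono e I := by
  rw [← ofPoly_toPoly e, toPoly_mono, ofPoly_monomial]

theorem mono_mem_degree (I : Fin n →₀ ℕ) : mono e I ∈ degree 𝒱 0 := by
  rw [← zeroPart_mono]; exact zeroPart_mem _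

theorem mono_zero : mono e 0 = 1 := by
  rw [← ofPoly_monomial, MvPolynomial.monomial_zero', map_one, map_one]

theorem mono_add_single (I : Fin n →₀ ℕ) (i : Fin n) :
    mono e (I + Finsupp.single i 1) = ι 𝒱 (e i : V) * mono e I := by
  rw [← ofPoly_monomial, ← ofPoly_monomial, ← ofPoly_X, ← map_mul, add_comm,
    MvPolynomial.monomial_single_add, pow_one]

theorem mono_single (i : Fin n) : mono e (Finsupp.single i 1) = ι 𝒱 (e i : V) := by
  have := mono_add_single e 0 i
  rwa [zero_add, mono_zero, mul_one] at this

theorem exists_eq_add_single {I : Fin n →₀ ℕ} (h : I ≠ 0) :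
    ∃ (i : Fin n) (J : Fin n →₀ ℕ), I = J + Finsupp.single i 1 := by
  obtain ⟨i, hi⟩ := Finsupp.ne_iff.1 h
  refine ⟨i, I - Finsupp.single i 1, (tsub_add_cancel_of_le ?_).symm⟩
  rw [Finsupp.single_le_iff]
  exact Nat.one_le_iff_ne_zero.2 hi

theorem wcomp_mono (k : ℕ) (I : Fin n →₀ ℕ) :
    wcomp 𝒱 k (mono e I) = if I.degree = k then mono e I else 0 := by
  induction k generalizing I with
  | zero =>
    rcases eq_or_ne I 0 with rfl | hI
    · simp [mono_zero, wcomp_one]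
    · rw [if_neg (by rwa [Finsupp.degree_eq_zero_iff])]
      obtain ⟨i, J, rfl⟩ := exists_eq_add_single hI
      rw [mono_add_single, wcomp_zero_ι_mul]
  | succ k ih =>
    rcases eq_or_ne I 0 with rfl | hI
    · simp [mono_zero, wcomp_one]
    · obtain ⟨i, J, rfl⟩ := exists_eq_add_single hI
      rw [mono_add_single, wcomp_succ_ι_mul, ih]
      simp [mul_ite]

/-- The exponential generating series `∑_I f(e^I) / I! · x^I` of a functional on `S(V⁰)`. -/
def series (f : GSym 𝒱 →ₗ[K] K) : MvPowerSeries (Fin n) K := fun I =>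
  (∏ i, ((I i).factorial : K))⁻¹ * f (mono e I)

theorem coeff_series (f : GSym 𝒱 →ₗ[K] K) (I : Fin n →₀ ℕ) : MvPowerSeries.coeff I (series e f) =
    (∏ i, ((I i).factorial : K))⁻¹ * f (mono e I) := rfl

/-- The functional on `S(V⁰)`, extended by zero to `S(V)`, with a given generating series. -/
def functional (f : MvPowerSeries (Fin n) K) : GSym 𝒱 →ₗ[K] K :=
  (MvPolynomial.basisMonomials (Fin n) K).constr K
    (fun I => (∏ i, ((I i).factorial : K)) * MvPowerSeries.coeff I f) ∘ₗ (toPoly e).toLinearMap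

theorem functional_mono (f : MvPowerSeries (Fin n) K) (I : Fin n →₀ ℕ) :
    functional e f (mono e I) = (∏ i, ((I i).factorial : K)) * MvPowerSeries.coeff I f := by
  have h := (MvPolynomial.basisMonomials (Fin n) K).constr_basis K
    (fun I => (∏ i, ((I i).factorial : K)) * MvPowerSeries.coeff I f) I
  rw [MvPolynomial.coe_basisMonomials] at h
  rw [functional, LinearMap.comp_apply, AlgHom.toLinearMap_apply, toPoly_mono]
  exact h

theorem linearMap_eq_of_mono {M : Type*} [AddCommGroup M] [Module K M] {f g : GSym 𝒱 →ₗ[K] M}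
    (h : ∀ I, f (mono e I) = g (mono e I)) (x : GSym 𝒱) : f (zeroPart 𝒱 x) = g (zeroPart 𝒱 x) := by
  rw [← ofPoly_toPoly e]
  have : f ∘ₗ (ofPoly e).toLinearMap = g ∘ₗ (ofPoly e).toLinearMap :=
    (MvPolynomial.basisMonomials (Fin n) K).ext fun I => by
      rw [MvPolynomial.coe_basisMonomials]
      simp only [LinearMap.comp_apply, AlgHom.toLinearMap_apply, ofPoly_monomial, h]
  exact LinearMap.congr_fun this _

theorem functional_zeroPart (f : MvPowerSeries (Fin n) K) (x : GSym 𝒱) :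
    functional e f (zeroPart 𝒱 x) = functional e f x := by
  simp only [functional, LinearMap.comp_apply, AlgHom.toLinearMap_apply]
  rw [← ofPoly_toPoly e, toPoly_ofPoly]

theorem series_congr {f g : GSym 𝒱 →ₗ[K] K} (h : ∀ x ∈ degree 𝒱 0, f x = g x) :
    series e f = series e g :=
  MvPowerSeries.ext fun I => by rw [coeff_series, coeff_series, h _ (mono_mem_degree e I)]

theorem series_add (f g : GSym 𝒱 →ₗ[K] K) : series e (f + g) = series e f + series e g :=
  MvPowerSeries.ext fun I => by
    rw [map_add, coeff_series, coeff_series, coeff_series, LinearMap.add_apply, mul_add]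

theorem series_smul (c : K) (f : GSym 𝒱 →ₗ[K] K) : series e (c • f) = c • series e f :=
  MvPowerSeries.ext fun I => by
    rw [map_smul, coeff_series, coeff_series, LinearMap.smul_apply, smul_eq_mul, smul_eq_mul,
      mul_left_comm]

theorem functional_add (f g : MvPowerSeries (Fin n) K) :
    functional e (f + g) = functional e f + functional e g := LinearMap.ext fun x => by
  rw [← functional_zeroPart, LinearMap.add_apply, ← functional_zeroPart e f,
    ← functional_zeroPart e g]
  exact linearMap_eq_of_mono e (f := functional e (f + g)) (g := functional e f + functional e g)
    (fun I => by rw [LinearMap.add_apply, functional_mono, functional_mono, functional_mono, map_add,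
      mul_add]) x

variable [CharZero K]

theorem prod_factorial_ne_zero (I : Fin n →₀ ℕ) : (∏ i, ((I i).factorial : K)) ≠ 0 :=
  Finset.prod_ne_zero_iff.2 fun _ _ => Nat.cast_ne_zero.2 (Nat.factorial_ne_zero _)

theorem series_functional (f : MvPowerSeries (Fin n) K) : series e (functional e f) = f :=
  MvPowerSeries.ext fun I => by
    rw [coeff_series, functional_mono, inv_mul_cancel_left₀ (prod_factorial_ne_zero I)]

theorem functional_series (f : GSym 𝒱 →ₗ[K] K) (x : GSym 𝒱) :
    functional e (series e f) x = f (zeroPart 𝒱 x) := by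
  rw [← functional_zeroPart]
  exact linearMap_eq_of_mono e (fun I => by
    rw [functional_mono, coeff_series, mul_inv_cancel_left₀ (prod_factorial_ne_zero I)]) x

theorem coeff_series_add_single (f : GSym 𝒱 →ₗ[K] K) (I : Fin n →₀ ℕ) (i : Fin n) :
    MvPowerSeries.coeff (I + Finsupp.single i 1) (series e f) * (I i + 1 : K) =
      MvPowerSeries.coeff I (series e (f ∘ₗ LinearMap.mulLeft K (ι 𝒱 (e i : V)))) := by
  rw [coeff_series, coeff_series, mono_add_single, LinearMap.comp_apply, LinearMap.mulLeft_apply]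
  have h : (∏ j, (((I + Finsupp.single i 1 : Fin n →₀ ℕ) j).factorial : K)) =
      (I i + 1 : K) * ∏ j, ((I j).factorial : K) := by
    rw [← Finset.mul_prod_erase _ _ (Finset.mem_univ i),
      ← Finset.mul_prod_erase _ (fun j => ((I j).factorial : K)) (Finset.mem_univ i), ← mul_assoc]
    congr 1
    · simp [Nat.factorial_succ]
    · refine Finset.prod_congr rfl fun j hj => ?_
      simp [Finsupp.single_eq_of_ne (Finset.ne_of_mem_erase hj)]
  rw [h, mul_inv]
  have : (I i + 1 : K) ≠ 0 := Nat.cast_add_one_ne_zero _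
  field_simp

/-- The normalization by `1 / I!` turns left multiplication by `eᵢ` into the partial derivative in
`xᵢ`. -/
theorem pderiv_series (f : GSym 𝒱 →ₗ[K] K) (i : Fin n) : MvPowerSeries.pderiv K i (series e f) =
    series e (f ∘ₗ LinearMap.mulLeft K (ι 𝒱 (e i : V))) :=
  MvPowerSeries.ext fun I => by rw [MvPowerSeries.coeff_pderiv, coeff_series_add_single]

theorem constantCoeff_series (f : GSym 𝒱 →ₗ[K] K) :
    MvPowerSeries.constantCoeff (series e f) = f 1 := by
  rw [← MvPowerSeries.coeff_zero_eq_constantCoeff_apply, coeff_series, mono_zero]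
  simp

/-- The generating series of a convolution product is the product of the generating series. -/
theorem series_conv (f g : GSym 𝒱 →ₗ[K] K) : series e (conv f g) = series e f * series e g := by
  refine MvPowerSeries.ext fun I => ?_
  obtain ⟨k, hk⟩ : ∃ k, I.degree = k := ⟨_, rfl⟩
  induction k generalizing I f g with
  | zero =>
    obtain rfl : I = 0 := by rwa [Finsupp.degree_eq_zero_iff] at hk
    rw [MvPowerSeries.coeff_zero_eq_constantCoeff_apply,
      MvPowerSeries.coeff_zero_eq_constantCoeff_apply, map_mul, constantCoeff_series,
      constantCoeff_series, constantCoeff_series, conv_one_apply]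
  | succ k ih =>
    obtain ⟨i, J, rfl⟩ := exists_eq_add_single (I := I) (by rintro rfl; simp at hk)
    have hJ : J.degree = k := by simpa using hk
    have hne : (J i + 1 : K) ≠ 0 := Nat.cast_add_one_ne_zero _
    -- Coefficients are compared after differentiating: both products obey the Leibniz rule, with no
    -- sign since `eᵢ` has degree zero.
    refine mul_right_cancel₀ hne ?_
    have h1 : series e (conv f g ∘ₗ LinearMap.mulLeft K (ι 𝒱 (e i : V))) =
        series e (conv (f ∘ₗ LinearMap.mulLeft K (ι 𝒱 (e i : V))) g) +
          series e (conv f (g ∘ₗ LinearMap.mulLeft K (ι 𝒱 (e i : V)))) := by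
      rw [← series_add]
      refine congrArg _ (LinearMap.ext fun x => ?_)
      rw [LinearMap.comp_apply, LinearMap.mulLeft_apply, conv_ι_mul f g (e i).2, sgn_zero,
        LinearMap.comp_id, LinearMap.add_apply]
    rw [coeff_series_add_single, h1, map_add, ih _ _ _ hJ, ih _ _ _ hJ,
      ← MvPowerSeries.coeff_pderiv, Derivation.leibniz, pderiv_series, pderiv_series, map_add,
      smul_eq_mul, smul_eq_mul, add_comm, mul_comm (series e g)]

theorem functional_mul (f g : MvPowerSeries (Fin n) K) :
    functional e (f * g) = conv (functional e f) (functional e g) := by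
  have hz : ∀ f : MvPowerSeries (Fin n) K,
      functional e f ∘ₗ (zeroPart 𝒱).toLinearMap = functional e f := fun f =>
    LinearMap.ext (functional_zeroPart e f)
  refine LinearMap.ext fun x => ?_
  conv_lhs => rw [← series_functional e f, ← series_functional e g, ← series_conv,
    functional_series]
  have h := conv_comp_of_comul_comp (zeroPart_isCoalgHom (𝒱 := 𝒱)).comul_comp
    (functional e f) (functional e g)
  rw [hz, hz] at h
  exact LinearMap.congr_fun h x

theorem series_counit : series e (counit 𝒱).toLinearMap = 1 := by
  refine MvPowerSeries.ext fun I => ?_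
  rw [coeff_series, MvPowerSeries.coeff_one]
  split_ifs with h
  · subst h; simp [mono_zero]
  · obtain ⟨i, J, rfl⟩ := exists_eq_add_single h
    rw [mono_add_single, AlgHom.toLinearMap_apply, counit_ι_mul, mul_zero]

theorem functional_one_apply (f : MvPowerSeries (Fin n) K) :
    functional e f 1 = MvPowerSeries.constantCoeff f := by
  rw [← constantCoeff_series e, series_functional]

theorem functional_C (c : K) : functional e (MvPowerSeries.C c) = c • (counit 𝒱).toLinearMap := by
  refine LinearMap.ext fun x => ?_
  have h : (MvPowerSeries.C c : MvPowerSeries (Fin n) K) = series e (c • (counit 𝒱).toLinearMap) := by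
    rw [series_smul, series_counit, MvPowerSeries.smul_eq_C_mul, mul_one]
  rw [h, functional_series, LinearMap.smul_apply, LinearMap.smul_apply]
  exact congrArg _ (zeroPart_isCoalgHom.counit_map x)

/-- A power series of order greater than `k` corresponds to a functional vanishing on elements of
weight at most `k`. -/
theorem functional_eq_zero_of_mem_fil {f : MvPowerSeries (Fin n) K} {k : ℕ}
    (hf : ∀ I : Fin n →₀ ℕ, I.degree ≤ k → MvPowerSeries.coeff I f = 0) {x : GSym 𝒱}
    (hx : x ∈ fil 𝒱 k) : functional e f x = 0 := by
  have h0 : ∀ j ≤ k, ∀ x, functional e f (wcomp 𝒱 j (zeroPart 𝒱 x)) = 0 := fun j hj x =>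
    linearMap_eq_of_mono e (f := functional e f ∘ₗ wcomp 𝒱 j) (g := 0) (fun I => by
      rw [LinearMap.comp_apply, wcomp_mono]
      split_ifs with h
      · rw [functional_mono, hf I (h.trans_le hj), mul_zero, LinearMap.zero_apply]
      · rw [map_zero, LinearMap.zero_apply]) x
  rw [eq_sum_of_mem_fil hx, map_sum]
  refine Finset.sum_eq_zero fun j hj => ?_
  rw [← functional_zeroPart, zeroPart, ← wcomp_map]
  exact h0 j (by simpa [Nat.lt_succ_iff] using hj) x

theorem coeff_series_eq_zero {f : GSym 𝒱 →ₗ[K] K} {k : ℕ} (hf : ∀ x ∈ fil 𝒱 k, f x = 0)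
    {I : Fin n →₀ ℕ} (hI : I.degree ≤ k) : MvPowerSeries.coeff I (series e f) = 0 := by
  rw [coeff_series, hf, mul_zero]
  have := wcomp_mono e I.degree I
  rw [if_pos rfl] at this
  rw [← this]
  exact fil_mono hI (wcomp_mem_fil _)

/-! ### The transpose of a coalgebra morphism. -/

section Pullback

variable {W : Type w} [AddCommGroup W] [Module K W] {𝒲 : ℤ → Submodule K W}
  [DirectSum.Decomposition 𝒲] {m : ℕ} (e' : Module.Basis (Fin m) K (𝒲 0))

/-- The map of power series rings which is the transpose of a coalgebra morphism. -/
def pullback {F : GSym 𝒱 →ₗ[K] GSym 𝒲} (hF : IsCoalgHom F) :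
    MvPowerSeries (Fin m) K →ₐ[K] MvPowerSeries (Fin n) K :=
  AlgHom.ofLinearMap
    { toFun := fun f => series e (functional e' f ∘ₗ F)
      map_add' := fun f g => by rw [functional_add, LinearMap.add_comp, series_add]
      map_smul' := fun c f => by
        rw [MvPowerSeries.smul_eq_C_mul, functional_mul, functional_C, smul_conv,
          RingHom.id_apply, ← series_smul]
        exact congrArg (fun h => series e ((c • h) ∘ₗ F)) (convUnit_conv (functional e' f)) }
    (by
      change series e (functional e' 1 ∘ₗ F) = 1
      rw [← series_counit e, ← map_one (MvPowerSeries.C (σ := Fin m) (R := K)), functional_C,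
        one_smul]
      exact congrArg _ (LinearMap.ext hF.counit_map))
    (fun f g => by
      change series e (functional e' (f * g) ∘ₗ F) = series e (_ ∘ₗ F) * series e (_ ∘ₗ F)
      rw [functional_mul, conv_comp_of_comul_comp hF.comul_comp, series_conv])

variable {F : GSym 𝒱 →ₗ[K] GSym 𝒲} (hF : IsCoalgHom F)

theorem pullback_apply (f : MvPowerSeries (Fin m) K) :
    pullback e e' hF f = series e (functional e' f ∘ₗ F) := rfl

theorem functional_pullback (hneg : ∀ i < 0, 𝒱 i = ⊥) (f : MvPowerSeries (Fin m) K) {x : GSym 𝒱}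
    (hx : x ∈ degree 𝒱 0) : functional e (pullback e e' hF f) x = functional e' f (F x) := by
  rw [pullback_apply, functional_series, zeroPart_of_mem hneg le_rfl hx]; rfl

theorem pullback_pullback (hneg : ∀ i < 0, 𝒲 i = ⊥) {G : GSym 𝒲 →ₗ[K] GSym 𝒱}
    (hG : IsCoalgHom G) (h : ∀ x, G (F x) = x) (f : MvPowerSeries (Fin n) K) :
    pullback e e' hF (pullback e' e hG f) = f := by
  conv_rhs => rw [← series_functional e f]
  refine series_congr e fun x hx => ?_
  rw [LinearMap.comp_apply, functional_pullback e' e hG hneg f (hF.map_degree hx), h]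

end Pullback

end GSym

/-! ### Powers of the maximal ideal through orders. -/

namespace MvPowerSeries

variable {σ R : Type*} [CommRing R]

/-- The ideal of power series of order at least `N`. -/
def orderIdeal (σ R : Type*) [CommRing R] (N : ℕ) : Ideal (MvPowerSeries σ R) where
  carrier := {f | (N : ℕ∞) ≤ f.order}
  add_mem' hf hg := (le_min hf hg).trans min_order_le_add
  zero_mem' := by simp
  smul_mem' c f hf := (le_add_left hf).trans le_order_mul

theorem mem_orderIdeal {N : ℕ} {f : MvPowerSeries σ R} :
    f ∈ orderIdeal σ R N ↔ ∀ I : σ →₀ ℕ, I.degree < N → coeff I f = 0 :=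
  ⟨fun h _ hI => coeff_of_lt_order (lt_of_lt_of_le (by exact_mod_cast hI) h), nat_le_order⟩

theorem mul_mem_orderIdeal {M N : ℕ} {f g : MvPowerSeries σ R} (hf : f ∈ orderIdeal σ R M)
    (hg : g ∈ orderIdeal σ R N) : f * g ∈ orderIdeal σ R (M + N) := by
  change ((M + N : ℕ) : ℕ∞) ≤ _
  push_cast
  exact (add_le_add hf hg).trans le_order_mul

theorem mem_orderIdeal_one {f : MvPowerSeries σ R} :
    f ∈ orderIdeal σ R 1 ↔ constantCoeff f = 0 := by
  rw [← one_le_order_iff_constCoeff_eq_zero]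
  rfl

theorem orderIdeal_mono {M N : ℕ} (h : M ≤ N) : orderIdeal σ R N ≤ orderIdeal σ R M :=
  fun _ hf => mem_orderIdeal.2 fun I hI => mem_orderIdeal.1 hf I (by omega)

end MvPowerSeries

/-! ### The Kuranishi ideal as an annihilator, and its invariance. -/

namespace LInftyOne

open GSym MvPowerSeries

variable {K : Type u} [Field K] [CharZero K]
variable {V : Type v} [AddCommGroup V] [Module K V] {𝒱 : ℤ → Submodule K V}
  [DirectSum.Decomposition 𝒱]
variable {W : Type w} [AddCommGroup W] [Module K W] {𝒲 : ℤ → Submodule K W}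
  [DirectSum.Decomposition 𝒲]
variable (X : LInftyOne 𝒱) {n : ℕ} (e : Module.Basis (Fin n) K (𝒱 0))

variable (𝒱) in
/-- The projection `V → Vⁱ`. -/
def degreeProj (i : ℤ) : V →ₗ[K] 𝒱 i :=
  DirectSum.component K ℤ (fun k => 𝒱 k) i ∘ₗ (DirectSum.decomposeLinearEquiv 𝒱).toLinearMap

theorem degreeProj_of_mem {i : ℤ} {v : V} (hv : v ∈ 𝒱 i) : degreeProj 𝒱 i v = ⟨v, hv⟩ :=
  Subtype.ext (component_of_mem hv)

theorem degreeProj_of_mem_ne {i j : ℤ} (h : j ≠ i) {v : V} (hv : v ∈ 𝒱 j) :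
    degreeProj 𝒱 i v = 0 :=
  Subtype.ext (component_of_mem_ne h hv)

theorem kuranishiSeries_eq (φ : Module.Dual K (𝒱 1)) :
    X.kuranishiSeries e φ = series e (φ ∘ₗ degreeProj 𝒱 1 ∘ₗ X.q) := rfl

theorem conv_comp_Q {A : Type*} [Ring A] [Algebra K A] (f g : GSym 𝒱 →ₗ[K] A) :
    conv f g ∘ₗ X.Q = conv (f ∘ₗ X.Q) g + conv (f ∘ₗ sign 𝒱) (g ∘ₗ X.Q) := by
  simp only [conv, LinearMap.comp_assoc, X.comul_comp, LinearMap.add_comp, LinearMap.comp_add,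
    ← LinearMap.comp_assoc _ _ (TensorProduct.map f g), ← TensorProduct.map_comp,
    LinearMap.comp_id]

/-- In the coderivation rule, the term where `Q` hits the second factor applies the projection to
`V¹` to an element of `S(V⁰)`, hence vanishes. -/
theorem conv_q_apply (hneg : ∀ i < 0, 𝒱 i = ⊥) (φ : Module.Dual K (𝒱 1)) (g : GSym 𝒱 →ₗ[K] K)
    {x : GSym 𝒱} (hx : x ∈ degree 𝒱 0) : conv (φ ∘ₗ degreeProj 𝒱 1 ∘ₗ X.q) g x =
      conv (φ ∘ₗ degreeProj 𝒱 1 ∘ₗ proj 𝒱) g (X.Q x) := by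
  have h := LinearMap.congr_fun (X.conv_comp_Q (φ ∘ₗ degreeProj 𝒱 1 ∘ₗ proj 𝒱) g) x
  rw [LinearMap.comp_apply] at h
  rw [h, LinearMap.add_apply]
  refine (add_eq_left.2 ?_).symm
  rw [← zeroPart_of_mem hneg le_rfl hx]
  have h2 := conv_comp_of_comul_comp (zeroPart_isCoalgHom (𝒱 := 𝒱)).comul_comp
    ((φ ∘ₗ degreeProj 𝒱 1 ∘ₗ proj 𝒱) ∘ₗ sign 𝒱) (g ∘ₗ X.Q)
  have h3 : ((φ ∘ₗ degreeProj 𝒱 1 ∘ₗ proj 𝒱) ∘ₗ sign 𝒱) ∘ₗ (zeroPart 𝒱).toLinearMap = 0 := by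
    refine LinearMap.ext fun y => ?_
    simp only [LinearMap.comp_apply, AlgHom.toLinearMap_apply, sign_of_mem (zeroPart_mem y),
      zpow_zero, one_smul, LinearMap.zero_apply]
    rw [degreeProj_of_mem_ne (by norm_num) (proj_mem 𝒱 (zeroPart_mem y)), map_zero]
  rw [h3, zero_conv] at h2
  exact LinearMap.congr_fun h2 x

/-- Every multiple of a generator of the ideal thus factors through `Q` as a functional. -/
theorem functional_mul_kuranishiSeries (hneg : ∀ i < 0, 𝒱 i = ⊥) (φ : Module.Dual K (𝒱 1))
    (a : MvPowerSeries (Fin n) K) {x : GSym 𝒱} (hx : x ∈ degree 𝒱 0) :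
    functional e (a * X.kuranishiSeries e φ) x =
      conv (φ ∘ₗ degreeProj 𝒱 1 ∘ₗ proj 𝒱) (functional e a) (X.Q x) := by
  rw [← X.conv_q_apply hneg φ _ hx, mul_comm, kuranishiSeries_eq]
  conv_lhs => rw [← series_functional e a, ← series_conv, functional_series,
    zeroPart_of_mem hneg le_rfl hx]

theorem functional_mul_eq_zero (hneg : ∀ i < 0, 𝒱 i = ⊥) {x : GSym 𝒱} (hx : x ∈ degree 𝒱 0)
    (𝔞 : Ideal (MvPowerSeries (Fin n) K))
    (h : ∀ a ∈ 𝔞, ∀ φ, conv (φ ∘ₗ degreeProj 𝒱 1 ∘ₗ proj 𝒱) (functional e a) (X.Q x) = 0)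
    {f a : MvPowerSeries (Fin n) K} (hf : f ∈ X.kuranishiIdeal e) (ha : a ∈ 𝔞) :
    functional e (a * f) x = 0 := by
  have h0 : functional e 0 x = 0 := by
    have := functional_C (𝒱 := 𝒱) e 0
    rw [map_zero, zero_smul] at this
    rw [this, LinearMap.zero_apply]
  induction hf using Submodule.span_induction generalizing a with
  | mem f hf =>
    obtain ⟨φ, rfl⟩ := hf
    rw [X.functional_mul_kuranishiSeries e hneg φ a hx, h a ha φ]
  | zero => rw [mul_zero, h0]
  | add f g _ _ hf hg => rw [mul_add, functional_add, LinearMap.add_apply, hf ha, hg ha, add_zero]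
  | smul b f _ hf =>
    rw [smul_eq_mul, ← mul_assoc]
    exact hf (𝔞.mul_mem_right b ha)

theorem functional_eq_zero_of_mem_kuranishiIdeal (hneg : ∀ i < 0, 𝒱 i = ⊥)
    {f : MvPowerSeries (Fin n) K} (hf : f ∈ X.kuranishiIdeal e) {x : GSym 𝒱}
    (hx : x ∈ degree 𝒱 0) (hQ : X.Q x = 0) : functional e f x = 0 := by
  have := X.functional_mul_eq_zero e hneg hx ⊤ (fun a _ φ => by rw [hQ, map_zero]) hf
    (Submodule.mem_top (x := 1))
  rwa [one_mul] at this

/-- Multiples by the maximal ideal vanish on more than `ker Q`: when `Q x` is a single vector `v`,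
the convolution evaluates to `φ v` times the constant term of `a`. -/
theorem functional_mul_eq_zero_of_mem_kuranishiIdeal (hneg : ∀ i < 0, 𝒱 i = ⊥)
    {f a : MvPowerSeries (Fin n) K} (hf : f ∈ X.kuranishiIdeal e) (ha : a ∈ orderIdeal (Fin n) K 1)
    {x : GSym 𝒱} (hx : x ∈ degree 𝒱 0) {v : V} (hQ : X.Q x = ι 𝒱 v) :
    functional e (a * f) x = 0 := by
  refine X.functional_mul_eq_zero e hneg hx _ (fun a ha φ => ?_) hf ha
  rw [hQ, conv_ι_apply, functional_one_apply, mem_orderIdeal_one.1 ha, mul_zero, zero_add,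
    LinearMap.comp_apply, LinearMap.comp_apply, proj_one, map_zero, map_zero, zero_mul]

/-- On `S(V⁰)`, `Q` splits off a factor in `V¹`. Expanding it in a basis `b` writes the series as
the sum over `j` of the Kuranishi series of the `j`-th coordinate times the series of `μ (b j ⊙ ·)`.
-/
theorem series_comp_Q_mem (hneg : ∀ i < 0, 𝒱 i = ⊥) [FiniteDimensional K (𝒱 1)]
    (μ : GSym 𝒱 →ₗ[K] K) : series e (μ ∘ₗ X.Q) ∈ X.kuranishiIdeal e := by
  let b := Module.finBasis K (𝒱 1)
  let l : ∀ j, GSym 𝒱 →ₗ[K] K := fun j => b.coord j ∘ₗ degreeProj 𝒱 1 ∘ₗ X.q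
  let Z := (zeroPart 𝒱).toLinearMap
  let L : ∀ j, GSym 𝒱 →ₗ[K] K := fun j => μ ∘ₗ LinearMap.mulLeft K (ι 𝒱 (b j : V))
  have key : μ ∘ₗ LinearMap.mul' K _ ∘ₗ TensorProduct.map ((ι 𝒱 ∘ₗ X.q) ∘ₗ Z) (LinearMap.id ∘ₗ Z) =
      ∑ j, LinearMap.mul' K K ∘ₗ TensorProduct.map (l j ∘ₗ Z) (L j ∘ₗ Z) := by
    refine TensorProduct.ext' fun s t => ?_
    have hq : X.q (Z s) ∈ 𝒱 1 := by
      have := X.q_mem (zeroPart_mem s)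
      rwa [zero_add] at this
    have hs : X.q (Z s) = ∑ j, l j (Z s) • (b j : V) := by
      have h1 := congrArg Subtype.val (b.sum_repr ⟨X.q (Z s), hq⟩)
      rw [AddSubmonoidClass.coe_finsetSum] at h1
      refine h1.symm.trans (Finset.sum_congr rfl fun j _ => ?_)
      simp only [l, LinearMap.comp_apply, degreeProj_of_mem hq]
      rfl
    simp only [LinearMap.comp_apply, TensorProduct.map_tmul, LinearMap.mul'_apply,
      LinearMap.sum_apply, LinearMap.id_apply]
    rw [hs, map_sum, Finset.sum_mul, map_sum]
    refine Finset.sum_congr rfl fun j _ => ?_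
    rw [map_smul, smul_mul_assoc, map_smul, smul_eq_mul]
    rfl
  have h2 : series e (μ ∘ₗ X.Q) = ∑ j, series e (l j) * series e (L j) := by
    have hs : ∑ j, series e (l j) * series e (L j) = series e (∑ j, conv (l j) (L j)) := by
      simp only [← series_conv]
      let T : (GSym 𝒱 →ₗ[K] K) →+ MvPowerSeries (Fin n) K :=
        ⟨⟨series e, MvPowerSeries.ext fun I => by simp [coeff_series]⟩, series_add e⟩
      exact (map_sum T _ _).symm
    rw [hs]
    refine series_congr e fun x hx => ?_
    have h3 := LinearMap.congr_fun key (comul 𝒱 x)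
    have h4 : μ (conv ((ι 𝒱 ∘ₗ X.q) ∘ₗ Z) (LinearMap.id ∘ₗ Z) x) =
        ∑ j, conv (l j ∘ₗ Z) (L j ∘ₗ Z) x := by
      rw [LinearMap.sum_apply] at h3
      exact h3
    have hZ : ∀ {A : Type (max u v)} [Ring A] [Algebra K A] (f g : GSym 𝒱 →ₗ[K] A),
        conv (f ∘ₗ Z) (g ∘ₗ Z) x = conv f g x := fun f g => by
      rw [← conv_comp_of_comul_comp zeroPart_isCoalgHom.comul_comp, LinearMap.comp_apply,
        AlgHom.toLinearMap_apply, zeroPart_of_mem hneg le_rfl hx]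
    have hZ' : ∀ (f g : GSym 𝒱 →ₗ[K] K),
        conv (f ∘ₗ Z) (g ∘ₗ Z) x = conv f g x := fun f g => by
      rw [← conv_comp_of_comul_comp zeroPart_isCoalgHom.comul_comp, LinearMap.comp_apply,
        AlgHom.toLinearMap_apply, zeroPart_of_mem hneg le_rfl hx]
    rw [hZ, ← X.Q_eq] at h4
    simp only [hZ'] at h4
    rw [LinearMap.comp_apply, h4, LinearMap.sum_apply]
  rw [h2]
  refine Ideal.sum_mem _ fun j _ => Ideal.mul_mem_right _ _ (Ideal.subset_span ⟨b.coord j, ?_⟩)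
  rw [kuranishiSeries_eq]

/-- A functional on the degree-zero part that vanishes on `ker Q` factors through `Q`, so it lies in
the ideal by `series_comp_Q_mem`. -/
theorem mem_kuranishiIdeal_iff (hneg : ∀ i < 0, 𝒱 i = ⊥) [FiniteDimensional K (𝒱 1)]
    {f : MvPowerSeries (Fin n) K} : f ∈ X.kuranishiIdeal e ↔
      ∀ x ∈ degree 𝒱 0, X.Q x = 0 → functional e f x = 0 := by
  refine ⟨fun hf x hx hQ => X.functional_eq_zero_of_mem_kuranishiIdeal e hneg hf hx hQ, fun h => ?_⟩
  obtain ⟨μ, hμ⟩ := LinearMap.exists_comp_eq_of_ker_le_ker (X.Q ∘ₗ (degree 𝒱 0).subtype)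
    (functional e f ∘ₗ (degree 𝒱 0).subtype) fun x hx => h x x.2 hx
  have : f = series e (μ ∘ₗ X.Q) := by
    conv_lhs => rw [← series_functional e f]
    exact series_congr e fun x hx => (LinearMap.congr_fun hμ ⟨x, hx⟩).symm
  rw [this]
  exact X.series_comp_Q_mem e hneg μ

/-- Each element of `S(V)` has finite weight, so a membership test involves only finitely many
orders. -/
theorem kuranishiIdeal_closed (hneg : ∀ i < 0, 𝒱 i = ⊥) [FiniteDimensional K (𝒱 1)]
    {f : MvPowerSeries (Fin n) K}
    (h : ∀ N, ∃ g ∈ X.kuranishiIdeal e, f - g ∈ orderIdeal (Fin n) K N) :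
    f ∈ X.kuranishiIdeal e := by
  rw [X.mem_kuranishiIdeal_iff e hneg]
  intro x hx hQ
  obtain ⟨k, hk⟩ := exists_mem_fil x
  obtain ⟨g, hg, hfg⟩ := h (k + 1)
  rw [← sub_add_cancel f g, functional_add, LinearMap.add_apply,
    X.functional_eq_zero_of_mem_kuranishiIdeal e hneg hg hx hQ, add_zero]
  exact functional_eq_zero_of_mem_fil e
    (fun I hI => mem_orderIdeal.1 hfg I (Nat.lt_succ_of_le hI)) hk

theorem kuranishiIdeal_le (hX : X.IsMinimal) : X.kuranishiIdeal e ≤ orderIdeal (Fin n) K 2 := by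
  refine Ideal.span_le.2 ?_
  rintro _ ⟨φ, rfl⟩
  refine mem_orderIdeal.2 fun I hI => ?_
  rw [kuranishiSeries_eq]
  refine coeff_series_eq_zero e (k := 1) (fun x hx => ?_) (by omega)
  have : X.q x = 0 := by
    rw [map_linear_of_mem_fil_one X.q_one hx, q_ι, hX, LinearMap.zero_apply]
  rw [LinearMap.comp_apply, LinearMap.comp_apply, this, map_zero, map_zero]

variable {X} {Y : LInftyOne 𝒲} {m : ℕ} (e' : Module.Basis (Fin m) K (𝒲 0))

theorem pullback_mem_kuranishiIdeal (hV : ∀ i < 0, 𝒱 i = ⊥) (hW : ∀ i < 0, 𝒲 i = ⊥)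
    [FiniteDimensional K (𝒱 1)] (F : Hom X Y)
    {f : MvPowerSeries (Fin m) K} (hf : f ∈ Y.kuranishiIdeal e') :
    pullback e e' F.isCoalgHom f ∈ X.kuranishiIdeal e := by
  rw [X.mem_kuranishiIdeal_iff e hV]
  intro x hx hQ
  rw [functional_pullback e e' F.isCoalgHom hV f hx]
  exact Y.functional_eq_zero_of_mem_kuranishiIdeal e' hW hf (F.map_degree hx)
    (by rw [← F.comm_apply, hQ, map_zero])

/-- An isomorphism of `L∞[1]` algebras induces an isomorphism of Kuranishi algebras. -/
theorem Hom.kuranishiAlgebra_equiv (hV : ∀ i < 0, 𝒱 i = ⊥) (hW : ∀ i < 0, 𝒲 i = ⊥)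
    [FiniteDimensional K (𝒱 1)] [FiniteDimensional K (𝒲 1)] (F : Hom X Y)
    (hF : Function.Bijective F.f₁) :
    Nonempty (X.KuranishiAlgebra e ≃ₐ[K] Y.KuranishiAlgebra e') := by
  obtain ⟨G, hGF, hFG⟩ := F.exists_inverse hF
  have h1 := pullback_pullback e e' F.isCoalgHom hW G.isCoalgHom hGF
  have h2 := pullback_pullback e' e G.isCoalgHom hV F.isCoalgHom hFG
  let E : MvPowerSeries (Fin n) K ≃ₐ[K] MvPowerSeries (Fin m) K :=
    AlgEquiv.ofAlgHom (pullback e' e G.isCoalgHom) (pullback e e' F.isCoalgHom)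
      (AlgHom.ext h2) (AlgHom.ext h1)
  refine ⟨Ideal.quotientEquivAlg _ _ E (le_antisymm (fun f hf => ?_) ?_)⟩
  · have := Ideal.mem_map_of_mem (E : MvPowerSeries (Fin n) K →+* MvPowerSeries (Fin m) K)
      (pullback_mem_kuranishiIdeal e e' hV hW F hf)
    have h3 : E (pullback e e' F.isCoalgHom f) = f := h2 f
    rw [← h3]
    exact this
  · rw [Ideal.map_le_iff_le_comap]
    intro f hf
    exact pullback_mem_kuranishiIdeal e' e hW hV G hf

end LInftyOne

/-! ### Algebra maps between quotients of power series rings. -/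

namespace MvPowerSeries

variable {K : Type*} [Field K] {m n : ℕ}

theorem exists_eq_sum_X_mul {N : ℕ} {f : MvPowerSeries (Fin m) K}
    (hf : f ∈ orderIdeal (Fin m) K (N + 1)) :
    ∃ t : Fin m → MvPowerSeries (Fin m) K,
      (∀ i, t i ∈ orderIdeal (Fin m) K N) ∧ f = ∑ i, X i * t i := by
  have hex : ∀ I : Fin m →₀ ℕ, I ≠ 0 → ∃ i, Finsupp.single i 1 ≤ I := fun I hI => by
    obtain ⟨i, hi⟩ := Finsupp.ne_iff.1 hI
    exact ⟨i, Finsupp.single_le_iff.2 (Nat.one_le_iff_ne_zero.2 hi)⟩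
  -- Each nonconstant monomial is assigned to one variable dividing it, so that no coefficient is
  -- used twice.
  choose c hc using hex
  have hne : ∀ (J : Fin m →₀ ℕ) i, J + Finsupp.single i 1 ≠ 0 := fun J i h => by
    have := DFunLike.congr_fun h i
    simp at this
  let t : Fin m → MvPowerSeries (Fin m) K := fun i J =>
    if c (J + Finsupp.single i 1) (hne J i) = i then coeff (J + Finsupp.single i 1) f else 0
  have ht : ∀ i J I (hI : I ≠ 0), J + Finsupp.single i 1 = I →
      coeff J (t i) = if c I hI = i then coeff I f else 0 := by
    rintro i J I hI rfl
    rfl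
  refine ⟨t, fun i => mem_orderIdeal.2 fun J hJ => ?_, MvPowerSeries.ext fun I => ?_⟩
  · rw [ht i J _ (hne J i) rfl, mem_orderIdeal.1 hf _ (by simpa using hJ), ite_self]
  · rw [map_sum]
    simp only [X, coeff_monomial_mul, one_mul]
    rcases eq_or_ne I 0 with rfl | hI
    · rw [mem_orderIdeal.1 hf 0 (by simp)]
      refine (Finset.sum_eq_zero fun i _ => if_neg ?_).symm
      simp
    · rw [Finset.sum_eq_single (c I hI)]
      · rw [if_pos (hc I hI), ht _ _ I hI (tsub_add_cancel_of_le (hc I hI)), if_pos rfl]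
      · intro i _ hi
        split_ifs with h
        · rw [ht _ _ I hI (tsub_add_cancel_of_le h), if_neg (Ne.symm hi)]
        · rfl
      · simp

variable {I : Ideal (MvPowerSeries (Fin n) K)} {J : Ideal (MvPowerSeries (Fin m) K)}

/-- Automatic continuity: once the variables go to the maximal ideal, so do powers to powers, since
a series of order `N + 1` is a finite sum of variables times series of order `N`. -/
theorem exists_lift_mem_orderIdeal (α : MvPowerSeries (Fin m) K →ₐ[K] MvPowerSeries (Fin n) K ⧸ I)
    {θ : Fin m → MvPowerSeries (Fin n) K} (hθ : ∀ i, θ i ∈ orderIdeal (Fin n) K 1)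
    (hα : ∀ i, α (X i) = Ideal.Quotient.mk I (θ i)) {N : ℕ} {f : MvPowerSeries (Fin m) K}
    (hf : f ∈ orderIdeal (Fin m) K N) :
    ∃ g ∈ orderIdeal (Fin n) K N, α f = Ideal.Quotient.mk I g := by
  induction N generalizing f with
  | zero =>
    obtain ⟨g, hg⟩ := Ideal.Quotient.mk_surjective (α f)
    exact ⟨g, mem_orderIdeal.2 fun I hI => by omega, hg.symm⟩
  | succ N ih =>
    obtain ⟨t, ht, rfl⟩ := exists_eq_sum_X_mul hf
    choose g hg hg' using fun i => ih (ht i)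
    refine ⟨∑ i, θ i * g i, Ideal.sum_mem _ fun i _ => ?_, ?_⟩
    · rw [add_comm]
      exact mul_mem_orderIdeal (hθ i) (hg i)
    · simp only [map_sum, map_mul, hα, hg']

/-- A nonzero constant term would make `θ`, hence the variable modulo `J`, a unit, impossible as `J`
lies in the maximal ideal. -/
theorem mem_orderIdeal_one_of_mk_eq (hJ : J ≤ orderIdeal (Fin m) K 1)
    (ρ : (MvPowerSeries (Fin m) K ⧸ J) ≃ₐ[K] MvPowerSeries (Fin n) K ⧸ I) {i : Fin m}
    {θ : MvPowerSeries (Fin n) K}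
    (h : ρ (Ideal.Quotient.mk J (X i)) = Ideal.Quotient.mk I θ) :
    θ ∈ orderIdeal (Fin n) K 1 := by
  rw [mem_orderIdeal_one]
  by_contra hθ
  have hu : IsUnit (Ideal.Quotient.mk I θ) :=
    (isUnit_iff_constantCoeff.2 (isUnit_iff_ne_zero.2 hθ)).map (Ideal.Quotient.mk I)
  rw [← h] at hu
  have hu' := hu.map ρ.symm
  rw [AlgEquiv.symm_apply_apply] at hu'
  obtain ⟨b, hb⟩ := hu'.exists_right_inv
  obtain ⟨a, rfl⟩ := Ideal.Quotient.mk_surjective b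
  rw [← map_mul, ← map_one (Ideal.Quotient.mk J), Ideal.Quotient.eq] at hb
  have := mem_orderIdeal_one.1 (hJ hb)
  simp at this

/-- Modulo terms of order two, `ρ` and `ρ⁻¹` induce mutually inverse maps of cotangent spaces; the
lifts compose to the identity to first order because `I` has no linear terms. -/
theorem sum_coeff_mul_coeff_eq (hI : I ≤ orderIdeal (Fin n) K 2)
    (ρ : (MvPowerSeries (Fin m) K ⧸ J) ≃ₐ[K] MvPowerSeries (Fin n) K ⧸ I)
    {θ : Fin m → MvPowerSeries (Fin n) K} (hθ : ∀ i, θ i ∈ orderIdeal (Fin n) K 1)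
    (hρ : ∀ i, ρ (Ideal.Quotient.mk J (X i)) = Ideal.Quotient.mk I (θ i))
    {η : Fin n → MvPowerSeries (Fin m) K} (hη : ∀ j, η j ∈ orderIdeal (Fin m) K 1)
    (hρ' : ∀ j, ρ.symm (Ideal.Quotient.mk I (X j)) = Ideal.Quotient.mk J (η j)) (j k : Fin n) :
    ∑ i, coeff (Finsupp.single i 1) (η j) * coeff (Finsupp.single k 1) (θ i) =
      if j = k then 1 else 0 := by
  let α : MvPowerSeries (Fin m) K →ₐ[K] MvPowerSeries (Fin n) K ⧸ I :=
    ρ.toAlgHom.comp (Ideal.Quotient.mkₐ K J)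
  have hα : ∀ f, α f = ρ (Ideal.Quotient.mk J f) := fun f => rfl
  set t := η j - ∑ i, coeff (Finsupp.single i 1) (η j) • X i with ht
  have ht2 : t ∈ orderIdeal (Fin m) K 2 := by
    refine mem_orderIdeal.2 fun d hd => ?_
    rw [ht, map_sub, map_sum]
    simp only [map_smul, smul_eq_mul]
    rcases eq_or_ne d 0 with rfl | hd0
    · rw [mem_orderIdeal.1 (hη j) 0 (by simp)]
      simp
    · obtain ⟨l, d', rfl⟩ := GSym.exists_eq_add_single hd0
      obtain rfl : d' = 0 := by
        rw [← Finsupp.degree_eq_zero_iff]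
        simp at hd
        simpa using hd
      rw [zero_add]
      simp [coeff_index_single_X]
  obtain ⟨g, hg, hg'⟩ := exists_lift_mem_orderIdeal α hθ (fun i => (hα _).trans (hρ i)) ht2
  have h1 : Ideal.Quotient.mk I (X j - ∑ i, coeff (Finsupp.single i 1) (η j) • θ i) =
      Ideal.Quotient.mk I g := by
    rw [← hg', ht, map_sub, map_sub, map_sum, hα (η j), ← hρ', AlgEquiv.apply_symm_apply, map_sum]
    congr 1
    refine Finset.sum_congr rfl fun i _ => ?_
    exact ((map_smul α _ _).trans (by rw [hα, hρ]; rfl)).symm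
  rw [Ideal.Quotient.eq] at h1
  have h2 : X j - ∑ i, coeff (Finsupp.single i 1) (η j) • θ i ∈ orderIdeal (Fin n) K 2 := by
    have := Submodule.add_mem _ (hI h1) hg
    rwa [sub_add_cancel] at this
  have h3 := mem_orderIdeal.1 h2 (Finsupp.single k 1) (by simp)
  rw [map_sub, map_sum, sub_eq_zero, coeff_index_single_X] at h3
  simp only [map_smul, smul_eq_mul] at h3
  rw [← h3]
  simp only [eq_comm]

/-- The maps agree on polynomials, and both send the tail of order `N` to the image of series of
order `N`. -/
theorem exists_sub_eq_mk_mem_orderIdeal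
    (α β : MvPowerSeries (Fin m) K →ₐ[K] MvPowerSeries (Fin n) K ⧸ I)
    {θ : Fin m → MvPowerSeries (Fin n) K} (hθ : ∀ i, θ i ∈ orderIdeal (Fin n) K 1)
    (hα : ∀ i, α (X i) = Ideal.Quotient.mk I (θ i))
    (hβ : ∀ i, β (X i) = Ideal.Quotient.mk I (θ i)) (f : MvPowerSeries (Fin m) K) (N : ℕ) :
    ∃ g ∈ orderIdeal (Fin n) K N, α f - β f = Ideal.Quotient.mk I g := by
  let c : MvPolynomial (Fin m) K →ₐ[K] MvPowerSeries (Fin m) K :=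
    MvPolynomial.coeToMvPowerSeries.algHom K
  have hc : ∀ p : MvPolynomial (Fin m) K, c p = (p : MvPowerSeries (Fin m) K) := fun p => by
    rw [MvPolynomial.coeToMvPowerSeries.algHom_apply, Algebra.algebraMap_self, map_id]; rfl
  have hpoly : ∀ p : MvPolynomial (Fin m) K, α (p : MvPowerSeries (Fin m) K) = β p := by
    have : α.comp c = β.comp c := MvPolynomial.algHom_ext fun i => by
      rw [AlgHom.comp_apply, AlgHom.comp_apply, hc, MvPolynomial.coe_X, hα, hβ]
    intro p
    rw [← hc]
    exact DFunLike.congr_fun this p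
  have ht : f - (truncTotal N f : MvPolynomial (Fin m) K) ∈ orderIdeal (Fin m) K N :=
    mem_orderIdeal.2 fun d hd => by
      rw [map_sub, MvPolynomial.coeff_coe, coeff_truncTotal _ hd, sub_self]
  obtain ⟨g, hg, hg'⟩ := exists_lift_mem_orderIdeal α hθ hα ht
  obtain ⟨h, hh, hh'⟩ := exists_lift_mem_orderIdeal β hθ hβ ht
  refine ⟨g - h, Submodule.sub_mem _ hg hh, ?_⟩
  rw [map_sub, ← hg', ← hh', map_sub, map_sub, hpoly]
  abel

end MvPowerSeries

/-! ### Coordinate functionals and injectivity in degree zero. -/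

namespace GSym

open MvPowerSeries

variable {K : Type u} [Field K]
variable {V : Type v} [AddCommGroup V] [Module K V] {𝒱 : ℤ → Submodule K V}
  [DirectSum.Decomposition 𝒱]
variable {n : ℕ} (e : Module.Basis (Fin n) K (𝒱 0))

theorem functional_smul (c : K) (f : MvPowerSeries (Fin n) K) :
    functional e (c • f) = c • functional e f := LinearMap.ext fun x => by
  rw [← functional_zeroPart, LinearMap.smul_apply, ← functional_zeroPart e f]
  exact linearMap_eq_of_mono e (f := functional e (c • f)) (g := c • functional e f)
    (fun I => by rw [LinearMap.smul_apply, functional_mono, functional_mono, map_smul,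
      smul_eq_mul, smul_eq_mul, mul_left_comm]) x

theorem functional_wcomp {f : MvPowerSeries (Fin n) K} {k : ℕ}
    (hf : ∀ I : Fin n →₀ ℕ, I.degree ≠ k → coeff I f = 0) (x : GSym 𝒱) :
    functional e f (wcomp 𝒱 k x) = functional e f x := by
  rw [← functional_zeroPart, ← functional_zeroPart e f x, zeroPart, ← wcomp_map]
  refine linearMap_eq_of_mono e (f := functional e f ∘ₗ wcomp 𝒱 k) (g := functional e f)
    (fun I => ?_) x
  rw [LinearMap.comp_apply, wcomp_mono]
  split_ifs with h
  · rfl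
  · rw [map_zero, functional_mono, hf I h, mul_zero]

theorem functional_ι (f : MvPowerSeries (Fin n) K) (k : Fin n) :
    functional e f (ι 𝒱 (e k : V)) = coeff (Finsupp.single k 1) f := by
  rw [← mono_single, functional_mono, Finset.prod_eq_one, one_mul]
  intro i _
  rw [Finsupp.single_apply]
  split_ifs <;> simp

variable [CharZero K]

theorem functional_X (i : Fin n) (x : GSym 𝒱) :
    functional e (X i) x = e.coord i (LInftyOne.degreeProj 𝒱 0 (proj 𝒱 x)) := by
  have h : (X i : MvPowerSeries (Fin n) K) =
      series e (e.coord i ∘ₗ LInftyOne.degreeProj 𝒱 0 ∘ₗ proj 𝒱) := by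
    refine MvPowerSeries.ext fun I => ?_
    rw [coeff_series, coeff_X]
    rcases eq_or_ne I 0 with rfl | hI
    · rw [mono_zero, LinearMap.comp_apply, LinearMap.comp_apply, proj_one, map_zero, map_zero,
        mul_zero, if_neg]
      intro h
      simpa using DFunLike.congr_fun h i
    · obtain ⟨k, J, rfl⟩ := exists_eq_add_single hI
      rw [mono_add_single, LinearMap.comp_apply, LinearMap.comp_apply, proj_ι_mul, map_smul,
        LInftyOne.degreeProj_of_mem (e k).2, map_smul]
      rcases eq_or_ne J 0 with rfl | hJ
      · rw [zero_add, mono_zero, map_one, one_smul, Finset.prod_eq_one, inv_one, one_mul]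
        · simp [Finsupp.single_left_inj, Finsupp.single_apply]
        · intro j _
          rw [Finsupp.single_apply]
          split_ifs <;> simp
      · obtain ⟨l, J, rfl⟩ := exists_eq_add_single hJ
        rw [mono_add_single, counit_ι_mul, zero_smul, mul_zero, if_neg]
        intro h
        have := congrArg Finsupp.degree h
        simp at this
  rw [h, functional_series, LinearMap.comp_apply, LinearMap.comp_apply, zeroPart, proj_map]
  congr 1
  rw [LInftyOne.degreeProj_of_mem (component_apply_mem 0 _)]
  rfl

theorem zeroPart_Q (hneg : ∀ i < 0, 𝒱 i = ⊥) (X : LInftyOne 𝒱) (x : GSym 𝒱) :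
    zeroPart 𝒱 (X.Q x) = 0 := by
  suffices h : (zeroPart 𝒱).toLinearMap ∘ₗ X.Q = 0 from LinearMap.congr_fun h x
  refine linearMap_ext_degree fun k x hx => ?_
  rw [LinearMap.comp_apply, AlgHom.toLinearMap_apply, LinearMap.zero_apply]
  rcases eq_or_ne (k + 1) 0 with hk | hk
  · rw [eq_zero_of_mem_degree_neg hneg (by omega) hx, map_zero, map_zero]
  · exact zeroPart_of_mem_ne hk (X.map_degree hx)

/-- A coalgebra morphism which is the identity to first order in degree zero is injective in degree
zero. -/
theorem IsCoalgHom.eq_zero_of_map_eq_zero (hneg : ∀ i < 0, 𝒱 i = ⊥) {F : GSym 𝒱 →ₗ[K] GSym 𝒱}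
    (hF : IsCoalgHom F) (hlin : linPart F = GCohomology.component 𝒱 0) {x : GSym 𝒱}
    (hx : x ∈ degree 𝒱 0) (h : F x = 0) : x = 0 := by
  obtain ⟨k, hk⟩ := exists_mem_fil x
  have key : ∀ k, x ∈ fil 𝒱 k → wcomp 𝒱 k x = 0 := fun k hk => by
    have h1 := hF.wcomp_apply hk
    rw [h, map_zero, GSym.map_congr (hψ := fun _ _ h => component_mem h) hlin] at h1
    exact (zeroPart_of_mem hneg le_rfl (wcomp_mem_degree k hx)).symm.trans h1.symm
  induction k with
  | zero => rw [eq_of_mem_fil_zero hk, ← wcomp_zero, key 0 hk]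
  | succ k ih => exact ih (mem_fil_of_wcomp_eq_zero hk (key _ hk))

end GSym

namespace LInftyOne

open GSym MvPowerSeries

variable {K : Type u} [Field K] [CharZero K]
variable {V : Type v} [AddCommGroup V] [Module K V] {𝒱 : ℤ → Submodule K V}
  [DirectSum.Decomposition 𝒱]

/-! ### Coalgebra morphisms from coordinate changes. -/

section Coordinates

variable {n m : ℕ} (e : Module.Basis (Fin n) K (𝒱 0)) (e' : Module.Basis (Fin m) K (𝒱 0))
  (θ : Fin m → MvPowerSeries (Fin n) K)

/-- The corestriction `S(V) → V⁰` with coordinate series `θ` in the basis `e'`. -/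
def coordMap : GSym 𝒱 →ₗ[K] V := ∑ i, (functional e (θ i)).smulRight (e' i : V)

theorem coordMap_apply (x : GSym 𝒱) :
    coordMap e e' θ x = ∑ i, functional e (θ i) x • (e' i : V) := by
  simp [coordMap, LinearMap.sum_apply]

theorem coordMap_apply_mem (x : GSym 𝒱) : coordMap e e' θ x ∈ 𝒱 0 := by
  rw [coordMap_apply]
  exact Submodule.sum_mem _ fun i _ => Submodule.smul_mem _ _ (e' i).2

theorem coordMap_zeroPart (x : GSym 𝒱) : coordMap e e' θ (zeroPart 𝒱 x) = coordMap e e' θ x := by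
  simp only [coordMap_apply, functional_zeroPart]

theorem coordMap_mem ⦃k : ℤ⦄ ⦃x : GSym 𝒱⦄ (hx : x ∈ degree 𝒱 k) : coordMap e e' θ x ∈ 𝒱 k := by
  rcases eq_or_ne k 0 with rfl | hk
  · exact coordMap_apply_mem e e' θ x
  · rw [← coordMap_zeroPart, zeroPart_of_mem_ne hk hx, map_zero]
    exact Submodule.zero_mem _

theorem coord_coordMap (x : GSym 𝒱) (i : Fin m) :
    e'.coord i (degreeProj 𝒱 0 (coordMap e e' θ x)) = functional e (θ i) x := by
  rw [degreeProj_of_mem (coordMap_apply_mem e e' θ x)]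
  have : (⟨coordMap e e' θ x, coordMap_apply_mem e e' θ x⟩ : 𝒱 0) =
      ∑ i, functional e (θ i) x • e' i := Subtype.ext (by
    rw [AddSubmonoidClass.coe_finsetSum]
    exact coordMap_apply e e' θ x)
  rw [this, Module.Basis.coord_apply, e'.repr_sum_self]

variable {θ}

theorem coordMap_one (hθ : ∀ i, θ i ∈ orderIdeal (Fin n) K 1) : coordMap e e' θ 1 = 0 := by
  rw [coordMap_apply]
  refine Finset.sum_eq_zero fun i _ => ?_
  rw [functional_one_apply, mem_orderIdeal_one.1 (hθ i), zero_smul]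

theorem coordMap_ι
    (h : ∀ i k, e'.coord i (e k) = coeff (Finsupp.single k 1) (θ i)) {v : V} (hv : v ∈ 𝒱 0) :
    coordMap e e' θ (ι 𝒱 v) = v := by
  have h1 : ∀ i, functional e (θ i) (ι 𝒱 v) = e'.coord i ⟨v, hv⟩ := fun i => by
    have : functional e (θ i) ∘ₗ ι 𝒱 ∘ₗ (𝒱 0).subtype = e'.coord i := e.ext fun k => by
      rw [h]; exact functional_ι e (θ i) k
    exact LinearMap.congr_fun this ⟨v, hv⟩
  have h2 := congrArg Subtype.val (e'.sum_repr ⟨v, hv⟩)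
  rw [AddSubmonoidClass.coe_finsetSum] at h2
  rw [coordMap_apply]
  simp only [h1]
  exact h2

variable (hθ : ∀ i, θ i ∈ orderIdeal (Fin n) K 1)

/-- On variables, the transpose of this coalgebra morphism is the substitution `xᵢ ↦ θᵢ`. -/
theorem pullback_coordMap_X (i : Fin m) :
    pullback e e' (cexp_isCoalgHom (coordMap_one e e' hθ) (coordMap_mem e e' θ)) (X i) = θ i := by
  rw [pullback_apply]
  conv_rhs => rw [← series_functional e (θ i)]
  refine congrArg _ (LinearMap.ext fun x => ?_)
  have h1 := LinearMap.congr_fun (proj_cexp (𝒲 := 𝒱) (coordMap_one e e' hθ)) x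
  rw [LinearMap.comp_apply] at h1
  rw [LinearMap.comp_apply, functional_X, h1, coord_coordMap]

theorem linPart_cexp_coordMap
    (h : ∀ i k, e'.coord i (e k) = coeff (Finsupp.single k 1) (θ i)) :
    linPart (cexp 𝒱 (coordMap e e' θ) (coordMap_one e e' hθ)) = GCohomology.component 𝒱 0 := by
  refine linearMap_ext_graded (ℳ := 𝒱) fun k v hv => ?_
  have h1 : linPart (cexp 𝒱 (coordMap e e' θ) (coordMap_one e e' hθ)) v =
      coordMap e e' θ (ι 𝒱 v) :=
    LinearMap.congr_fun (proj_cexp (𝒲 := 𝒱) (coordMap_one e e' hθ)) _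
  rw [h1]
  rcases eq_or_ne k 0 with rfl | hk
  · rw [coordMap_ι e e' h hv, component_of_mem hv]
  · rw [component_of_mem_ne hk hv]
    exact eq_of_mem_of_mem_ne hk (coordMap_mem e e' θ (ι_mem_degree 𝒱 hv))
      (coordMap_apply_mem e e' θ _)

end Coordinates

/-! ### From a quadratic Kuranishi algebra to the quadratic part. -/

section Quadratic

variable {n m : ℕ} {e : Module.Basis (Fin n) K (𝒱 0)} {e' : Module.Basis (Fin m) K (𝒱 0)}
  {S : Set (MvPolynomial (Fin m) K)}

theorem span_le_orderIdeal (hS : ∀ f ∈ S, f.IsHomogeneous 2) :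
    Ideal.span ((fun f : MvPolynomial (Fin m) K => (f : MvPowerSeries (Fin m) K)) '' S) ≤
      orderIdeal (Fin m) K 2 := by
  refine Ideal.span_le.2 ?_
  rintro _ ⟨p, hp, rfl⟩
  refine mem_orderIdeal.2 fun d hd => ?_
  rw [MvPolynomial.coeff_coe, (hS p hp).coeff_eq_zero (by omega)]

/-- Modulo the product of the maximal ideal with the Kuranishi ideal, the elements of an ideal
generated by quadrics agree with their quadratic parts. -/
theorem functional_wcomp_two (hS : ∀ f ∈ S, f.IsHomogeneous 2) (X : LInftyOne 𝒱)
    (hneg : ∀ i < 0, 𝒱 i = ⊥) {G : GSym 𝒱 →ₗ[K] GSym 𝒱} (hG : IsCoalgHom G)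
    (hJ : ∀ g ∈ Ideal.span ((fun f : MvPolynomial (Fin m) K => (f : MvPowerSeries (Fin m) K)) '' S),
      pullback e e' hG g ∈ X.kuranishiIdeal e)
    {x : GSym 𝒱} (hx : x ∈ degree 𝒱 0) {v : V} (hQ : X.Q x = ι 𝒱 v) {g : MvPowerSeries (Fin m) K}
    (hg : g ∈ Ideal.span ((fun f : MvPolynomial (Fin m) K => (f : MvPowerSeries (Fin m) K)) '' S)) :
    functional e' g (wcomp 𝒱 2 (G x)) = functional e' g (G x) := by
  induction hg using Submodule.span_induction with
  | mem g hg =>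
    obtain ⟨p, hp, rfl⟩ := hg
    refine functional_wcomp e' (fun I hI => ?_) _
    rw [MvPolynomial.coeff_coe, (hS p hp).coeff_eq_zero hI]
  | zero =>
    have : functional e' 0 = (0 : GSym 𝒱 →ₗ[K] K) := by
      simpa using functional_smul e' (0 : K) (0 : MvPowerSeries (Fin m) K)
    rw [this, LinearMap.zero_apply, LinearMap.zero_apply]
  | add f g _ _ hf hg => rw [functional_add, LinearMap.add_apply, LinearMap.add_apply, hf, hg]
  | smul a g hg h =>
    set a₀ := constantCoeff a
    have ha' : a - C a₀ ∈ orderIdeal (Fin m) K 1 := by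
      rw [mem_orderIdeal_one, map_sub, constantCoeff_C, sub_self]
    -- The constant of `a` only rescales. The rest puts the product in `𝔪 J`: of order at least
    -- three, it vanishes in weight two, and pulled back into `𝔪 I`, it vanishes on `x`.
    have hsplit : a • g = a₀ • g + (a - C a₀) * g := by
      rw [smul_eq_mul, MvPowerSeries.smul_eq_C_mul]; ring
    have h1 : functional e' ((a - C a₀) * g) (wcomp 𝒱 2 (G x)) = 0 := by
      refine functional_eq_zero_of_mem_fil e' (k := 2) (fun I hI => ?_) (wcomp_mem_fil _)
      exact mem_orderIdeal.1 (mul_mem_orderIdeal ha' (span_le_orderIdeal hS hg)) I (by omega)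
    have h2 : functional e' ((a - C a₀) * g) (G x) = 0 := by
      rw [← functional_pullback e e' hG hneg _ hx, map_mul]
      refine X.functional_mul_eq_zero_of_mem_kuranishiIdeal e hneg (hJ g hg) ?_ hx hQ
      rw [mem_orderIdeal_one, pullback_apply, constantCoeff_series, LinearMap.comp_apply,
        hG.map_one, functional_one_apply, mem_orderIdeal_one.1 ha']
    rw [hsplit, functional_add, functional_smul, LinearMap.add_apply, LinearMap.add_apply,
      LinearMap.smul_apply, LinearMap.smul_apply, h, h1, h2]

/-- The Jacobian `A` of the lifts is invertible by comparison of cotangent spaces. It is absorbed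
into the basis `e'`, so that the associated coalgebra morphism has the identity as linear part in
degree 0. -/
theorem exists_coordinates {I : Ideal (MvPowerSeries (Fin n) K)}
    {J : Ideal (MvPowerSeries (Fin m) K)} (hI : I ≤ orderIdeal (Fin n) K 2)
    (hJ : J ≤ orderIdeal (Fin m) K 2)
    (ρ : (MvPowerSeries (Fin n) K ⧸ I) ≃ₐ[K] MvPowerSeries (Fin m) K ⧸ J) :
    ∃ (θ : Fin m → MvPowerSeries (Fin n) K) (e' : Module.Basis (Fin m) K (𝒱 0)),
      (∀ i, θ i ∈ orderIdeal (Fin n) K 1) ∧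
      (∀ i, ρ.symm (Ideal.Quotient.mk J (X i)) = Ideal.Quotient.mk I (θ i)) ∧
      ∀ i k, e'.coord i (e k) = coeff (Finsupp.single k 1) (θ i) := by
  choose θ hθ using fun i : Fin m =>
    Ideal.Quotient.mk_surjective (ρ.symm (Ideal.Quotient.mk J (X i)))
  choose η hη using fun j : Fin n =>
    Ideal.Quotient.mk_surjective (ρ (Ideal.Quotient.mk I (X j)))
  have hθ1 : ∀ i, θ i ∈ orderIdeal (Fin n) K 1 := fun i =>
    mem_orderIdeal_one_of_mk_eq (hJ.trans (orderIdeal_mono one_le_two)) ρ.symm (hθ i).symm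
  have hη1 : ∀ j, η j ∈ orderIdeal (Fin m) K 1 := fun j =>
    mem_orderIdeal_one_of_mk_eq (hI.trans (orderIdeal_mono one_le_two)) ρ (hη j).symm
  let A : Matrix (Fin m) (Fin n) K := fun i k => coeff (Finsupp.single k 1) (θ i)
  let B : Matrix (Fin n) (Fin m) K := fun j i => coeff (Finsupp.single i 1) (η j)
  have hBA : B * A = 1 := by
    ext j k
    rw [Matrix.mul_apply, Matrix.one_apply]
    exact sum_coeff_mul_coeff_eq hI ρ.symm hθ1 (fun i => (hθ i).symm) hη1 (fun j => (hη j).symm) j k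
  have hAB : A * B = 1 := by
    ext j k
    rw [Matrix.mul_apply, Matrix.one_apply]
    exact sum_coeff_mul_coeff_eq hJ ρ hη1 (fun i => (hη i).symm) hθ1 (fun j => (hθ j).symm) j k
  refine ⟨θ, Module.Basis.ofEquivFun (e.equivFun.trans (Matrix.toLin'OfInv hBA hAB)), hθ1,
    fun i => (hθ i).symm, fun i k => ?_⟩
  rw [Module.Basis.coord_apply, ← Module.Basis.equivFun_apply, Module.Basis.equivFun_ofEquivFun,
    LinearEquiv.trans_apply]
  change Matrix.toLin' A _ i = _
  rw [Matrix.toLin'_apply]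
  simp [Matrix.mulVec, dotProduct, A, Module.Basis.equivFun_self]

/-- If the Kuranishi algebra of a minimal `L∞[1]` algebra concentrated in degrees `0` and `1` is
quadratic, then the algebra is isomorphic to its quadratic part. -/
theorem exists_hom_quadratic (X Y : LInftyOne 𝒱) (hX : X.IsMinimal)
    (hdeg : ∀ i : ℤ, i ≠ 0 → i ≠ 1 → 𝒱 i = ⊥) [FiniteDimensional K (𝒱 1)]
    (hY : ∀ x ∈ degree 𝒱 0, Y.q x = X.q (wcomp 𝒱 2 x))
    (hS : ∀ f ∈ S, f.IsHomogeneous 2)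
    (ρ : X.KuranishiAlgebra e ≃ₐ[K] MvPowerSeries (Fin m) K ⧸
      Ideal.span ((fun f : MvPolynomial (Fin m) K => (f : MvPowerSeries (Fin m) K)) '' S)) :
    ∃ F : Hom X Y, F.f₁ = LinearMap.id := by
  set J := Ideal.span ((fun f : MvPolynomial (Fin m) K => (f : MvPowerSeries (Fin m) K)) '' S)
    with hJdef
  have hneg : ∀ i < 0, 𝒱 i = ⊥ := fun i hi => hdeg i (by omega) (by omega)
  obtain ⟨θ, e', hθ, hρ, hcoord⟩ := exists_coordinates (e := e) (X.kuranishiIdeal_le e hX)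
    (span_le_orderIdeal hS) ρ
  have hG := cexp_isCoalgHom (𝒲 := 𝒱) (coordMap_one e e' hθ) (coordMap_mem e e' θ)
  have hlin := linPart_cexp_coordMap e e' hθ hcoord
  have hX' := pullback_coordMap_X e e' hθ
  set G := cexp 𝒱 (coordMap e e' θ) (coordMap_one e e' hθ) with hGdef
  have hmk : ∀ f, ρ.symm (Ideal.Quotient.mk J f) =
      Ideal.Quotient.mk (X.kuranishiIdeal e) (pullback e e' hG f) := by
    intro f
    let α : MvPowerSeries (Fin m) K →ₐ[K] X.KuranishiAlgebra e :=
      ρ.symm.toAlgHom.comp (Ideal.Quotient.mkₐ K J)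
    let β : MvPowerSeries (Fin m) K →ₐ[K] X.KuranishiAlgebra e :=
      (Ideal.Quotient.mkₐ K (X.kuranishiIdeal e)).comp (pullback e e' hG)
    obtain ⟨a, ha⟩ := Ideal.Quotient.mk_surjective (ρ.symm (Ideal.Quotient.mk J f))
    rw [← ha, Ideal.Quotient.eq]
    -- Two algebra maps equal on the variables agree to every order, and closedness of the ideal
    -- makes them equal.
    refine X.kuranishiIdeal_closed e hneg fun N => ?_
    obtain ⟨t, ht, ht'⟩ := exists_sub_eq_mk_mem_orderIdeal α β hθ hρ
      (fun i => congrArg _ (hX' i)) f N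
    refine ⟨a - pullback e e' hG f - t, ?_, by rwa [sub_sub_cancel]⟩
    rw [← Ideal.Quotient.eq_zero_iff_mem, map_sub, map_sub, ← ht', ha]
    exact sub_self _
  have hJI : ∀ g ∈ J, pullback e e' hG g ∈ X.kuranishiIdeal e := fun g hg => by
    rw [← Ideal.Quotient.eq_zero_iff_mem, ← hmk, Ideal.Quotient.eq_zero_iff_mem.2 hg, map_zero]
  have hIJ : ∀ g, pullback e e' hG g ∈ X.kuranishiIdeal e → g ∈ J := fun g hg => by
    rw [← Ideal.Quotient.eq_zero_iff_mem] at hg ⊢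
    rw [← hmk] at hg
    simpa using hg
  refine exists_hom_of_zeroPart X Y hdeg (fun _ _ h => h) (coordMap_one e e' hθ)
    (coordMap_mem e e' θ) (coordMap_apply_mem e e' θ)
    (fun x => by rw [← coordMap_zeroPart, zeroPart_Q hneg, map_zero])
    (fun v hv => coordMap_ι e e' hcoord hv) fun x hx v hv hQ => ?_
  change Y.q (G x) = v
  have hGx := hG.map_degree hx
  have hz := wcomp_mem_degree 2 hGx
  rw [hY _ hGx]
  have hqx : X.q x = v := by
    change proj 𝒱 (X.Q x) = v
    rw [hQ, proj_ι]
  have hq1 : X.q (wcomp 𝒱 2 (G x)) ∈ 𝒱 1 := by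
    have := X.q_mem hz
    rwa [zero_add] at this
  suffices h : ∀ φ : Module.Dual K (𝒱 1),
      φ (degreeProj 𝒱 1 (X.q (wcomp 𝒱 2 (G x)))) = φ (degreeProj 𝒱 1 (X.q x)) by
    have h1 : degreeProj 𝒱 1 (X.q (wcomp 𝒱 2 (G x))) = degreeProj 𝒱 1 v := by
      rw [← sub_eq_zero, ← Module.forall_dual_apply_eq_zero_iff K]
      intro φ
      rw [map_sub, h, hqx, sub_self]
    rw [degreeProj_of_mem hq1, degreeProj_of_mem hv] at h1
    exact congrArg Subtype.val h1
  intro φ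
  -- `G` is injective in degree 0, so `φ ∘ q` extends along it to a functional `c`; its series pulls
  -- back to a Kuranishi series and therefore lies in `J`.
  obtain ⟨c, hc⟩ := LinearMap.exists_comp_eq_of_ker_le_ker (G ∘ₗ (degree 𝒱 0).subtype)
    ((φ ∘ₗ degreeProj 𝒱 1 ∘ₗ X.q) ∘ₗ (degree 𝒱 0).subtype) fun y hy => by
      have : y = 0 := Subtype.ext (hG.eq_zero_of_map_eq_zero hneg hlin y.2 hy)
      rw [this]; exact Submodule.zero_mem _
  have hc' : ∀ y ∈ degree 𝒱 0, functional e' (series e' c) (G y) =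
      φ (degreeProj 𝒱 1 (X.q y)) := fun y hy => by
    rw [functional_series, zeroPart_of_mem hneg le_rfl (hG.map_degree hy)]
    exact LinearMap.congr_fun hc ⟨y, hy⟩
  have hg : series e' c ∈ J := hIJ _ (by
    have : pullback e e' hG (series e' c) = X.kuranishiSeries e φ := by
      rw [kuranishiSeries_eq, pullback_apply]
      exact series_congr e hc'
    rw [this]
    exact Ideal.subset_span ⟨φ, rfl⟩)
  -- Having identity linear part, `G` moves an element of weight two only by terms of weight at most
  -- one, which `c`, of order at least two, does not see.
  have hfil : G (wcomp 𝒱 2 (G x)) - wcomp 𝒱 2 (G x) ∈ fil 𝒱 1 := by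
    refine mem_fil_of_wcomp_eq_zero (Submodule.sub_mem _ (hG.map_mem_fil (wcomp_mem_fil _))
      (wcomp_mem_fil _)) ?_
    rw [map_sub, hG.wcomp_apply (wcomp_mem_fil _),
      GSym.map_congr (hψ := fun _ _ h => component_mem h) hlin, wcomp_wcomp_self, sub_eq_zero]
    exact zeroPart_of_mem hneg le_rfl hz
  have hker := functional_eq_zero_of_mem_fil e' (f := series e' c) (k := 1) (fun I hI =>
    mem_orderIdeal.1 (span_le_orderIdeal hS hg) I (by omega)) hfil
  rw [map_sub, sub_eq_zero] at hker
  -- With `z` the weight-two part of `G x`: `φ (q z) = c (G z) = c z = c (G x) = φ (q x)`.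
  rw [← hc' _ hz, hker, functional_wcomp_two hS X hneg hG hJI hx hQ hg, hc' x hx]

end Quadratic

end LInftyOne

/-! ### Weight components of products, and algebras with only a binary bracket. -/

namespace GSym

variable {K : Type u} [Field K]
variable {V : Type v} [AddCommGroup V] [Module K V] {𝒱 : ℤ → Submodule K V}
  [DirectSum.Decomposition 𝒱]

theorem wcomp_list_prod (k : ℕ) (l : List V) : wcomp 𝒱 k (l.map (ι 𝒱)).prod =
    if l.length = k then (l.map (ι 𝒱)).prod else 0 := by
  induction l generalizing k with
  | nil => simp [wcomp_one, eq_comm]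
  | cons v l ih =>
    rw [List.map_cons, List.prod_cons]
    rcases k with _ | k
    · simp [wcomp_zero_ι_mul]
    · rw [wcomp_succ_ι_mul, ih]
      simp [mul_ite]

theorem wcomp_mem_span (k : ℕ) (x : GSym 𝒱) : wcomp 𝒱 k x ∈ Submodule.span K
    (Set.range fun v : Fin k → V => (List.ofFn fun i => ι 𝒱 (v i)).prod) := by
  induction x using induction generalizing k with
  | one =>
    rw [wcomp_one]
    split_ifs with h
    · subst h
      exact Submodule.subset_span ⟨Fin.elim0, by simp⟩
    · exact Submodule.zero_mem _
  | add x y hx hy => rw [map_add]; exact Submodule.add_mem _ (hx k) (hy k)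
  | smul c x hx => rw [map_smul]; exact Submodule.smul_mem _ _ (hx k)
  | ι_mul i v hv x hx =>
    rcases k with _ | k
    · rw [wcomp_zero_ι_mul]; exact Submodule.zero_mem _
    · rw [wcomp_succ_ι_mul]
      have h := Submodule.mem_map_of_mem (f := LinearMap.mulLeft K (ι 𝒱 v)) (hx k)
      rw [Submodule.map_span] at h
      refine Submodule.span_mono ?_ h
      rintro _ ⟨_, ⟨w, rfl⟩, rfl⟩
      exact ⟨Fin.cons v w, by simp [List.ofFn_succ]⟩

end GSym

namespace LInftyOne

open GSym MvPowerSeries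

variable {K : Type u} [Field K] [CharZero K]
variable {V : Type v} [AddCommGroup V] [Module K V] {𝒱 : ℤ → Submodule K V}
  [DirectSum.Decomposition 𝒱]

theorem q_wcomp_eq_zero (X : LInftyOne 𝒱) {k : ℕ} (h : ∀ v, X.taylor k v = 0) (x : GSym 𝒱) :
    X.q (wcomp 𝒱 k x) = 0 := by
  refine (Submodule.span_le.2 ?_ : _ ≤ LinearMap.ker X.q) (wcomp_mem_span k x)
  rintro _ ⟨v, rfl⟩
  exact h v

theorem isMinimal_of_taylor_one (X : LInftyOne 𝒱) (h : ∀ v, X.taylor 1 v = 0) : X.IsMinimal :=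
  LinearMap.ext fun v => by
    have := X.q_wcomp_eq_zero h (ι 𝒱 v)
    rwa [wcomp_ι, if_pos rfl] at this

/-- The Kuranishi algebra of an `L∞[1]` algebra whose only bracket is the binary one is
quadratic. -/
theorem isQuadraticAlgebra_of_taylor (X : LInftyOne 𝒱) (h : ∀ k, k ≠ 2 → ∀ v, X.taylor k v = 0)
    {n : ℕ} (e : Module.Basis (Fin n) K (𝒱 0)) : IsQuadraticAlgebra K (X.KuranishiAlgebra e) := by
  have hcoeff : ∀ (φ : Module.Dual K (𝒱 1)) (I : Fin n →₀ ℕ), I.degree ≠ 2 →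
      coeff I (X.kuranishiSeries e φ) = 0 := fun φ I hI => by
    have h1 := X.q_wcomp_eq_zero (h _ hI) (mono e I)
    rw [wcomp_mono, if_pos rfl] at h1
    rw [kuranishiSeries_eq, coeff_series, LinearMap.comp_apply, LinearMap.comp_apply, h1, map_zero,
      map_zero, mul_zero]
  let p : Module.Dual K (𝒱 1) → MvPolynomial (Fin n) K := fun φ =>
    -- Only coefficients of degree two are nonzero, so truncation below degree three loses nothing.
    truncTotal 3 (X.kuranishiSeries e φ)
  have hp : ∀ φ I, MvPolynomial.coeff I (p φ) = coeff I (X.kuranishiSeries e φ) := fun φ I => by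
    rcases lt_or_ge I.degree 3 with hI | hI
    · exact coeff_truncTotal _ hI
    · rw [hcoeff φ I (by omega)]
      exact coeff_truncTotal_eq_zero _ hI
  refine ⟨n, Set.range p, ?_, ⟨Ideal.quotientEquivAlgOfEq K ?_⟩⟩
  · rintro _ ⟨φ, rfl⟩ d hd
    by_contra hne
    refine hd ?_
    rw [hp, hcoeff φ d]
    rwa [Finsupp.degree_eq_weight_one]
  · rw [kuranishiIdeal, ← Set.range_comp]
    congr 2
    funext φ
    exact MvPowerSeries.ext fun I => by rw [Function.comp_apply, MvPolynomial.coeff_coe, hp]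

/-! ### The binary bracket induced on cohomology. -/

section Cohomology

variable (X : LInftyOne 𝒱) (c : GCohomology.Contraction 𝒱 X.q₁)

theorem extend_ι_mul_ι_eq_zero {d : V →ₗ[K] V}
    (hd : ∀ ⦃i : ℤ⦄ ⦃v : V⦄, v ∈ 𝒱 i → d v ∈ 𝒱 (i + 1)) {v w : V} (hv : d v = 0) (hw : d w = 0) :
    extend 𝒱 d (ι 𝒱 v * ι 𝒱 w) = 0 := by
  classical
  conv_lhs => rw [← DirectSum.sum_support_decompose 𝒱 v]
  rw [map_sum, Finset.sum_mul, map_sum]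
  refine Finset.sum_eq_zero fun i _ => ?_
  have h1 : d (DirectSum.decompose 𝒱 v i : V) = 0 := by
    have := GCohomology.map_component hd i v
    rwa [hv, map_zero] at this
  rw [extend_ι_mul hd (DirectSum.decompose 𝒱 v i).2, h1, map_zero, zero_mul, extend_ι, hw,
    map_zero, mul_zero, smul_zero, add_zero]

/-- The weight-two term of `Q (v w)` is the derivation induced by `q₁`, which kills products of
cocycles. -/
theorem Q_ι_mul_ι {v w : V} (hv : X.q₁ v = 0) (hw : X.q₁ w = 0) :
    X.Q (ι 𝒱 v * ι 𝒱 w) = ι 𝒱 (X.q (ι 𝒱 v * ι 𝒱 w)) := by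
  have h2 : ι 𝒱 v * ι 𝒱 w ∈ fil 𝒱 2 := ι_mul_mem_fil v (ι_mem_fil w)
  have hw2 : wcomp 𝒱 2 (ι 𝒱 v * ι 𝒱 w) = ι 𝒱 v * ι 𝒱 w := by
    rw [wcomp_succ_ι_mul, wcomp_ι, if_pos rfl]
  have h1 : X.Q (ι 𝒱 v * ι 𝒱 w) ∈ fil 𝒱 1 := by
    refine mem_fil_of_wcomp_eq_zero (X.Q_mem_fil h2) ?_
    rw [X.wcomp_Q le_rfl h2, hw2, extend_ι_mul_ι_eq_zero X.q₁_mem hv hw]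
  conv_lhs => rw [eq_of_mem_fil_one h1, counit_Q, map_zero, zero_add]
  rfl

/-- Applying `G` to `Q (v w) = ι (q₂ (v, w))` gives `π (q₂ (v, w)) = r (G (v w))`; by minimality
only the weight-two term `[v] [w]` of `G (v w)` contributes. -/
theorem q_ι_mul_ι_of_hom {R : LInftyOne X.cohomologyDegree} (hR : R.IsMinimal) {G : Hom X R}
    (hG : G.f₁ = c.π) (v w : LinearMap.ker X.q₁) :
    ∃ z : LinearMap.ker X.q₁, (z : V) = X.q (ι 𝒱 v * ι 𝒱 w) ∧
      R.q (ι X.cohomologyDegree (GCohomology.mk X.q₁ v) *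
        ι X.cohomologyDegree (GCohomology.mk X.q₁ w)) = GCohomology.mk X.q₁ z := by
  have hQ := X.Q_ι_mul_ι v.2 w.2
  have hz : X.q₁ (X.q (ι 𝒱 v * ι 𝒱 w)) = 0 := by
    have h := congrArg X.Q hQ
    rw [X.Q_Q, X.Q_ι] at h
    simpa [proj_ι] using (congrArg (proj 𝒱) h).symm
  refine ⟨⟨_, hz⟩, rfl, ?_⟩
  have hkill : ∀ y ∈ fil X.cohomologyDegree 1, R.q y = 0 := fun y hy => by
    rw [map_linear_of_mem_fil_one R.q_one hy, q_ι, hR, LinearMap.zero_apply]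
  have h2 : ι 𝒱 (v : V) * ι 𝒱 w ∈ fil 𝒱 2 := ι_mul_mem_fil _ (ι_mem_fil _)
  have hlin : linPart G.F = c.π := hG
  have hw2 : wcomp 𝒱 2 (ι 𝒱 (v : V) * ι 𝒱 w) = ι 𝒱 (v : V) * ι 𝒱 w := by
    rw [wcomp_succ_ι_mul, wcomp_ι, if_pos rfl]
  have htop : wcomp X.cohomologyDegree 2 (G.F (ι 𝒱 v * ι 𝒱 w)) =
      ι X.cohomologyDegree (GCohomology.mk X.q₁ v) *
        ι X.cohomologyDegree (GCohomology.mk X.q₁ w) := by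
    rw [G.isCoalgHom.wcomp_apply h2, GSym.map_congr (hψ := c.π_mem) hlin, hw2, map_mul, map_ι,
      map_ι, c.π_ker, c.π_ker]
  have h3 := hkill _ (sub_wcomp_mem_fil (n := 1) (G.isCoalgHom.map_mem_fil h2))
  rw [map_sub, sub_eq_zero, htop] at h3
  rw [← h3, ← c.π_ker]
  change proj _ (R.Q (G.F _)) = _
  rw [← G.comm_apply, hQ, ← hG]
  rfl

theorem isCohomologyStructure_of_q {R Y : LInftyOne X.cohomologyDegree} (hR : R.IsMinimal)
    {G : Hom X R} (hG : G.f₁ = c.π) (hY : ∀ x, Y.q x = R.q (wcomp X.cohomologyDegree 2 x)) :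
    X.IsCohomologyStructure Y := by
  constructor
  · intro k hk v
    change Y.q _ = 0
    have h := wcomp_list_prod (𝒱 := X.cohomologyDegree) 2 (List.ofFn v)
    rw [List.map_ofFn, List.length_ofFn, if_neg hk] at h
    rw [hY]
    exact (congrArg R.q h).trans (map_zero _)
  · intro v w
    obtain ⟨z, hz, hz'⟩ := X.q_ι_mul_ι_of_hom c hR hG v w
    refine ⟨z, ?_, ?_⟩
    · rw [hz]
      change _ = X.q _
      simp
    · rw [← hz']
      change Y.q _ = _
      rw [hY]
      congr 1
      simp [wcomp_succ_ι_mul, wcomp_ι]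

end Cohomology

end LInftyOne

/-! ### Assembly of the theorem. -/

theorem IsQuadraticAlgebra.congr {K : Type*} [Field K] {A B : Type*} [CommRing A] [Algebra K A]
    [CommRing B] [Algebra K B] (E : A ≃ₐ[K] B) (h : IsQuadraticAlgebra K A) :
    IsQuadraticAlgebra K B := by
  obtain ⟨n, S, hS, ⟨ρ⟩⟩ := h
  exact ⟨n, S, hS, ⟨E.symm.trans ρ⟩⟩

theorem eq_bot_of_map_injective {K V W : Type*} [Field K] [AddCommGroup V] [Module K V]
    [AddCommGroup W] [Module K W] {P : Submodule K V} {P' : Submodule K W} {f : V →ₗ[K] W}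
    (hf : Function.Injective f) (h : ∀ v ∈ P, f v ∈ P') (hP : P' = ⊥) : P = ⊥ := by
  rw [Submodule.eq_bot_iff]
  intro v hv
  have := h v hv
  rw [hP, Submodule.mem_bot] at this
  exact hf (this.trans (map_zero f).symm)

end

theorem mainTheorem5 {K : Type u} [Field K] [CharZero K]
    {V : Type v} [AddCommGroup V] [Module K V]
    (𝒱 : ℤ → Submodule K V) [DirectSum.Decomposition 𝒱] (X : LInftyOne 𝒱)
    (hfin : FiniteDimensional K X.TangentCohomology)
    (hdeg : ∀ i : ℤ, i ≠ 0 → i ≠ 1 → X.cohomologyDegree i = ⊥) :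
    (∃ (R : LInftyOne X.cohomologyDegree) (F : LInftyOne.Hom R X), X.IsMinimalModel F) ∧
    ∀ {W : Type w} [AddCommGroup W] [Module K W]
      (𝒲 : ℤ → Submodule K W) [DirectSum.Decomposition 𝒲]
      (R : LInftyOne 𝒲) (F : LInftyOne.Hom R X), X.IsMinimalModel F →
      ∀ {n : ℕ} (e : Module.Basis (Fin n) K (𝒲 0)),
        (X.IsFormal ↔ IsQuadraticAlgebra K (R.KuranishiAlgebra e)) := by
  obtain ⟨c⟩ := GCohomology.exists_contraction X.q₁_mem X.q₁_q₁
  obtain ⟨r, h0, h1, hr1, hrι, G, hG⟩ := X.exists_hom_cohomology c hdeg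
  have hmin : (LInftyOne.ofZeroPart r h0 h1 hr1).IsMinimal := LinearMap.ext fun v => by
    rw [← LInftyOne.q_ι, LInftyOne.q_ofZeroPart, hrι, LinearMap.zero_apply]
  refine ⟨?_, ?_⟩
  · obtain ⟨F, hF⟩ := X.exists_hom_of_cohomology c G hG
    exact ⟨_, F, hmin, X.isWeakEquivalence_of_f₁_eq_i c hmin hF⟩
  intro W _ _ 𝒲 _ R F hF n e
  have hneg : ∀ i < 0, X.cohomologyDegree i = ⊥ := fun i hi => hdeg i (by omega) (by omega)
  have hGw := X.isWeakEquivalence_of_f₁_eq_π c hmin hG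
  -- Any minimal model is isomorphic to the one on `H`, so `W` inherits finite dimension and the
  -- absence of negative degrees.
  have hbij := (hGw.comp hF.2).bijective hF.1 hmin
  have hWneg : ∀ i < 0, 𝒲 i = ⊥ := fun i hi =>
    eq_bot_of_map_injective hbij.1 (fun v hv => (G.comp F).isCoalgHom.linPart_mem hv) (hneg i hi)
  have hWfin : FiniteDimensional K W := Module.Finite.of_injective _ hbij.1
  let e' := Module.finBasis K (X.cohomologyDegree 0)
  constructor
  · rintro ⟨R₂, ⟨hR₂, -⟩, F₂, hF₂⟩
    have hmin₂ := R₂.isMinimal_of_taylor_one (hR₂ 1 (by norm_num))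
    obtain ⟨E⟩ := LInftyOne.Hom.kuranishiAlgebra_equiv e e' hWneg hneg (F₂.comp F)
      ((hF₂.comp hF.2).bijective hF.1 hmin₂)
    exact (R₂.isQuadraticAlgebra_of_taylor hR₂ e').congr E.symm
  · intro hquad
    obtain ⟨E⟩ := LInftyOne.Hom.kuranishiAlgebra_equiv e e' hWneg hneg (G.comp F) hbij
    obtain ⟨m, S, hS, ⟨ρ⟩⟩ := hquad.congr E
    have h0' : (r ∘ₗ GSym.wcomp X.cohomologyDegree 2) ∘ₗ (GSym.zeroPart X.cohomologyDegree).toLinearMap =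
        r ∘ₗ GSym.wcomp X.cohomologyDegree 2 := LinearMap.ext fun x => by
      simp only [LinearMap.comp_apply, AlgHom.toLinearMap_apply]
      rw [GSym.zeroPart, GSym.wcomp_map]
      exact LinearMap.congr_fun h0 _
    have hr1' : (r ∘ₗ GSym.wcomp X.cohomologyDegree 2) 1 = 0 := by
      rw [LinearMap.comp_apply, GSym.wcomp_one, if_neg (by norm_num), map_zero]
    -- The quadratic part of the minimal model on `H`, retaining only the binary bracket.
    let R₂ := LInftyOne.ofZeroPart (r ∘ₗ GSym.wcomp X.cohomologyDegree 2) h0' (fun x => h1 _) hr1'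
    have hq : ∀ x, R₂.q x = (LInftyOne.ofZeroPart r h0 h1 hr1).q (GSym.wcomp X.cohomologyDegree 2 x) := fun x => by
      rw [LInftyOne.q_ofZeroPart, LInftyOne.q_ofZeroPart]; rfl
    have hcoh := X.isCohomologyStructure_of_q c hmin hG hq
    obtain ⟨F₂, hF₂⟩ := LInftyOne.exists_hom_quadratic (LInftyOne.ofZeroPart r h0 h1 hr1) R₂ hmin hdeg
      (fun x _ => hq x) hS ρ
    refine ⟨R₂, hcoh, F₂.comp G, X.isWeakEquivalence_of_f₁_eq_π c
      (R₂.isMinimal_of_taylor_one (hcoh.1 1 (by norm_num))) ?_⟩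
    rw [LInftyOne.Hom.comp_f₁, hF₂, hG, LinearMap.id_comp]
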